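/- Let $k$ be a field, let $A$ and $B$ be $k$-algebras (associative and unital, not necessarily finite dimensional), let $M$ be a $B$-$A$-bimodule and $N$ an $A$-$B$-bimodule (with the two actions of $k$ equal). Put $\mathbb A=A\times B$ and $\mathbb M=M\oplus N$, which is an $\mathbb A$-bimodule through $(a,b)(m,n)=(bm,an)$ and $(m,n)(a,b)=(ma,nb)$. The null-square algebra $$\Lambda=\begin{pmatrix}A&N\\M&B\end{pmatrix}$$ is the algebra of such matrices in which all products of an element of $M$ with an element of $N$, in either order, are zero; that is, $\Lambda=\mathbb A\oplus\mathbb M$ with $\mathbb M^2=0$. Assume that $\Lambda$ is projective, i.e. that $\mathbb M$ is a projective $\mathbb A$-bimodule. Let $\mathsf{HH}^n(\Lambda)$ denote Hochschild cohomology with coefficients in $\Lambda$, and likewise for $\mathbb A$. Restricting Hochschild cochains of $\Lambda$ to $\mathbb A$ and composing with the projection $\Lambda\to\mathbb A$ induces linear maps $\pi_n:\mathsf{HH}^n(\Lambda)\to\mathsf{HH}^n(\mathbb A)$. Let $D=k\times k\subset\mathbb A$, let $J^\bullet$ be the complex of Hochschild cochains relative to $D$, with $J^n=\mathrm{Hom}_{D-D}(\Lambda^{\otimes_D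 n},\Lambda)$, and let $D^\bullet\subset J^\bullet$ be the subcomplex of the cochains with values in $\mathbb M$. The short exact sequence $0\to D^\bullet\to J^\bullet\to J^\bullet/D^\bullet\to 0$ has a connecting homomorphism $\nabla_n:H^n(J^\bullet/D^\bullet)\to H^{n+1}(D^\bullet)$. For $\varphi\in\mathrm{Hom}_{\mathbb A-\mathbb A}(\mathbb M^{\otimes_{\mathbb A}n},\mathbb A)$, the composite $\Lambda^{\otimes_D n}\to\mathbb M^{\otimes_{\mathbb A}n}\xrightarrow{\varphi}\mathbb A\subset\Lambda$ is an element of $J^n$ whose coboundary is in $D^{n+1}$; so $\varphi$ has a class in $H^n(J^\bullet/D^\bullet)$. Restriction of cocycles to $\mathbb M\otimes\cdots\otimes\mathbb M$ gives a map $H^{n+1}(D^\bullet)\to\mathrm{Hom}_{\mathbb A-\mathbb A}(\mathbb M^{\otimes_{\mathbb A}n+1},\mathbb M)$. Let $$\nabla'_{2m}:\mathrm{Hom}_{\mathbb A-\mathbb A}(\mathbb M^{\otimes_{\mathbb A}2m},\mathbb A)\longrightarrow\mathrm{Hom}_{\mathbb A-\mathbb A}(\mathbb M^{\otimes_{\mathbb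 A}2m+1},\mathbb M)$$ be the map that $\nabla_{2m}$ induces in this way. Then for every integer $m>0$: 1. there is an isomorphism $\mathsf{HH}^{2m}(\Lambda)\cong\mathsf{HH}^{2m}(\mathbb A)\oplus\ker\nabla'_{2m}$ of vector spaces, whose first component is $\pi_{2m}$; 2. there is a short exact sequence $$0\to\mathrm{Coker}\,\nabla'_{2m}\to\mathsf{HH}^{2m+1}(\Lambda)\xrightarrow{\pi_{2m+1}}\mathsf{HH}^{2m+1}(\mathbb A)\to0.$$ -/

import Mathlib

open CategoryTheory

universe u

set_option linter.unusedSectionVars false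

namespace NullSquare

section Hochschild

variable {k R : Type u} [Field k] [Ring R] [Algebra k R]

lemma succAbove_eq {n : ℕ} (p l : Fin (n + 1)) (hl : l ≠ p) :
    p.succ.succAbove l = p.castSucc.succAbove l := by
  rcases lt_or_gt_of_ne hl with h | h
  · rw [Fin.lt_def] at h
    rw [Fin.succAbove_of_castSucc_lt _ _ (by rw [Fin.lt_def]; simp; omega),
      Fin.succAbove_of_castSucc_lt _ _ (by rw [Fin.lt_def]; simpa using h)]
  · rw [Fin.lt_def] at h
    rw [Fin.succAbove_of_le_castSucc _ _ (by rw [Fin.le_def]; simp; omega),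
      Fin.succAbove_of_le_castSucc _ _ (by rw [Fin.le_def]; simp; omega)]

lemma contractNth_castSucc {α : Type u} {n : ℕ} (op : α → α → α) (i : Fin n) (x : Fin (n + 1) → α) :
    i.castSucc.contractNth op x =
      Function.update (fun l => x (i.castSucc.succAbove l)) i (op (x i.castSucc) (x i.succ)) := by
  funext l
  rcases lt_trichotomy l i with h | rfl | h
  · rw [Fin.contractNth_apply_of_lt _ _ _ _ (by simpa using h), Function.update_of_ne h.ne,
      Fin.succAbove_of_castSucc_lt _ _ (by simpa using h)]
  · rw [Fin.contractNth_apply_of_eq _ _ _ _ (by simp), Function.update_self]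
  · rw [Fin.contractNth_apply_of_gt _ _ _ _ (by simpa using h), Function.update_of_ne h.ne',
      Fin.succAbove_of_le_castSucc _ _ (by simpa using h.le)]

lemma contractNth_succ {α : Type u} {n : ℕ} (op : α → α → α) (i : Fin n) (x : Fin (n + 1) → α) :
    i.castSucc.contractNth op x =
      Function.update (fun l => x (i.succ.succAbove l)) i (op (x i.castSucc) (x i.succ)) := by
  funext l
  rcases lt_trichotomy l i with h | rfl | h
  · rw [Fin.contractNth_apply_of_lt _ _ _ _ (by simpa using h), Function.update_of_ne h.ne,
      Fin.succAbove_of_castSucc_lt _ _ (by rw [Fin.lt_def] at *; simp only [Fin.val_castSucc, Fin.val_succ]; omega)]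
  · rw [Fin.contractNth_apply_of_eq _ _ _ _ (by simp), Function.update_self]
  · rw [Fin.contractNth_apply_of_gt _ _ _ _ (by simpa using h), Function.update_of_ne h.ne',
      Fin.succAbove_of_le_castSucc _ _ (by rw [Fin.lt_def] at h; rw [Fin.le_def]; simp only [Fin.val_castSucc, Fin.val_succ]; omega)]

/-- Changing one entry of a tuple changes one entry of a contraction, in a linear way. -/
lemma contractNth_update {n : ℕ} (i : Fin n) (x : Fin (n + 1) → R) (p : Fin (n + 1)) :
    ∃ (q : Fin n) (L : R →ₗ[k] R), ∀ v, i.castSucc.contractNth (· * ·) (Function.update x p v) =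
      Function.update (i.castSucc.contractNth (· * ·) x) q (L v) := by
  rcases eq_or_ne p i.castSucc with rfl | hp
  · refine ⟨i, LinearMap.mulRight k (x i.succ), fun v => ?_⟩
    rw [contractNth_castSucc, contractNth_castSucc]
    have h : i.succ ≠ i.castSucc := by simp [Fin.ext_iff]
    simp [Function.update_of_ne h]
  · obtain ⟨q, rfl⟩ := Fin.exists_succAbove_eq hp
    rcases eq_or_ne q i with rfl | hq
    · refine ⟨q, LinearMap.mulLeft k (x q.castSucc), fun v => ?_⟩
      rw [contractNth_succ, contractNth_succ]
      have h : q.castSucc.succAbove q = q.succ := by simp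
      have h' : q.castSucc ≠ q.succ := by simp [Fin.ext_iff]
      rw [h]
      simp [Function.update_of_ne h']
    · refine ⟨q, LinearMap.id, fun v => ?_⟩
      rw [contractNth_castSucc, contractNth_castSucc]
      have h : i.succ ≠ i.castSucc.succAbove q := by
        rw [show i.succ = i.castSucc.succAbove i by simp]
        exact fun h => hq (Fin.succAbove_right_injective h).symm
      rw [Function.update_of_ne (Fin.succAbove_ne _ _).symm, Function.update_of_ne h,
        Function.update_comm hq.symm]
      congr 1
      funext l
      by_cases hl : l = q
      · subst hl; simp
      · rw [Function.update_of_ne hl,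
          Function.update_of_ne (fun h => hl (Fin.succAbove_right_injective h))]

variable (k R) in
/-- Hochschild `n`-cochains of `R`: the `k`-linear maps `R ⊗ ⋯ ⊗ R → R` (`n` factors). -/
abbrev Cochain (n : ℕ) : Type u := MultilinearMap k (fun _ : Fin n => R) R

/-- `x₁ ⊗ ⋯ ⊗ xₙ₊₁ ↦ x₁ f(x₂ ⊗ ⋯ ⊗ xₙ₊₁)`. -/
def frontMul {n : ℕ} (f : Cochain k R n) : Cochain k R (n + 1) :=
  MultilinearMap.mk' (fun x => x 0 * f (Fin.tail x))
    (fun x i a b => by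
      refine Fin.cases ?_ (fun j => ?_) i
      · simp [add_mul]
      · simp [mul_add, Function.update_of_ne (Fin.succ_ne_zero j).symm])
    (fun x i c a => by
      refine Fin.cases ?_ (fun j => ?_) i
      · simp
      · simp [Function.update_of_ne (Fin.succ_ne_zero j).symm])

/-- `x₁ ⊗ ⋯ ⊗ xₙ₊₁ ↦ f(x₁ ⊗ ⋯ ⊗ xₙ) xₙ₊₁`. -/
def backMul {n : ℕ} (f : Cochain k R n) : Cochain k R (n + 1) :=
  MultilinearMap.mk' (fun x => f (Fin.init x) * x (Fin.last n))
    (fun x i a b => by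
      refine Fin.lastCases ?_ (fun j => ?_) i
      · simp [mul_add]
      · simp [add_mul, (Fin.castSucc_lt_last j).ne'])
    (fun x i c a => by
      refine Fin.lastCases ?_ (fun j => ?_) i
      · simp
      · simp [(Fin.castSucc_lt_last j).ne'])

/-- `x₁ ⊗ ⋯ ⊗ xₙ₊₁ ↦ f(x₁ ⊗ ⋯ ⊗ xᵢxᵢ₊₁ ⊗ ⋯ ⊗ xₙ₊₁)`; the index `i` starts at `0` in the code. -/
def contractMul {n : ℕ} (i : Fin n) (f : Cochain k R n) : Cochain k R (n + 1) :=
  MultilinearMap.mk' (fun x => f (i.castSucc.contractNth (· * ·) x))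
    (fun x p a b => by
      obtain ⟨q, L, h⟩ := contractNth_update (k := k) i x p
      simp [h])
    (fun x p c a => by
      obtain ⟨q, L, h⟩ := contractNth_update (k := k) i x p
      simp [h])

variable (k R) in
/-- The Hochschild coboundary. -/
def coboundary (n : ℕ) : Cochain k R n →ₗ[k] Cochain k R (n + 1) where
  toFun f := frontMul f + ∑ i : Fin n, (-1 : k) ^ ((i : ℕ) + 1) • contractMul i f
    + (-1 : k) ^ (n + 1) • backMul f
  map_add' f g := by
    ext x
    simp [frontMul, backMul, contractMul, mul_add, add_mul, Finset.sum_add_distrib]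
    abel
  map_smul' c f := by
    ext x
    simp [frontMul, backMul, contractMul, Finset.smul_sum, smul_comm c]

lemma coboundary_apply {n : ℕ} (f : Cochain k R n) (x : Fin (n + 1) → R) :
    coboundary k R n f x = x 0 * f (Fin.tail x)
      + ∑ i : Fin n, (-1 : k) ^ ((i : ℕ) + 1) • f (i.castSucc.contractNth (· * ·) x)
      + (-1 : k) ^ (n + 1) • (f (Fin.init x) * x (Fin.last n)) := by
  simp [coboundary, frontMul, backMul, contractMul]

/-- Auxiliary: `y₀ ⊗ ⋯ ⊗ yₙ₊₁ ↦ y₀ f(y₁ ⊗ ⋯ ⊗ yₙ) yₙ₊₁`. -/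
def ends {n : ℕ} (f : Cochain k R n) (y : Fin (n + 2) → R) : R :=
  y 0 * f (fun i => y i.succ.castSucc) * y (Fin.last (n + 1))

lemma ends_coboundary {n : ℕ} (f : Cochain k R n) (y : Fin (n + 3) → R) :
    ends (coboundary k R n f) y = ∑ j : Fin (n + 2),
      (-1 : k) ^ (j : ℕ) • ends f (j.castSucc.contractNth (· * ·) y) := by
  rw [Fin.sum_univ_succ, Fin.sum_univ_castSucc]
  simp only [ends, coboundary_apply, mul_add, add_mul, Finset.mul_sum, Finset.sum_mul]
  rw [← add_assoc]
  congr 1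
  · congr 1
    · simp [Fin.contractNth, mul_assoc]
      rfl
    · refine Finset.sum_congr rfl fun i _ => ?_
      have h1 : ¬ n < (i : ℕ) := by omega
      have h2 : ¬ n = (i : ℕ) := by omega
      simp only [mul_smul_comm, smul_mul_assoc]
      simp [Fin.contractNth, h1, h2]
      rfl
  · simp [Fin.contractNth, mul_assoc]
    rfl

lemma eq_ends {n : ℕ} (f : Cochain k R n) (x : Fin n → R) :
    f x = ends f (Fin.cons (α := fun _ => R) 1 (Fin.snoc (α := fun _ => R) x 1)) := by
  have h : Fin.last (n + 1) = (Fin.last n).succ := rfl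
  simp only [ends, Fin.cons_zero, h, Fin.cons_succ, Fin.snoc_last, one_mul, mul_one]
  congr 1
  funext i
  rw [← Fin.succ_castSucc, Fin.cons_succ, Fin.snoc_castSucc]

lemma contractNth_contractNth {n : ℕ} (i j : Fin (n + 1)) (h : j ≤ i) (y : Fin (n + 3) → R) :
    i.castSucc.contractNth (· * ·) (j.castSucc.castSucc.contractNth (· * ·) y) =
      j.castSucc.contractNth (· * ·) (i.succ.castSucc.contractNth (· * ·) y) := by
  funext l
  rw [Fin.le_def] at h
  simp only [Fin.contractNth, Fin.val_castSucc, Fin.val_succ]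
  split_ifs <;> first | omega | rfl | simp [mul_assoc]

theorem coboundary_coboundary {n : ℕ} (f : Cochain k R n) :
    coboundary k R (n + 1) (coboundary k R n f) = 0 := by
  ext x
  rw [eq_ends, zero_apply]
  generalize (Fin.cons (α := fun _ => R) 1 (Fin.snoc (α := fun _ => R) x 1)) = y
  simp only [ends_coboundary, Finset.smul_sum]
  rw [Finset.sum_sigma']
  refine Finset.sum_involution
    (fun a _ => if h : (a.1 : ℕ) ≤ a.2 then ⟨a.2.succ, ⟨a.1, by omega⟩⟩
      else ⟨⟨a.2, by omega⟩, ⟨a.1 - 1, by omega⟩⟩) ?_ ?_ ?_ ?_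
  · rintro ⟨j, i⟩ -
    by_cases h : (j : ℕ) ≤ i
    · obtain ⟨j, rfl⟩ : ∃ j' : Fin (n + 2), j = j'.castSucc := ⟨⟨j, by omega⟩, rfl⟩
      simp only [h, dite_true]
      rw [contractNth_contractNth i j (by simpa using h)]
      simp [pow_succ, smul_smul, mul_comm]
    · obtain ⟨j, rfl⟩ : ∃ j' : Fin (n + 2), j = j'.succ :=
        ⟨⟨j - 1, by omega⟩, by ext; simp; omega⟩
      simp only [h, dite_false]
      have h' : i ≤ j := by
        rw [Fin.le_def]
        rw [Fin.val_succ] at h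
        omega
      have e := contractNth_contractNth j i h' y
      simp only [Fin.val_succ, Nat.add_sub_cancel]
      rw [show (⟨(i : ℕ), by omega⟩ : Fin (n + 3)) = i.castSucc from rfl]
      simp only [Fin.eta]
      rw [e]
      simp [pow_succ, smul_smul, mul_comm]
  · rintro ⟨j, i⟩ - - h
    by_cases h' : (j : ℕ) ≤ i
    · simp [h', Fin.ext_iff] at h
      omega
    · simp [h', Fin.ext_iff] at h
      omega
  · intros; simp
  · rintro ⟨j, i⟩ -
    by_cases h' : (j : ℕ) ≤ i
    · have h2 : ¬ (i : ℕ) + 1 ≤ j := by omega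
      simp [h', h2]
    · have h2 : (i : ℕ) ≤ j - 1 := by omega
      simp [h', h2, Fin.ext_iff]
      omega

lemma contractNth_balanced {n : ℕ} (j p : Fin (n + 2)) (hp : p ≠ j) (y : Fin (n + 3) → R) (d : R) :
    ∃ q : Fin (n + 1), ∀ z, z = j.castSucc.contractNth (· * ·) y →
      j.castSucc.contractNth (· * ·) (Function.update y p.castSucc (y p.castSucc * d)) =
        Function.update z q.castSucc (z q.castSucc * d) ∧
      j.castSucc.contractNth (· * ·) (Function.update y p.succ (d * y p.succ)) =
        Function.update z q.succ (d * z q.succ) := by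
  have close (q : Fin (n + 1)) (l : Fin (n + 2)) :
      l = q.castSucc ∨ l = q.succ ∨ ((l : ℕ) ≠ q ∧ (l : ℕ) ≠ q + 1) := by
    by_cases h1 : (l : ℕ) = q
    · exact Or.inl (Fin.ext h1)
    by_cases h2 : (l : ℕ) = q + 1
    · exact Or.inr (Or.inl (Fin.ext h2))
    exact Or.inr (Or.inr ⟨h1, h2⟩)
  rcases lt_or_gt_of_ne hp with h | h
  · obtain ⟨q, rfl⟩ := Fin.exists_castSucc_eq.mpr (Fin.ne_last_of_lt h)
    rw [Fin.lt_def, Fin.val_castSucc] at h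
    refine ⟨q, ?_⟩
    rintro z rfl
    rcases eq_or_ne j q.succ with rfl | hj
    · constructor <;> funext l <;> rcases close q l with rfl | rfl | h3 <;>
      simp only [Fin.contractNth, Function.update_apply, Fin.ext_iff, Fin.val_castSucc,
        Fin.val_succ] <;>
      split_ifs <;> first | omega | rfl | simp [mul_assoc]
    · replace hj : (j : ℕ) ≠ q + 1 := fun e => hj (Fin.ext e)
      constructor <;> funext l <;> rcases close q l with rfl | rfl | h3 <;>
      simp only [Fin.contractNth, Function.update_apply, Fin.ext_iff, Fin.val_castSucc,
        Fin.val_succ] at * <;>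
      split_ifs <;> first | omega | rfl
  · obtain ⟨q, rfl⟩ := Fin.exists_succ_eq.mpr (Fin.ne_zero_of_lt h)
    replace h : (j : ℕ) < q + 1 := by simpa [Fin.lt_def] using h
    refine ⟨q, ?_⟩
    rintro z rfl
    rcases eq_or_ne j q.castSucc with rfl | hj
    · constructor <;> funext l <;> rcases close q l with rfl | rfl | h3 <;>
      simp only [Fin.contractNth, Function.update_apply, Fin.ext_iff, Fin.val_castSucc,
        Fin.val_succ] <;>
      split_ifs <;> first | omega | rfl | simp [mul_assoc]
    · replace hj : (j : ℕ) ≠ q := fun e => hj (Fin.ext e)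
      constructor <;> funext l <;> rcases close q l with rfl | rfl | h3 <;>
      simp only [Fin.contractNth, Function.update_apply, Fin.ext_iff, Fin.val_castSucc,
        Fin.val_succ] at * <;>
      split_ifs <;> first | omega | rfl

/-- Cochains relative to a subalgebra `D`: the `D`-bimodule maps `R ⊗_D ⋯ ⊗_D R → R` (`n` factors),
that is, the multilinear maps that are `D`-balanced in consecutive arguments and linear for the
outer left and right actions of `D`; for `n = 0`, the elements of `R` commuting with `D`. -/
def relCochains (D : Subalgebra k R) : (n : ℕ) → Submodule k (Cochain k R n)
  | 0 =>
    { carrier := {f | ∀ d ∈ D, ∀ x, d * f x = f x * d}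
      add_mem' := fun {f g} hf hg d hd x => by simp [mul_add, add_mul, hf d hd x, hg d hd x]
      zero_mem' := fun d _ x => by simp
      smul_mem' := fun c f hf d hd x => by simp [hf d hd x] }
  | n + 1 =>
    { carrier := {f | ∀ d ∈ D, ∀ x : Fin (n + 1) → R,
        f (Function.update x 0 (d * x 0)) = d * f x ∧
        (∀ i : Fin n, f (Function.update x i.castSucc (x i.castSucc * d)) =
          f (Function.update x i.succ (d * x i.succ))) ∧
        f (Function.update x (Fin.last n) (x (Fin.last n) * d)) = f x * d}
      add_mem' := fun {f g} hf hg d hd x => by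
        obtain ⟨h1, h2, h3⟩ := hf d hd x
        obtain ⟨h1', h2', h3'⟩ := hg d hd x
        refine ⟨by simp [h1, h1', mul_add], fun i => by simp [h2, h2'],
          by simp [h3, h3', add_mul]⟩
      zero_mem' := fun d _ x => by simp
      smul_mem' := fun c f hf d hd x => by
        obtain ⟨h1, h2, h3⟩ := hf d hd x
        refine ⟨by simp [h1], fun i => by simp [h2], by simp [h3]⟩ }

lemma ends_update_zero {n : ℕ} (f : Cochain k R n) (y : Fin (n + 2) → R) (v : R) :
    ends f (Function.update y 0 v) =
      v * f (fun i => y i.succ.castSucc) * y (Fin.last (n + 1)) := by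
  have h (i : Fin n) : i.succ.castSucc ≠ 0 := by simp [Fin.ext_iff]
  have h' : Fin.last (n + 1) ≠ 0 := by simp [Fin.ext_iff]
  simp only [ends, Function.update_of_ne h', Function.update_of_ne (h _), Function.update_self]

lemma ends_update_last {n : ℕ} (f : Cochain k R n) (y : Fin (n + 2) → R) (v : R) :
    ends f (Function.update y (Fin.last (n + 1)) v) =
      y 0 * f (fun i => y i.succ.castSucc) * v := by
  have h (i : Fin n) : i.succ.castSucc ≠ Fin.last (n + 1) := (Fin.castSucc_lt_last _).ne
  have h' : 0 ≠ Fin.last (n + 1) := by simp [Fin.ext_iff]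
  simp only [ends, Function.update_of_ne h', Function.update_of_ne (h _), Function.update_self]

lemma ends_update_mid {n : ℕ} (f : Cochain k R n) (y : Fin (n + 2) → R) (i : Fin n) (v : R) :
    ends f (Function.update y i.succ.castSucc v) =
      y 0 * f (Function.update (fun i => y i.succ.castSucc) i v) * y (Fin.last (n + 1)) := by
  have h : Fin.last (n + 1) ≠ i.succ.castSucc := (Fin.castSucc_lt_last _).ne'
  have h' : 0 ≠ i.succ.castSucc := by simp [Fin.ext_iff]
  simp only [ends, Function.update_of_ne h, Function.update_of_ne h']
  congr 3
  funext l
  by_cases hl : l = i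
  · subst hl; simp
  · rw [Function.update_of_ne hl, Function.update_of_ne (by simpa [Fin.ext_iff] using hl)]

lemma mem_relCochains_iff {D : Subalgebra k R} {n : ℕ} {f : Cochain k R n} :
    f ∈ relCochains D n ↔ ∀ d ∈ D, ∀ (y : Fin (n + 2) → R) (p : Fin (n + 1)),
      ends f (Function.update y p.castSucc (y p.castSucc * d)) =
        ends f (Function.update y p.succ (d * y p.succ)) := by
  cases n with
  | zero =>
    constructor
    · intro hf d hd y p
      obtain rfl : p = 0 := Subsingleton.elim (α := Fin 1) _ _
      have h := hf d hd (fun i => y i.succ.castSucc)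
      rw [show Fin.succ (0 : Fin 1) = Fin.last (0 + 1) from rfl, ends_update_last,
        Fin.castSucc_zero, ends_update_zero, mul_assoc _ d, h]
      simp [mul_assoc]
    · intro hf d hd x
      have h := hf d hd (fun _ => 1) 0
      rw [show Fin.succ (0 : Fin 1) = Fin.last (0 + 1) from rfl, ends_update_last,
        Fin.castSucc_zero, ends_update_zero] at h
      rw [Subsingleton.elim x (fun i => 1)]
      simpa using h
  | succ n =>
    constructor
    · intro hf d hd y p
      obtain ⟨h1, h2, h3⟩ := hf d hd (fun i => y i.succ.castSucc)
      refine Fin.cases ?_ (fun p => ?_) p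
      · rw [Fin.castSucc_zero, ends_update_zero, show Fin.succ (0 : Fin (n + 2)) =
          (Fin.succ (0 : Fin (n + 1))).castSucc from rfl, ends_update_mid, h1]
        simp [mul_assoc]
      · refine Fin.lastCases ?_ (fun p => ?_) p
        · rw [ends_update_mid, h3, Fin.succ_last, Fin.succ_last, ends_update_last]
          simp [mul_assoc]
        · rw [ends_update_mid, h2, show p.castSucc.succ.succ = p.succ.succ.castSucc from rfl,
            ends_update_mid]
    · intro hf d hd x
      have key := hf d hd (Fin.cons (α := fun _ => R) 1 (Fin.snoc (α := fun _ => R) x 1))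
      set y : Fin (n + 1 + 2) → R :=
        Fin.cons (α := fun _ => R) 1 (Fin.snoc (α := fun _ => R) x 1) with hy
      have hx : x = fun i => y i.succ.castSucc := by
        funext i
        rw [hy, ← Fin.succ_castSucc, Fin.cons_succ, Fin.snoc_castSucc]
      have h0 : y 0 = 1 := rfl
      have hl : y (Fin.last (n + 1 + 1)) = 1 := by
        rw [hy, ← Fin.succ_last, Fin.cons_succ, Fin.snoc_last]
      refine ⟨?_, fun i => ?_, ?_⟩
      · have h := key 0
        rw [Fin.castSucc_zero, ends_update_zero, show Fin.succ (0 : Fin (n + 2)) =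
          (Fin.succ (0 : Fin (n + 1))).castSucc from rfl, ends_update_mid, ← hx] at h
        simpa [h0, hl, congrFun hx 0] using h.symm
      · have h := key i.succ.castSucc
        rw [show i.succ.castSucc.castSucc = i.castSucc.succ.castSucc from rfl, ends_update_mid,
          show i.succ.castSucc.succ = i.succ.succ.castSucc from rfl, ends_update_mid, ← hx] at h
        simpa [h0, hl, congrFun hx _] using h
      · have h := key (Fin.last n).succ
        rw [ends_update_mid, Fin.succ_last, Fin.succ_last, ends_update_last, ← hx] at h
        simpa [h0, hl, congrFun hx (Fin.last n)] using h

lemma coboundary_mem_relCochains {D : Subalgebra k R} {n : ℕ} {f : Cochain k R n}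
    (hf : f ∈ relCochains D n) : coboundary k R n f ∈ relCochains D (n + 1) := by
  rw [mem_relCochains_iff] at hf ⊢
  intro d hd y p
  rw [ends_coboundary, ends_coboundary]
  refine Finset.sum_congr rfl fun j _ => ?_
  congr 1
  by_cases hp : p = j
  · subst hp
    congr 1
    rw [contractNth_succ, contractNth_castSucc]
    have h1 : p.castSucc ≠ p.succ := by simp [Fin.ext_iff]
    simp only [Function.update_self, Function.update_of_ne h1, Function.update_of_ne h1.symm,
      mul_assoc]
    funext l
    rcases eq_or_ne l p with rfl | hl
    · simp
    · have h2 := succAbove_eq p l hl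
      have h3 : p.succ.succAbove l ≠ p.castSucc := by
        rw [h2]; exact Fin.succAbove_ne _ _
      have h4 : p.castSucc.succAbove l ≠ p.succ := by
        rw [← h2]; exact Fin.succAbove_ne _ _
      rw [Function.update_of_ne hl, Function.update_of_ne hl, Function.update_of_ne h3,
        Function.update_of_ne h4, h2]
  · obtain ⟨q, h⟩ := contractNth_balanced j p hp y d
    obtain ⟨h1, h2⟩ := h _ rfl
    rw [h1, h2, hf d hd]

variable (k R) in
/-- The Hochschild cochain complex of the `k`-algebra `R`. -/
noncomputable def hochschildComplex : CochainComplex (ModuleCat.{u} k) ℕ :=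
  CochainComplex.of (fun n => ModuleCat.of k (Cochain k R n))
    (fun n => ModuleCat.ofHom (coboundary k R n))
    (fun n => by ext f : 2; exact coboundary_coboundary f)

variable (k R) in
/-- Hochschild cohomology `HHⁿ(R)` of the algebra `R` over the field `k`. -/
noncomputable abbrev HH (n : ℕ) : ModuleCat.{u} k := (hochschildComplex k R).homology n

/-- The coboundary on relative cochains. -/
def relCoboundary (D : Subalgebra k R) (n : ℕ) :
    relCochains D n →ₗ[k] relCochains D (n + 1) :=
  (coboundary k R n).restrict fun _ hf => coboundary_mem_relCochains hf

lemma relCoboundary_comp (D : Subalgebra k R) (n : ℕ) :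
    relCoboundary D (n + 1) ∘ₗ relCoboundary D n = 0 := by
  ext f : 2
  exact coboundary_coboundary f.1

/-- The complex of cochains of `R` relative to the subalgebra `D`. -/
noncomputable def relComplex (D : Subalgebra k R) : CochainComplex (ModuleCat.{u} k) ℕ :=
  CochainComplex.of (fun n => ModuleCat.of k (relCochains D n))
    (fun n => ModuleCat.ofHom (relCoboundary D n))
    (fun n => by ext f : 2; exact congr($(relCoboundary_comp D n) f))

variable {S : Type u} [Ring S] [Algebra k S]

/-- For algebra maps `ι : S → R` and `p : R → S` with `p ∘ ι = id`, the map of Hochschild cochains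
`f ↦ p ∘ f ∘ (ι ⊗ ⋯ ⊗ ι)`. -/
noncomputable def retractCochain (ι : S →ₐ[k] R) (p : R →ₐ[k] S) (n : ℕ) :
    Cochain k R n →ₗ[k] Cochain k S n where
  toFun f := p.toLinearMap.compMultilinearMap (f.compLinearMap fun _ => ι.toLinearMap)
  map_add' f g := by ext; simp
  map_smul' c f := by ext; simp

lemma retractCochain_coboundary (ι : S →ₐ[k] R) (p : R →ₐ[k] S) (h : ∀ s, p (ι s) = s) {n : ℕ}
    (f : Cochain k R n) :
    coboundary k S n (retractCochain ι p n f) =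
      retractCochain ι p (n + 1) (coboundary k R n f) := by
  ext x
  have e (i : Fin n) : (fun l => ι (i.castSucc.contractNth (· * ·) x l)) =
      i.castSucc.contractNth (· * ·) (fun l => ι (x l)) := by
    rw [contractNth_castSucc, contractNth_castSucc]
    funext l
    rcases eq_or_ne l i with rfl | hl
    · simp
    · simp [hl]
  simp only [retractCochain, LinearMap.coe_mk, AddHom.coe_mk, coboundary_apply,
    LinearMap.compMultilinearMap_apply, MultilinearMap.compLinearMap_apply,
    AlgHom.toLinearMap_apply, map_add, map_mul, map_sum, map_smul, h, e]
  rfl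

/-- The induced map of Hochschild complexes. -/
noncomputable def retractMap (ι : S →ₐ[k] R) (p : R →ₐ[k] S) (h : ∀ s, p (ι s) = s) :
    hochschildComplex k R ⟶ hochschildComplex k S :=
  CochainComplex.ofHom (fun n => ModuleCat.ofHom (retractCochain ι p n))
    (fun n => by
      ext f : 2
      simp only [hochschildComplex, CochainComplex.of_d]
      exact retractCochain_coboundary ι p h f)

/-- For an algebra map `p : R → S`, the cochains of `R` relative to `D` with values in the kernel
of `p`. -/
def kerCochains (p : R →ₐ[k] S) (D : Subalgebra k R) (n : ℕ) : Submodule k (Cochain k R n) where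
  carrier := {f | f ∈ relCochains D n ∧ ∀ x, p (f x) = 0}
  add_mem' {f g} hf hg := ⟨add_mem hf.1 hg.1, fun x => by simp [hf.2 x, hg.2 x]⟩
  zero_mem' := ⟨zero_mem _, fun x => by simp⟩
  smul_mem' c f hf := ⟨Submodule.smul_mem _ _ hf.1, fun x => by simp [hf.2 x]⟩

lemma map_coboundary (p : R →ₐ[k] S) {n : ℕ} {f : Cochain k R n} (hf : ∀ x, p (f x) = 0)
    (x : Fin (n + 1) → R) : p (coboundary k R n f x) = 0 := by
  simp [coboundary_apply, hf]

/-- The coboundary on relative cochains with values in the kernel of `p`. -/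
def kerCoboundary (p : R →ₐ[k] S) (D : Subalgebra k R) (n : ℕ) :
    kerCochains p D n →ₗ[k] kerCochains p D (n + 1) :=
  (coboundary k R n).restrict
    fun _ hf => ⟨coboundary_mem_relCochains hf.1, map_coboundary p hf.2⟩

/-- The subcomplex of relative cochains with values in the kernel of `p`. -/
noncomputable def kerComplex (p : R →ₐ[k] S) (D : Subalgebra k R) :
    CochainComplex (ModuleCat.{u} k) ℕ :=
  CochainComplex.of (fun n => ModuleCat.of k (kerCochains p D n))
    (fun n => ModuleCat.ofHom (kerCoboundary p D n))
    (fun n => by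
      ext f : 2
      exact Subtype.ext (coboundary_coboundary f.1))

/-- The inclusion of the kernel-valued relative cochains in the relative cochains. -/
noncomputable def kerInclusion (p : R →ₐ[k] S) (D : Subalgebra k R) :
    kerComplex p D ⟶ relComplex D :=
  CochainComplex.ofHom
    (fun n => ModuleCat.ofHom
      (Submodule.inclusion (show kerCochains p D n ≤ relCochains D n from fun _ h => h.1)))
    (fun n => by
      ext f : 2
      simp only [kerComplex, relComplex, CochainComplex.of_d]
      rfl)

instance (p : R →ₐ[k] S) (D : Subalgebra k R) : Mono (kerInclusion p D) := by
  have : ∀ n, Mono ((kerInclusion p D).f n) := fun n =>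
    (ModuleCat.mono_iff_injective _).2 
      (Submodule.inclusion_injective (show kerCochains p D n ≤ relCochains D n from fun _ h => h.1))
  exact HomologicalComplex.mono_of_mono_f _ this

/-- The short exact sequence of complexes given by the kernel-valued relative cochains, the relative
cochains, and their quotient. -/
noncomputable abbrev kerSequence (p : R →ₐ[k] S) (D : Subalgebra k R) :
    ShortComplex (CochainComplex (ModuleCat.{u} k) ℕ) :=
  ShortComplex.mk (kerInclusion p D) (Limits.cokernel.π (kerInclusion p D))
    (Limits.cokernel.condition _)

lemma kerSequence_shortExact (p : R →ₐ[k] S) (D : Subalgebra k R) :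
    (kerSequence p D).ShortExact where
  exact := ShortComplex.exact_cokernel _
  mono_f := inferInstanceAs (Mono (kerInclusion p D))
  epi_g := inferInstanceAs (Epi (Limits.cokernel.π (kerInclusion p D)))

end Hochschild

section TrivialExtension

open scoped RightActions

/-- For an algebra `S`, and `S`-bimodules `V` and `Z`, the space
`Hom_{S-S}(V ⊗_S ⋯ ⊗_S V, Z)` (`n` factors): by the universal property of the tensor product of
bimodules these are the multilinear maps `V × ⋯ × V → Z` that are `S`-balanced in consecutive
arguments and linear for the outer left and right actions of `S`; for `n = 0` it is
`Hom_{S-S}(S, Z)`, that is, the elements of `Z` commuting with `S`. -/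
def bimodHom (k S V Z : Type u) [Field k] [Ring S] [Algebra k S]
    [AddCommGroup V] [Module k V] [Module S V] [Module Sᵐᵒᵖ V]
    [AddCommGroup Z] [Module k Z] [Module S Z] [Module Sᵐᵒᵖ Z]
    [IsScalarTower k S Z] [IsScalarTower k Sᵐᵒᵖ Z] :
    (n : ℕ) → Submodule k (MultilinearMap k (fun _ : Fin n => V) Z)
  | 0 =>
    { carrier := {f | ∀ (s : S) x, s •> f x = f x <• s}
      add_mem' := fun {f g} hf hg s x => by simp [hf s x, hg s x]
      zero_mem' := fun s x => by simp
      smul_mem' := fun c f hf s x => by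
        have := hf s x
        simp [smul_comm _ c, this] }
  | n + 1 =>
    { carrier := {f | ∀ (s : S) (x : Fin (n + 1) → V),
        f (Function.update x 0 (s •> x 0)) = s •> f x ∧
        (∀ i : Fin n, f (Function.update x i.castSucc (x i.castSucc <• s)) =
          f (Function.update x i.succ (s •> x i.succ))) ∧
        f (Function.update x (Fin.last n) (x (Fin.last n) <• s)) = f x <• s}
      add_mem' := fun {f g} hf hg s x => by
        obtain ⟨h1, h2, h3⟩ := hf s x
        obtain ⟨h1', h2', h3'⟩ := hg s x
        refine ⟨by simp [h1, h1'], fun i => by simp [h2, h2'], by simp [h3, h3']⟩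
      zero_mem' := fun s x => by simp
      smul_mem' := fun c f hf s x => by
        obtain ⟨h1, h2, h3⟩ := hf s x
        refine ⟨by simp [h1, smul_comm _ c], fun i => by simp [h2], by simp [h3, smul_comm _ c]⟩ }

variable {k S V : Type u} [Field k] [Ring S] [Algebra k S]
  [AddCommGroup V] [Module k V] [Module S V] [Module Sᵐᵒᵖ V] [SMulCommClass S Sᵐᵒᵖ V]
  [IsScalarTower k S V] [IsScalarTower k Sᵐᵒᵖ V]


lemma snd_contractNth {n : ℕ} (i : Fin n) (x : Fin (n + 1) → TrivSqZeroExt S V) :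
    (fun l => (i.castSucc.contractNth (· * ·) x l).snd) =
      Function.update (fun l => (x (i.castSucc.succAbove l)).snd) i
        ((x i.castSucc).fst •> (x i.succ).snd + (x i.castSucc).snd <• (x i.succ).fst) := by
  rw [contractNth_castSucc]
  funext l
  rcases eq_or_ne l i with rfl | hl
  · simp
  · simp [hl]

lemma telescope {Z : Type u} [AddCommGroup Z] [Module k Z] {n : ℕ} (T : Fin (n + 1) → Z) :
    T 0 + ∑ i : Fin n, (-1 : k) ^ ((i : ℕ) + 1) • (T i.castSucc + T i.succ)
      + (-1 : k) ^ (n + 1) • T (Fin.last n) = 0 := by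
  induction n with
  | zero => simp
  | succ n ih =>
    rw [Fin.sum_univ_castSucc]
    have h := ih (fun i => T i.castSucc)
    simp only [Fin.val_castSucc, Fin.val_last, Fin.castSucc_zero, Fin.succ_last,
      Fin.succ_castSucc] at h ⊢
    rw [smul_add, ← add_assoc, ← add_assoc, h, pow_succ _ (n + 1)]
    simp

/-- For `φ : V ⊗_S ⋯ ⊗_S V → S`, the cochain `x₁ ⊗ ⋯ ⊗ xₙ ↦ φ(v₁ ⊗ ⋯ ⊗ vₙ)` of the algebra `S ⊕ V`,
where `vᵢ` is the component of `xᵢ` in `V`. -/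
def extendCochain (n : ℕ) : MultilinearMap k (fun _ : Fin n => V) S →ₗ[k]
    Cochain k (TrivSqZeroExt S V) n where
  toFun φ := (TrivSqZeroExt.inlAlgHom k S V).toLinearMap.compMultilinearMap
    (φ.compLinearMap fun _ => (TrivSqZeroExt.sndHom S V).restrictScalars k)
  map_add' f g := by ext <;> simp
  map_smul' c f := by ext <;> simp

lemma extendCochain_apply {n : ℕ} (φ : MultilinearMap k (fun _ : Fin n => V) S) (x) :
    extendCochain n φ x = TrivSqZeroExt.inl (φ fun i => (x i).snd) := rfl

lemma snd_update {n : ℕ} (x : Fin n → TrivSqZeroExt S V) (j : Fin n) (y : TrivSqZeroExt S V) :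
    (fun i => (Function.update x j y i).snd) = Function.update (fun i => (x i).snd) j y.snd := by
  funext l
  rcases eq_or_ne l j with rfl | hl
  · simp
  · simp [hl]

lemma extendCochain_mem (D : Subalgebra k S) {n : ℕ} {φ : MultilinearMap k (fun _ : Fin n => V) S}
    (hφ : φ ∈ bimodHom k S V S n) :
    extendCochain n φ ∈ relCochains (D.map (TrivSqZeroExt.inlAlgHom k S V)) n := by
  cases n with
  | zero =>
    rintro _ ⟨s, -, rfl⟩ x
    have h := hφ s (fun i => (x i).snd)
    simp only [extendCochain_apply]
    ext
    · simpa using h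
    · simp
  | succ n =>
    rintro _ ⟨s, -, rfl⟩ x
    obtain ⟨h1, h2, h3⟩ := hφ s (fun i => (x i).snd)
    simp only [extendCochain_apply, snd_update]
    refine ⟨?_, fun i => ?_, ?_⟩
    · ext
      · simpa using h1
      · simp
    · ext
      · simpa using h2 i
      · simp
    · ext
      · simpa using h3
      · simp

lemma fst_coboundary_extendCochain {n : ℕ} {φ : MultilinearMap k (fun _ : Fin n => V) S}
    (hφ : φ ∈ bimodHom k S V S n) (x : Fin (n + 1) → TrivSqZeroExt S V) :
    (coboundary k _ n (extendCochain n φ) x).fst = 0 := by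
  obtain ⟨T, h0, hi, hl⟩ : ∃ T : Fin (n + 1) → S,
      (x 0).fst * φ (fun i => (Fin.tail x i).snd) = T 0 ∧
      (∀ i : Fin n, φ (fun l => (i.castSucc.contractNth (· * ·) x l).snd) =
        T i.castSucc + T i.succ) ∧
      φ (fun i => (Fin.init x i).snd) * (x (Fin.last n)).fst = T (Fin.last n) := by
    cases n with
    | zero =>
      refine ⟨fun _ => (x 0).fst * φ (fun i => (Fin.tail x i).snd), rfl, fun i => i.elim0, ?_⟩
      have h := hφ (x 0).fst (fun i => (Fin.tail x i).snd)
      simp only [smul_eq_mul, MulOpposite.smul_eq_mul_unop, MulOpposite.unop_op] at h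
      rw [h]
      congr 2
      exact Subsingleton.elim _ _
    | succ n =>
      obtain ⟨T, hT, hT'⟩ : ∃ T : Fin (n + 1 + 1) → S,
          (∀ i : Fin (n + 1), T i.castSucc =
            φ (Function.update (fun l => (x (i.castSucc.succAbove l)).snd) i
              ((x i.castSucc).fst •> (x i.succ).snd))) ∧
          T (Fin.last (n + 1)) = φ (fun i => (Fin.init x i).snd) * (x (Fin.last (n + 1))).fst :=
        ⟨Fin.snoc (α := fun _ => S) (fun i => φ (Function.update
            (fun l => (x (i.castSucc.succAbove l)).snd) i ((x i.castSucc).fst •> (x i.succ).snd)))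
            (φ (fun i => (Fin.init x i).snd) * (x (Fin.last (n + 1))).fst),
          fun i => by rw [Fin.snoc_castSucc], by rw [Fin.snoc_last]⟩
      refine ⟨T, ?_, fun i => ?_, hT'.symm⟩
      · have h := (hφ (x 0).fst (fun i => (Fin.tail x i).snd)).1
        rw [← Fin.castSucc_zero, hT]
        rw [smul_eq_mul] at h
        rw [Fin.castSucc_zero, ← h]
        rfl
      · rw [snd_contractNth, φ.map_update_add, hT]
        congr 1
        have e (z : V) : Function.update (fun l => (x (i.castSucc.succAbove l)).snd) i z =
            Function.update (fun l => (x (i.succ.succAbove l)).snd) i z := by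
          funext l
          rcases eq_or_ne l i with rfl | hl
          · simp
          · rw [Function.update_of_ne hl, Function.update_of_ne hl, succAbove_eq _ _ hl]
        obtain ⟨-, h2, h3⟩ := hφ (x i.succ).fst (fun l => (x (i.succ.succAbove l)).snd)
        rw [e]
        revert e h2 h3
        refine Fin.lastCases ?_ (fun i => ?_) i
        · intro e h2 h3
          rw [Fin.succ_last] at h3 ⊢
          rw [hT']
          simp only [Fin.succAbove_last] at h3 ⊢
          exact h3
        · intro e h2 h3
          have h := h2 i
          rw [Fin.succ_castSucc] at h ⊢
          rw [hT]
          have e1 : i.succ.castSucc.succAbove i.castSucc = i.castSucc.castSucc := by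
            rw [← Fin.succ_castSucc, Fin.succAbove_succ_self]
          rw [Fin.succAbove_castSucc_self, e1] at h
          exact h
  have key := congrArg TrivSqZeroExt.fst (coboundary_apply (k := k) (extendCochain n φ) x)
  rw [key]
  simp only [extendCochain_apply, TrivSqZeroExt.fst_add, TrivSqZeroExt.fst_mul,
    TrivSqZeroExt.fst_inl, TrivSqZeroExt.fst_smul, TrivSqZeroExt.fst_sum, h0, hi, hl]
  exact telescope T

lemma snd_coboundary_inr {n : ℕ} {f : Cochain k (TrivSqZeroExt S V) n}
    (hf : ∀ x, (f x).fst = 0) (v : Fin (n + 1) → V) :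
    (coboundary k _ n f fun i => TrivSqZeroExt.inr (v i)).snd = 0 := by
  have h (i : Fin n) : f (i.castSucc.contractNth (· * ·)
      fun i => (TrivSqZeroExt.inr (v i) : TrivSqZeroExt S V)) = 0 := by
    rw [contractNth_castSucc]
    exact f.map_coord_zero i (by simp)
  simp [coboundary_apply, hf, h]

/-- The restriction of a cochain of `S ⊕ V` to `V ⊗ ⋯ ⊗ V`, followed by the projection to `V`. -/
def restrictCochain (n : ℕ) : Cochain k (TrivSqZeroExt S V) n →ₗ[k]
    MultilinearMap k (fun _ : Fin n => V) V where
  toFun f := ((TrivSqZeroExt.sndHom S V).restrictScalars k).compMultilinearMap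
    (f.compLinearMap fun _ => (TrivSqZeroExt.inrHom S V).restrictScalars k)
  map_add' f g := by ext; simp
  map_smul' c f := by ext; simp

lemma restrictCochain_apply {n : ℕ} (f : Cochain k (TrivSqZeroExt S V) n) (v : Fin n → V) :
    restrictCochain n f v = (f fun i => TrivSqZeroExt.inr (v i)).snd := rfl

lemma restrictCochain_contractNth {n : ℕ} (f : Cochain k (TrivSqZeroExt S V) n)
    (p : Fin (n + 1)) (s : S) (v : Fin n → V) (x : Fin (n + 1) → TrivSqZeroExt S V)
    (hp : x p = TrivSqZeroExt.inl s) (hx : ∀ l, x (p.succAbove l) = TrivSqZeroExt.inr (v l))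
    (i : Fin n) :
    (f (i.castSucc.contractNth (· * ·) x)).snd =
      (if i.castSucc = p then restrictCochain n f (Function.update v i (s •> v i)) else 0) +
      (if i.succ = p then restrictCochain n f (Function.update v i (v i <• s)) else 0) := by
  have inr_update (z : V) : (fun l => TrivSqZeroExt.inr (Function.update v i z l)) =
      Function.update (fun l => (TrivSqZeroExt.inr (v l) : TrivSqZeroExt S V)) i
        (TrivSqZeroExt.inr z) := by
    funext l
    rcases eq_or_ne l i with rfl | hl
    · simp
    · simp [hl]
  have hne : i.castSucc ≠ i.succ := by simp [Fin.ext_iff]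
  by_cases h1 : i.castSucc = p
  · subst h1
    have h3 := hx i
    rw [Fin.succAbove_castSucc_self] at h3
    rw [if_pos rfl, if_neg hne.symm, add_zero, contractNth_castSucc, restrictCochain_apply,
      inr_update, hp, h3, TrivSqZeroExt.inl_mul_inr]
    simp only [hx]
  · by_cases h2 : i.succ = p
    · subst h2
      have h3 := hx i
      rw [Fin.succAbove_succ_self] at h3
      rw [if_pos rfl, if_neg hne, zero_add, contractNth_succ, restrictCochain_apply,
        inr_update, hp, h3, TrivSqZeroExt.inr_mul_inl]
      simp only [hx]
    · rw [if_neg h1, if_neg h2, add_zero, contractNth_castSucc]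
      obtain ⟨a, ha⟩ := Fin.exists_succAbove_eq h1
      obtain ⟨b, hb⟩ := Fin.exists_succAbove_eq h2
      rw [← ha, ← hb, hx, hx, TrivSqZeroExt.inr_mul_inr, f.map_coord_zero i (by simp)]
      simp

lemma restrictCochain_mem {n : ℕ} {f : Cochain k (TrivSqZeroExt S V) (n + 1)}
    (hf : ∀ x, (f x).fst = 0) (hdf : coboundary k _ (n + 1) f = 0) :
    restrictCochain (n + 1) f ∈ bimodHom k S V V (n + 1) := by
  have key (p : Fin (n + 2)) (s : S) (v : Fin (n + 1) → V) :
      ∃ x : Fin (n + 2) → TrivSqZeroExt S V, x p = TrivSqZeroExt.inl s ∧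
        (∀ l, x (p.succAbove l) = TrivSqZeroExt.inr (v l)) ∧
        (x 0).fst •> (f (Fin.tail x)).snd
          + ∑ i : Fin (n + 1), (-1 : k) ^ ((i : ℕ) + 1) •
            ((if i.castSucc = p then
                restrictCochain (n + 1) f (Function.update v i (s •> v i)) else 0) +
              (if i.succ = p then
                restrictCochain (n + 1) f (Function.update v i (v i <• s)) else 0))
          + (-1 : k) ^ (n + 1 + 1) • ((f (Fin.init x)).snd <• (x (Fin.last (n + 1))).fst) = 0 := by
    let x : Fin (n + 2) → TrivSqZeroExt S V := p.insertNth (α := fun _ => TrivSqZeroExt S V)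
      (TrivSqZeroExt.inl s) (fun l => TrivSqZeroExt.inr (v l))
    have hp : x p = TrivSqZeroExt.inl s := by simp [x]
    have hx : ∀ l, x (p.succAbove l) = TrivSqZeroExt.inr (v l) := fun l => by simp [x]
    refine ⟨x, hp, hx, ?_⟩
    have h := congrArg TrivSqZeroExt.snd (congrArg (fun g => g x) hdf)
    simp only [coboundary_apply, TrivSqZeroExt.snd_add, TrivSqZeroExt.snd_mul,
      TrivSqZeroExt.snd_smul, TrivSqZeroExt.snd_sum, hf, MulOpposite.op_zero, zero_smul, add_zero,
      zero_add, restrictCochain_contractNth f p s v x hp hx] at h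
    exact h
  intro s v
  refine ⟨?_, fun j => ?_, ?_⟩
  · obtain ⟨x, hp, hx, h⟩ := key 0 s v
    have e : Fin.tail x = fun l => TrivSqZeroExt.inr (v l) := funext fun l => hx l
    have e' := hx (Fin.last n)
    rw [Fin.zero_succAbove, Fin.succ_last] at e'
    rw [hp, e, e'] at h
    simp only [smul_add, Finset.sum_add_distrib] at h
    simp at h
    exact (add_neg_eq_zero.1 h).symm
  · obtain ⟨x, hp, hx, h⟩ := key j.succ.castSucc s v
    have e0 : (x 0).fst = 0 := by
      have h0 := hx 0
      rw [Fin.succAbove_ne_zero_zero (by simp [Fin.ext_iff])] at h0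
      rw [h0, TrivSqZeroExt.fst_inr]
    have el : (x (Fin.last (n + 1))).fst = 0 := by
      have h0 := hx (Fin.last n)
      rw [Fin.succAbove_ne_last_last (Fin.castSucc_lt_last _).ne] at h0
      rw [h0, TrivSqZeroExt.fst_inr]
    have i1 (i : Fin (n + 1)) : i.castSucc = j.succ.castSucc ↔ i = j.succ :=
      Fin.castSucc_inj
    have i2 (i : Fin (n + 1)) : i.succ = j.succ.castSucc ↔ i = j.castSucc := by
      rw [← Fin.succ_castSucc, Fin.succ_inj]
    rw [e0, el] at h
    simp only [smul_add, Finset.sum_add_distrib, i1, i2, smul_ite, smul_zero,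
      Finset.sum_ite_eq', Finset.mem_univ, if_true, zero_smul, MulOpposite.op_zero, zero_add,
      add_zero, Fin.val_succ, Fin.val_castSucc, pow_succ _ ((j : ℕ) + 1), mul_neg, mul_one,
      neg_smul] at h
    rw [neg_add_eq_zero, smul_right_inj (pow_ne_zero _ (neg_ne_zero.2 one_ne_zero))] at h
    exact h.symm
  · obtain ⟨x, hp, hx, h⟩ := key (Fin.last (n + 1)) s v
    have e : Fin.init x = fun l => TrivSqZeroExt.inr (v l) := funext fun l => by
      rw [← hx l, Fin.succAbove_last]; rfl
    have e' := hx 0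
    rw [Fin.succAbove_last, Fin.castSucc_zero] at e'
    rw [hp, e, e'] at h
    have i1 (i : Fin (n + 1)) : i.castSucc = Fin.last (n + 1) ↔ False := by
      simp [(Fin.castSucc_lt_last i).ne]
    have i2 (i : Fin (n + 1)) : i.succ = Fin.last (n + 1) ↔ i = Fin.last n := by
      rw [← Fin.succ_last, Fin.succ_inj]
    simp only [i1, i2, smul_ite, smul_zero,
      Finset.sum_ite_eq', Finset.mem_univ, if_true, if_false, zero_smul, zero_add, Fin.val_last, pow_succ _ (n + 1), mul_neg, mul_one,
      neg_smul, TrivSqZeroExt.fst_inr, TrivSqZeroExt.fst_inl] at h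
    rw [add_neg_eq_zero, smul_right_inj (pow_ne_zero _ (neg_ne_zero.2 one_ne_zero))] at h
    exact h

variable (k S V) in
/-- The projection of the trivial extension `S ⊕ V` onto `S`. -/
abbrev proj : TrivSqZeroExt S V →ₐ[k] S := TrivSqZeroExt.fstHom k S V

variable (V) in
/-- A subalgebra `D` of `S`, seen in the trivial extension `S ⊕ V`. -/
abbrev inlSub (D : Subalgebra k S) : Subalgebra k (TrivSqZeroExt S V) :=
  D.map (TrivSqZeroExt.inlAlgHom k S V)

/-- The map `extendCochain` on `Hom_{S-S}(V ⊗_S ⋯ ⊗_S V, S)`, with values in relative cochains. -/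
noncomputable def extendHom (D : Subalgebra k S) (n : ℕ) :
    ModuleCat.of k (bimodHom k S V S n) ⟶ (relComplex (inlSub V D)).X n :=
  ModuleCat.ofHom ((extendCochain n).restrict fun _ hφ => extendCochain_mem D hφ)

/-- The coboundary of an extended cochain is `V`-valued. -/
noncomputable def extendHomCoboundary (D : Subalgebra k S) (n : ℕ) :
    ModuleCat.of k (bimodHom k S V S n) ⟶ (kerComplex (proj k S V) (inlSub V D)).X (n + 1) :=
  ModuleCat.ofHom ((coboundary k _ n ∘ₗ extendCochain n).restrict
    (p := bimodHom k S V S n) (q := kerCochains (proj k S V) (inlSub V D) (n + 1))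
    fun _ hφ => ⟨coboundary_mem_relCochains (extendCochain_mem D hφ),
      fst_coboundary_extendCochain hφ⟩)

lemma extendHom_d (D : Subalgebra k S) (n : ℕ) :
    extendHom D n ≫ (relComplex (inlSub V D)).d n (n + 1) =
      extendHomCoboundary D n ≫ (kerInclusion (proj k S V) (inlSub V D)).f (n + 1) := by
  ext φ : 2
  simp only [relComplex, CochainComplex.of_d]
  rfl

variable (V) in
/-- The map `Hom_{S-S}(V ⊗_S ⋯ ⊗_S V, S) → Hⁿ(J/D)` (`n` factors) that sends a morphism to the class
of the corresponding cochain; here `J` is the complex of relative cochains of `S ⊕ V`, and `D` its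
subcomplex of `V`-valued cochains. -/
noncomputable def toQuotient (D : Subalgebra k S) (n : ℕ) :
    ModuleCat.of k (bimodHom k S V S n) ⟶
      (Limits.cokernel (kerInclusion (proj k S V) (inlSub V D))).homology n :=
  (Limits.cokernel (kerInclusion (proj k S V) (inlSub V D))).liftCycles
    (extendHom D n ≫ (Limits.cokernel.π (kerInclusion (proj k S V) (inlSub V D))).f n)
    (n + 1) (by simp)
    (by
      rw [Category.assoc, HomologicalComplex.Hom.comm, ← Category.assoc, extendHom_d,
        Category.assoc, ← HomologicalComplex.comp_f, Limits.cokernel.condition,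
        HomologicalComplex.zero_f, Limits.comp_zero]) ≫
  (Limits.cokernel (kerInclusion (proj k S V) (inlSub V D))).homologyπ n

variable (V) in
/-- The map `restrictCochain` on `V`-valued relative cochains. -/
noncomputable def restrictHom (D : Subalgebra k S) (n : ℕ) :
    (kerComplex (proj k S V) (inlSub V D)).X n ⟶
      ModuleCat.of k (MultilinearMap k (fun _ : Fin n => V) V) :=
  ModuleCat.ofHom (restrictCochain n ∘ₗ (kerCochains (proj k S V) (inlSub V D) n).subtype)

lemma d_restrictHom (D : Subalgebra k S) (n : ℕ) :
    (kerComplex (proj k S V) (inlSub V D)).d n (n + 1) ≫ restrictHom V D (n + 1) = 0 := by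
  ext f : 2
  simp only [kerComplex, CochainComplex.of_d]
  exact MultilinearMap.ext fun v => snd_coboundary_inr f.2.2 v

variable (V) in
/-- The map from `Hⁿ⁺¹(D)` to multilinear maps given by restricting cocycles to `V ⊗ ⋯ ⊗ V`. -/
noncomputable def fromKerAux (D : Subalgebra k S) (n : ℕ) :
    (kerComplex (proj k S V) (inlSub V D)).homology (n + 1) ⟶
      ModuleCat.of k (MultilinearMap k (fun _ : Fin (n + 1) => V) V) :=
  (kerComplex (proj k S V) (inlSub V D)).homologyι (n + 1) ≫
    (kerComplex (proj k S V) (inlSub V D)).descOpcycles (restrictHom V D (n + 1)) n (by simp)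
      (d_restrictHom D n)

lemma fromKerAux_mem (D : Subalgebra k S) (n : ℕ)
    (h : (kerComplex (proj k S V) (inlSub V D)).homology (n + 1)) :
    fromKerAux V D n h ∈ bimodHom k S V V (n + 1) := by
  obtain ⟨z, rfl⟩ := (ModuleCat.epi_iff_surjective
    ((kerComplex (proj k S V) (inlSub V D)).homologyπ (n + 1))).1 inferInstance h
  have e : (kerComplex (proj k S V) (inlSub V D)).homologyπ (n + 1) ≫ fromKerAux V D n =
      (kerComplex (proj k S V) (inlSub V D)).iCycles (n + 1) ≫ restrictHom V D (n + 1) := by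
    simp [fromKerAux]
  have hz := congr($((kerComplex (proj k S V) (inlSub V D)).iCycles_d (n + 1) (n + 1 + 1)) z)
  have e' := congr($e z)
  rw [ModuleCat.comp_apply, ModuleCat.comp_apply] at e'
  rw [ModuleCat.comp_apply] at hz
  rw [e']
  generalize (kerComplex (proj k S V) (inlSub V D)).iCycles (n + 1) z = f at hz
  simp only [kerComplex, CochainComplex.of_d] at hz
  exact restrictCochain_mem f.2.2 (congrArg Subtype.val hz)

variable (V) in
/-- The map `Hⁿ⁺¹(D) → Hom_{S-S}(V ⊗_S ⋯ ⊗_S V, V)` (`n + 1` factors), given by restricting cocycles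
to `V ⊗ ⋯ ⊗ V`. -/
noncomputable def fromKer (D : Subalgebra k S) (n : ℕ) :
    (kerComplex (proj k S V) (inlSub V D)).homology (n + 1) →ₗ[k] bimodHom k S V V (n + 1) :=
  (fromKerAux V D n).hom.codRestrict _ (fromKerAux_mem D n)

variable (V) in
/-- The component `Hom_{S-S}(V ⊗_S ⋯ ⊗_S V, S) → Hom_{S-S}(V ⊗_S ⋯ ⊗_S V, V)` (`n` factors in the
source, `n + 1` in the target) of the connecting homomorphism `Hⁿ(J/D) → Hⁿ⁺¹(D)`. -/
noncomputable def connecting (D : Subalgebra k S) (n : ℕ) :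
    bimodHom k S V S n →ₗ[k] bimodHom k S V V (n + 1) :=
  fromKer V D n ∘ₗ
    ((kerSequence_shortExact (proj k S V) (inlSub V D)).δ n (n + 1) (by simp)).hom ∘ₗ
    (toQuotient V D n).hom

/-- `V` is projective as an `S`-bimodule, that is, as an `S ⊗ Sᵒᵖ`-module. -/
def IsProjectiveBimodule (k S V : Type u) [Field k] [Ring S] [Algebra k S]
    [AddCommGroup V] [Module k V] [Module S V] [Module Sᵐᵒᵖ V] [SMulCommClass S Sᵐᵒᵖ V]
    [IsScalarTower k S V] [IsScalarTower k Sᵐᵒᵖ V] : Prop :=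
  letI : Module (TensorProduct k S Sᵐᵒᵖ) V := TensorProduct.Algebra.module
  Module.Projective (TensorProduct k S Sᵐᵒᵖ) V

end TrivialExtension

section Square

open scoped RightActions

/-- `M ⊕ N`, for a `B-A`-bimodule `M` and an `A-B`-bimodule `N`. -/
def Corner (M N : Type u) : Type u := M × N

variable {k A B M N : Type u}

instance [AddCommGroup M] [AddCommGroup N] : AddCommGroup (Corner M N) :=
  inferInstanceAs (AddCommGroup (M × N))

instance [Field k] [AddCommGroup M] [AddCommGroup N] [Module k M] [Module k N] :
    Module k (Corner M N) :=
  inferInstanceAs (Module k (M × N))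

/-- `A × B` acts on the left of `M ⊕ N` by `(a, b)(m, n) = (bm, an)`. -/
instance [Ring A] [Ring B] [AddCommGroup M] [AddCommGroup N] [Module B M] [Module A N] :
    Module (A × B) (Corner M N) where
  smul s v := (s.2 • v.1, s.1 • v.2)
  one_smul v := Prod.ext (one_smul B v.1) (one_smul A v.2)
  mul_smul s t v := Prod.ext (mul_smul s.2 t.2 v.1) (mul_smul s.1 t.1 v.2)
  smul_zero s := Prod.ext (smul_zero s.2) (smul_zero s.1)
  smul_add s v w := Prod.ext (smul_add s.2 v.1 w.1) (smul_add s.1 v.2 w.2)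
  add_smul s t v := Prod.ext (add_smul s.2 t.2 v.1) (add_smul s.1 t.1 v.2)
  zero_smul v := Prod.ext (zero_smul B v.1) (zero_smul A v.2)

/-- `A × B` acts on the right of `M ⊕ N` by `(m, n)(a, b) = (ma, nb)`. -/
instance [Ring A] [Ring B] [AddCommGroup M] [AddCommGroup N] [Module Aᵐᵒᵖ M] [Module Bᵐᵒᵖ N] :
    Module (A × B)ᵐᵒᵖ (Corner M N) where
  smul s v := (v.1 <• s.unop.1, v.2 <• s.unop.2)
  one_smul v := Prod.ext (one_smul Aᵐᵒᵖ v.1) (one_smul Bᵐᵒᵖ v.2)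
  mul_smul s t v := Prod.ext (mul_smul (MulOpposite.op s.unop.1) (MulOpposite.op t.unop.1) v.1)
    (mul_smul (MulOpposite.op s.unop.2) (MulOpposite.op t.unop.2) v.2)
  smul_zero s := Prod.ext (smul_zero (MulOpposite.op s.unop.1)) (smul_zero (MulOpposite.op s.unop.2))
  smul_add s v w := Prod.ext (smul_add (MulOpposite.op s.unop.1) v.1 w.1)
    (smul_add (MulOpposite.op s.unop.2) v.2 w.2)
  add_smul s t v := Prod.ext (add_smul (MulOpposite.op s.unop.1) (MulOpposite.op t.unop.1) v.1)
    (add_smul (MulOpposite.op s.unop.2) (MulOpposite.op t.unop.2) v.2)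
  zero_smul v := Prod.ext (zero_smul Aᵐᵒᵖ v.1) (zero_smul Bᵐᵒᵖ v.2)

instance [Ring A] [Ring B] [AddCommGroup M] [AddCommGroup N] [Module B M] [Module A N]
    [Module Aᵐᵒᵖ M] [Module Bᵐᵒᵖ N] [SMulCommClass B Aᵐᵒᵖ M] [SMulCommClass A Bᵐᵒᵖ N] :
    SMulCommClass (A × B) (A × B)ᵐᵒᵖ (Corner M N) where
  smul_comm s t v := Prod.ext (smul_comm s.2 (MulOpposite.op t.unop.1) v.1)
    (smul_comm s.1 (MulOpposite.op t.unop.2) v.2)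

instance [Field k] [Ring A] [Ring B] [Algebra k A] [Algebra k B] [AddCommGroup M] [AddCommGroup N]
    [Module k M] [Module k N] [Module B M] [Module A N]
    [IsScalarTower k B M] [IsScalarTower k A N] :
    IsScalarTower k (A × B) (Corner M N) where
  smul_assoc c s v := Prod.ext (smul_assoc c s.2 v.1) (smul_assoc c s.1 v.2)

instance [Field k] [Ring A] [Ring B] [Algebra k A] [Algebra k B] [AddCommGroup M] [AddCommGroup N]
    [Module k M] [Module k N] [Module Aᵐᵒᵖ M] [Module Bᵐᵒᵖ N]
    [IsScalarTower k Aᵐᵒᵖ M] [IsScalarTower k Bᵐᵒᵖ N] :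
    IsScalarTower k (A × B)ᵐᵒᵖ (Corner M N) where
  smul_assoc c s v := Prod.ext (smul_assoc c (MulOpposite.op s.unop.1) v.1)
    (smul_assoc c (MulOpposite.op s.unop.2) v.2)

variable (k A B M N : Type u) [Field k] [Ring A] [Ring B] [Algebra k A] [Algebra k B]
  [AddCommGroup M] [AddCommGroup N] [Module k M] [Module k N]
  [Module B M] [Module Aᵐᵒᵖ M] [SMulCommClass B Aᵐᵒᵖ M]
  [IsScalarTower k B M] [IsScalarTower k Aᵐᵒᵖ M]
  [Module A N] [Module Bᵐᵒᵖ N] [SMulCommClass A Bᵐᵒᵖ N]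
  [IsScalarTower k A N] [IsScalarTower k Bᵐᵒᵖ N]

/-- The null-square algebra of matrices `(a n; m b)`, in which the products of `M` and `N` are zero:
the trivial extension of `A × B` by the bimodule `M ⊕ N`. -/
abbrev NullSquareAlgebra (A B M N : Type u) [AddCommGroup M] [AddCommGroup N] : Type u :=
  TrivSqZeroExt (A × B) (Corner M N)

/-- The subalgebra `k × k` of `A × B`. -/
def diagonal : Subalgebra k (A × B) :=
  (AlgHom.prodMap (Algebra.ofId k A) (Algebra.ofId k B)).range

/-- The component `∇'₂ₘ : Hom(𝕄^{⊗2m}, 𝔸) → Hom(𝕄^{⊗2m+1}, 𝕄)` of the connecting map, where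
`𝔸 = A × B`, `𝕄 = M ⊕ N`, and both the tensor powers and the morphisms are over `𝔸`. -/
noncomputable def nablaPrime (m : ℕ) :
    bimodHom k (A × B) (Corner M N) (A × B) (2 * m) →ₗ[k]
      bimodHom k (A × B) (Corner M N) (Corner M N) (2 * m + 1) :=
  connecting (Corner M N) (diagonal k A B) (2 * m)

/-- The canonical map `HHⁿ(Λ) → HHⁿ(A × B)`, induced by restricting cochains to `A × B` and
composing them with the projection `Λ → A × B`. -/
noncomputable def projHH (n : ℕ) : HH k (NullSquareAlgebra A B M N) n →ₗ[k] HH k (A × B) n :=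
  (HomologicalComplex.homologyMap
    (retractMap (TrivSqZeroExt.inlAlgHom k (A × B) (Corner M N)) (proj k (A × B) (Corner M N))
      (fun _ => rfl)) n).hom

end Square

end NullSquare

/-!
Write `S = A × B` and `V = M ⊕ N`, so that `Λ = S ⊕ V` with `V² = 0`. The proof works with explicit
cocycles.

Since `V` is a projective bimodule, the action maps `V ⊗ S → V` and `S ⊗ V → V` have `S`-linear
splittings (`exists_isRightSplitting`, `exists_isLeftSplitting`). Replacing a letter of a cocycle by
its image under a splitting gives a cochain of lower degree whose coboundary can be subtracted to make
the cocycle vanish on tensors with a letter of `S` in a given position. Hence a cocycle of `Λ` that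
vanishes on `S ⊗ ⋯ ⊗ S` is cohomologous to one that vanishes as soon as one argument lies in `S`
(`exists_isNormal_sub_coboundary`). Such a cocycle only depends on the `V`-components of its
arguments, and is given by two bimodule maps `φ : V ⊗ ⋯ ⊗ V → S` and `ψ : V ⊗ ⋯ ⊗ V → V` over `S`
(`exists_sub_coboundary_eq`).

The idempotent `e = (1, 0)` acts on `V` with `ev + ve = v`. Its left and right actions on the
cohomology of `S` with values in `V` agree, by the insertion homotopy, whereas their difference is an
involution of `V`; so that cohomology vanishes, and a cocycle of `Λ` whose `S`-component on
`S ⊗ ⋯ ⊗ S` is zero may be taken to vanish there (`exists_isInitial_sub_coboundary`). Moving `e` past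
the factors of `V ⊗ ⋯ ⊗ V` turns it into `1 - e` at each step, which gives `ψ = 0` in even degrees and
`φ = 0` in odd degrees (`IsOffDiagonal.bimodHom_eq_bot_of_even`,
`IsOffDiagonal.bimodHom_eq_bot_of_odd`).

The map `∇'` sends `φ` to the coboundary of the cochain it defines, restricted to `V ⊗ ⋯ ⊗ V`
(`connecting_coe`); so `φ` defines a cocycle exactly if `∇'φ = 0`, and `ψ` a coboundary exactly if it
is some `∇'φ` (`ker_inrClass`). Finally a cocycle `f` of `S` lifts to `Λ`: the coboundary of its
extension by zero is `V`-valued and vanishes on `S ⊗ ⋯ ⊗ S`, so that it can be corrected, with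
a `V`-valued cochain `g`, to a normal cocycle; this is the coboundary of a cochain, the extension
minus `g`, which has no `S`-component on `V ⊗ ⋯ ⊗ V`, and so it is zero on `V ⊗ ⋯ ⊗ V` and hence
everywhere (`exists_cocycle_baseCochain_eq`).
-/

namespace NullSquare

/-! ### Cochains as functions on infinite sequences -/

section Sequences

variable {k R : Type u} [Field k] [Ring R] [Algebra k R]

/-- `y₀ f(y₁ ⊗ ⋯ ⊗ yₙ) yₙ₊₁`, the two-sided form of a cochain, as a function on infinite sequences:
indexing by `ℕ` keeps the positions of letters free of the arithmetic of `Fin`. -/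
def ev {n : ℕ} (f : Cochain k R n) (y : ℕ → R) : R :=
  y 0 * f (fun i => y (i + 1)) * y (n + 1)

/-- The sequence obtained by multiplying together the letters in positions `i` and `i + 1`. -/
def ctr (i : ℕ) (y : ℕ → R) : ℕ → R :=
  fun l => if l < i then y l else if l = i then y i * y (i + 1) else y (l + 1)

/-- The sequence obtained by putting the two letters `u`, `w` in place of the letter in
position `j`. -/
def split (j : ℕ) (u w : R) (y : ℕ → R) : ℕ → R :=
  fun l => if l < j then y l else if l = j then u else if l = j + 1 then w else y (l - 1)

/-- The sequence obtained by inserting the letter `w` in position `j`. -/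
def ins (j : ℕ) (w : R) (y : ℕ → R) : ℕ → R :=
  fun l => if l < j then y l else if l = j then w else y (l - 1)

/-- The letters of `x`, with `1` in all other positions. -/
def pad {n : ℕ} (x : Fin n → R) : ℕ → R :=
  fun l => if h : l - 1 < n ∧ 0 < l then x ⟨l - 1, h.1⟩ else 1

lemma pad_succ {n : ℕ} (x : Fin n → R) (i : Fin n) : pad x (i + 1) = x i := by
  simp [pad]

lemma pad_zero {n : ℕ} (x : Fin n → R) : pad x 0 = 1 := by simp [pad]

lemma pad_last {n : ℕ} (x : Fin n → R) : pad x (n + 1) = 1 := by simp [pad]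

lemma ev_pad {n : ℕ} (f : Cochain k R n) (x : Fin n → R) : ev f (pad x) = f x := by
  simp only [ev, pad_zero, pad_last, pad_succ, one_mul, mul_one]

@[simp] lemma ev_sub {n : ℕ} (f g : Cochain k R n) (y : ℕ → R) :
    ev (f - g) y = ev f y - ev g y := by
  simp [ev, mul_sub, sub_mul]

@[simp] lemma ev_smul {n : ℕ} (c : k) (f : Cochain k R n) (y : ℕ → R) :
    ev (c • f) y = c • ev f y := by
  simp [ev]

@[simp] lemma ev_zero {n : ℕ} (y : ℕ → R) : ev (0 : Cochain k R n) y = 0 := by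
  simp [ev]

lemma ev_sum {n : ℕ} {ι : Type*} (s : Finset ι) (f : ι → Cochain k R n) (y : ℕ → R) :
    ev (∑ i ∈ s, f i) y = ∑ i ∈ s, ev (f i) y := by
  simp [ev, Finset.mul_sum, Finset.sum_mul]

lemma ev_eq_ends {n : ℕ} (f : Cochain k R n) (y : ℕ → R) :
    ev f y = ends f (fun i : Fin (n + 2) => y i) := by
  simp [ev, ends]

/-- In two-sided form, the coboundary is the alternating sum of all contractions, the two outer ones
included. -/
lemma ev_coboundary {n : ℕ} (f : Cochain k R n) (y : ℕ → R) :
    ev (coboundary k R n f) y = ∑ i ∈ Finset.range (n + 2), (-1 : k) ^ i • ev f (ctr i y) := by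
  rw [ev_eq_ends, ends_coboundary, Finset.sum_range]
  refine Finset.sum_congr rfl fun j _ => ?_
  rw [ev_eq_ends]
  congr 2
  funext l
  simp only [Fin.contractNth, ctr, Fin.val_castSucc, Fin.val_succ]
  split_ifs with _ h <;> first | rfl | rw [h]

lemma update_comp_succ {n : ℕ} (y : ℕ → R) (p : Fin n) (a : R) :
    (fun i : Fin n => Function.update y (p + 1) a (i + 1)) =
      Function.update (fun i : Fin n => y (i + 1)) p a := by
  funext i
  rcases eq_or_ne i p with rfl | h
  · simp
  · have h' : (i : ℕ) ≠ p := fun e => h (Fin.ext e)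
    rw [Function.update_of_ne h, Function.update_of_ne (by omega)]

/-- `ev f` is linear in each inner letter. -/
lemma ev_update_add {n : ℕ} (f : Cochain k R n) (y : ℕ → R) {p : ℕ} (h1 : 1 ≤ p) (h2 : p ≤ n)
    (a b : R) : ev f (Function.update y p (a + b)) =
      ev f (Function.update y p a) + ev f (Function.update y p b) := by
  obtain ⟨p, rfl⟩ : ∃ p', p = p' + 1 := ⟨p - 1, by omega⟩
  have e (c : R) := update_comp_succ y (⟨p, by omega⟩ : Fin n) c
  have hp : n ≠ p := by omega
  simp only [ev] at *
  simp only [e, MultilinearMap.map_update_add]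
  simp [hp, mul_add, add_mul]

lemma ev_update_zero {n : ℕ} (f : Cochain k R n) (y : ℕ → R) {p : ℕ} (h1 : 1 ≤ p) (h2 : p ≤ n)
    (h : y p = 0) : ev f y = 0 := by
  obtain ⟨p, rfl⟩ : ∃ p', p = p' + 1 := ⟨p - 1, by omega⟩
  rw [ev, f.map_coord_zero ⟨p, by omega⟩ h]
  simp

lemma ctr_split_of_lt {i j : ℕ} (h : i < j) (u w : R) (y : ℕ → R) :
    ctr i (split (j + 1) u w y) = split j u w (ctr i y) := by
  funext l
  simp only [ctr, split]
  split_ifs <;> first | omega | rfl | (congr 1; omega)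

lemma ctr_split_eq (j : ℕ) (u w : R) (y : ℕ → R) :
    ctr j (split (j + 1) u w y) = split j (y j * u) w (ctr j y) := by
  funext l
  simp only [ctr, split]
  split_ifs <;> first | omega | rfl | (congr 1; omega)

lemma ctr_split_self (j : ℕ) (u w : R) (y : ℕ → R) :
    ctr j (split j u w y) = Function.update y j (u * w) := by
  funext l
  simp only [ctr, split, Function.update_apply]
  split_ifs <;> first | omega | rfl

lemma ctr_succ_split (j : ℕ) (u w : R) (y : ℕ → R) :
    ctr (j + 1) (split j u w y) = split j u (w * y (j + 1)) (ctr j y) := by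
  funext l
  simp only [ctr, split]
  split_ifs <;> first | omega | rfl | (congr 1; omega)

lemma ctr_split_of_gt {i j : ℕ} (h : j < i) (u w : R) (y : ℕ → R) :
    ctr (i + 1) (split j u w y) = split j u w (ctr i y) := by
  funext l
  simp only [ctr, split]
  split_ifs <;> first | omega | rfl | (congr 1; omega)

end Sequences

/-! ### Replacing an argument by a tensor -/

section Splice

open scoped TensorProduct

variable {k R : Type u} [Field k] [Ring R] [Algebra k R]

/-- The bilinear map `(u, w) ↦ f(x₀, …, xⱼ₋₁, u, w, xⱼ₊₁, …)`. -/
def spliceBilin {m : ℕ} (f : Cochain k R (m + 1)) (j : Fin m) (x : Fin m → R) :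
    R →ₗ[k] R →ₗ[k] R :=
  LinearMap.mk₂ k (fun u w => f.curryMid j.succ w (Function.update x j u))
    (fun _ _ _ => by simp) (fun _ _ _ => by simp) (fun _ _ _ => by simp) (fun _ _ _ => by simp)

lemma spliceBilin_update_self {m : ℕ} (f : Cochain k R (m + 1)) (j : Fin m) (x : Fin m → R)
    (a : R) : spliceBilin f j (Function.update x j a) = spliceBilin f j x := by
  ext u w
  simp [spliceBilin]

lemma spliceBilin_update_add {m : ℕ} (f : Cochain k R (m + 1)) {j p : Fin m} (h : p ≠ j)
    (x : Fin m → R) (a b : R) : spliceBilin f j (Function.update x p (a + b)) =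
      spliceBilin f j (Function.update x p a) + spliceBilin f j (Function.update x p b) := by
  ext u w
  simp [spliceBilin, Function.update_comm h]

lemma spliceBilin_update_smul {m : ℕ} (f : Cochain k R (m + 1)) {j p : Fin m} (h : p ≠ j)
    (x : Fin m → R) (c : k) (a : R) : spliceBilin f j (Function.update x p (c • a)) =
      c • spliceBilin f j (Function.update x p a) := by
  ext u w
  simp [spliceBilin, Function.update_comm h]

/-- The cochain obtained from `f` by replacing the argument in position `j` by a tensor with two
factors, which fill two consecutive arguments of `f`. -/
def splice {m : ℕ} (f : Cochain k R (m + 1)) (j : Fin m) (τ : R →ₗ[k] R ⊗[k] R) :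
    Cochain k R m :=
  MultilinearMap.mk' (fun x => TensorProduct.lift (spliceBilin f j x) (τ (x j)))
    (fun x p a b => by
      rcases eq_or_ne p j with rfl | h
      · simp [spliceBilin_update_self]
      · rw [spliceBilin_update_add f h]
        have e (c : R) : Function.update x p c j = x j := Function.update_of_ne h.symm _ _
        simp only [e]
        generalize τ (x j) = t
        induction t with
        | zero => simp
        | tmul u w => simp
        | add s t hs ht => simp only [map_add, hs, ht]; abel)
    (fun x p c a => by
      rcases eq_or_ne p j with rfl | h
      · simp [spliceBilin_update_self]
      · rw [spliceBilin_update_smul f h]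
        have e (c : R) : Function.update x p c j = x j := Function.update_of_ne h.symm _ _
        simp only [e]
        generalize τ (x j) = t
        induction t with
        | zero => simp
        | tmul u w => simp
        | add s t hs ht => simp only [map_add, hs, ht, smul_add])

/-- The linear extension to tensors of `u ⊗ w ↦ ev f (split (j + 1) u w z)`. -/
def spliceEv {m : ℕ} (f : Cochain k R (m + 1)) (j : Fin m) (z : ℕ → R) : R ⊗[k] R →ₗ[k] R :=
  LinearMap.mulRight k (z (m + 1)) ∘ₗ LinearMap.mulLeft k (z 0) ∘ₗ
    TensorProduct.lift (spliceBilin f j fun i => z (i + 1))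

lemma ev_splice {m : ℕ} (f : Cochain k R (m + 1)) (j : Fin m) (τ : R →ₗ[k] R ⊗[k] R)
    (z : ℕ → R) : ev (splice f j τ) z = spliceEv f j z (τ (z (j + 1))) := rfl

lemma curryMid_eq {m : ℕ} (f : Cochain k R (m + 1)) (j : Fin (m + 1)) (w : R) (y : ℕ → R) :
    f.curryMid j w (fun i => y (i + 1)) = f (fun i => ins (j + 1) w y (i + 1)) := by
  change f (j.insertNth (α := fun _ => R) w fun i => y (i + 1)) = _
  congr 1
  rw [Fin.insertNth_eq_iff]
  refine ⟨by simp [ins], ?_⟩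
  funext i
  rcases lt_or_ge i.castSucc j with h | h
  · simp only [Fin.removeNth]
    rw [Fin.succAbove_of_castSucc_lt _ _ h]
    rw [Fin.lt_def, Fin.val_castSucc] at h
    simp [ins, h]
  · simp only [Fin.removeNth]
    rw [Fin.succAbove_of_le_castSucc _ _ h]
    rw [Fin.le_def, Fin.val_castSucc] at h
    have h1 : ¬ (i : ℕ) + 1 < j := by omega
    have h2 : ¬ (i : ℕ) + 1 = j := by omega
    simp [ins, h1, h2]

lemma ev_curryMid {m : ℕ} (f : Cochain k R (m + 1)) (j : Fin (m + 1)) (w : R) (y : ℕ → R) :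
    ev (n := m) (f.curryMid j w) y = ev f (ins (j + 1) w y) := by
  have h1 : ¬ m + 1 < j := by omega
  have h2 : ¬ m + 1 = j := by omega
  rw [ev, curryMid_eq, ev]
  simp [ins, h1, h2]

lemma ins_update (j : ℕ) (u w : R) (y : ℕ → R) :
    ins (j + 1) w (Function.update y j u) = split j u w y := by
  funext l
  simp only [ins, split, Function.update_apply]
  split_ifs <;> first | omega | rfl

lemma spliceEv_tmul {m : ℕ} (f : Cochain k R (m + 1)) (j : Fin m) (z : ℕ → R) (u w : R) :
    spliceEv f j z (u ⊗ₜ w) = ev f (split (j + 1) u w z) := by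
  have h : (m : ℕ) ≠ j := by omega
  have := ev_curryMid f j.succ w (Function.update z (j + 1) u)
  rw [Fin.val_succ, ins_update] at this
  rw [← this, ev, update_comp_succ]
  simp [spliceEv, spliceBilin, h]

end Splice

/-! ### Normalizing one argument of a cocycle -/

section Sweep

open scoped TensorProduct

variable {k R : Type u} [Field k] [Ring R] [Algebra k R]

/-- `a ↦ ev f y`, with `a` in place of the letter `yⱼ₊₁`. -/
def evLetter {n : ℕ} (f : Cochain k R n) (j : Fin n) (y : ℕ → R) : R →ₗ[k] R :=
  LinearMap.mulRight k (y (n + 1)) ∘ₗ LinearMap.mulLeft k (y 0) ∘ₗ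
    f.toLinearMap (fun i => y (i + 1)) j

lemma evLetter_apply {n : ℕ} (f : Cochain k R n) (j : Fin n) (y : ℕ → R) (a : R) :
    evLetter f j y a = ev f (Function.update y (j + 1) a) := by
  have h : (n : ℕ) ≠ j := by omega
  rw [ev, update_comp_succ]
  simp [evLetter, h]

variable {S V : Type u} [Ring S] [Algebra k S]
  [AddCommGroup V] [Module k V] [Module S V] [Module Sᵐᵒᵖ V] [SMulCommClass S Sᵐᵒᵖ V]
  [IsScalarTower k S V] [IsScalarTower k Sᵐᵒᵖ V]

/-- The cochain `f` of `S ⊕ V` vanishes as soon as one of its first `J` arguments lies in `S`. -/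
def IsNormal {n : ℕ} (f : Cochain k (TrivSqZeroExt S V) n) (J : ℕ) : Prop :=
  ∀ (y : ℕ → TrivSqZeroExt S V) (p : ℕ), 1 ≤ p → p ≤ J → (y p).snd = 0 → ev f y = 0

/-- If `f` is normal, only the two contractions at a letter of `S` contribute to the coboundary:
the others leave that letter among the first arguments. Hence normal cocycles are balanced. -/
lemma IsNormal.ev_coboundary {n : ℕ} {f : Cochain k (TrivSqZeroExt S V) n} {J : ℕ}
    (hf : IsNormal f J) {y : ℕ → TrivSqZeroExt S V} {p : ℕ} (hp : (y (p + 1)).snd = 0)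
    (hpn : p ≤ n) (hpJ : p + 1 ≤ J ∨ (p ≤ J ∧ p = n)) :
    ev (coboundary k _ n f) y = (-1 : k) ^ p • (ev f (ctr p y) - ev f (ctr (p + 1) y)) := by
  rw [NullSquare.ev_coboundary, Finset.sum_eq_add_of_mem p (p + 1) (by simp; omega)
    (by simp; omega) (by omega)]
  · rw [pow_succ, smul_sub]
    simp [sub_eq_add_neg]
  · rintro l hl ⟨h1, h2⟩
    rw [Finset.mem_range] at hl
    rcases lt_or_gt_of_ne h1 with h | h
    · rw [hf (ctr l y) p (by omega) (by omega), smul_zero]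
      simp [ctr, show ¬ p < l by omega, show p ≠ l by omega, hp]
    · rw [hf (ctr l y) (p + 1) (by omega) (by omega), smul_zero]
      simp [ctr, show p + 1 < l by omega, hp]

lemma eq_alternating_sum_of_eq_zero {Z : Type*} [AddCommGroup Z] [Module k Z] {a c : ℕ} {A : ℕ → Z}
    (h : ∑ i ∈ Finset.range (c + 1), (-1 : k) ^ (a + i) • A i = 0) :
    A 0 = ∑ i ∈ Finset.range c, (-1 : k) ^ i • A (i + 1) := by
  simp only [pow_add _ a, mul_smul, ← Finset.smul_sum] at h
  rw [smul_eq_zero_iff_right (pow_ne_zero _ (neg_ne_zero.2 one_ne_zero)),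
    Finset.sum_range_succ'] at h
  simp only [pow_succ, mul_neg, mul_one, neg_smul, Finset.sum_neg_distrib, pow_zero, one_smul] at h
  exact (neg_add_eq_zero.1 h).symm

/-- `inl` as a linear map over the ground field. -/
abbrev inlₗ (k S V : Type u) [Field k] [Ring S] [Algebra k S]
    [AddCommGroup V] [Module k V] [Module S V] [Module Sᵐᵒᵖ V] [SMulCommClass S Sᵐᵒᵖ V]
    [IsScalarTower k S V] [IsScalarTower k Sᵐᵒᵖ V] : S →ₗ[k] TrivSqZeroExt S V :=
  (TrivSqZeroExt.inlAlgHom k S V).toLinearMap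

/-- A splitting of the right action `V ⊗ S → V` by a map of `S`-bimodules, extended by zero to a map
on `S ⊕ V`. That the second tensor factors lie in `S` is expressed by the field `ext`. -/
structure IsRightSplitting (τ : TrivSqZeroExt S V →ₗ[k]
    TrivSqZeroExt S V ⊗[k] TrivSqZeroExt S V) : Prop where
  zero : ∀ x, x.snd = 0 → τ x = 0
  mul_left : ∀ (s : S) x, τ (TrivSqZeroExt.inl s * x) =
    (LinearMap.mulLeft k (TrivSqZeroExt.inl s)).rTensor _ (τ x)
  mul_right : ∀ (s : S) x, τ (x * TrivSqZeroExt.inl s) =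
    (LinearMap.mulRight k (TrivSqZeroExt.inl s)).lTensor _ (τ x)
  mul : ∀ x, LinearMap.mul' k _ (τ x) = TrivSqZeroExt.inr x.snd
  ext : ∀ F G : TrivSqZeroExt S V ⊗[k] TrivSqZeroExt S V →ₗ[k] TrivSqZeroExt S V,
    (∀ u s, F (u ⊗ₜ TrivSqZeroExt.inl s) = G (u ⊗ₜ TrivSqZeroExt.inl s)) →
    ∀ x, F (τ x) = G (τ x)

/-- A splitting of the left action `S ⊗ V → V` by a map of left `S`-modules, extended by zero to a
map on `S ⊕ V`. -/
structure IsLeftSplitting (τ : TrivSqZeroExt S V →ₗ[k]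
    TrivSqZeroExt S V ⊗[k] TrivSqZeroExt S V) : Prop where
  zero : ∀ x, x.snd = 0 → τ x = 0
  mul_left : ∀ (s : S) x, τ (TrivSqZeroExt.inl s * x) =
    (LinearMap.mulLeft k (TrivSqZeroExt.inl s)).rTensor _ (τ x)
  mul : ∀ x, LinearMap.mul' k _ (τ x) = TrivSqZeroExt.inr x.snd
  ext : ∀ F G : TrivSqZeroExt S V ⊗[k] TrivSqZeroExt S V →ₗ[k] TrivSqZeroExt S V,
    (∀ s u, F (TrivSqZeroExt.inl s ⊗ₜ u) = G (TrivSqZeroExt.inl s ⊗ₜ u)) →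
    ∀ x, F (τ x) = G (τ x)

lemma isNormal_splice {m : ℕ} {f : Cochain k (TrivSqZeroExt S V) (m + 1)} {j : Fin m}
    (hf : IsNormal f (j + 1)) {τ} (hτ : IsRightSplitting (k := k) (S := S) (V := V) τ) :
    IsNormal (splice f j τ) (j + 1) := by
  intro y p h1 h2 hp
  rw [ev_splice]
  rcases h2.eq_or_lt with rfl | h
  · rw [hτ.zero _ hp, map_zero]
  · refine DFunLike.congr_fun (TensorProduct.ext' (h := 0) fun u w => ?_) _
    rw [spliceEv_tmul, hf _ p h1 h2 (by simpa [split, h] using hp)]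
    rfl

lemma exists_eq_inl {x : TrivSqZeroExt S V} (h : x.snd = 0) : ∃ s, x = TrivSqZeroExt.inl s :=
  ⟨x.fst, by ext <;> simp [h]⟩

/-- For a letter of `S` among the first `j + 1` ones, the coboundary of the spliced cochain vanishes
because splicing preserves balancedness. -/
lemma ev_coboundary_splice_of_le {m : ℕ} {f : Cochain k (TrivSqZeroExt S V) (m + 1)}
    (hδ : coboundary k _ (m + 1) f = 0) {j : Fin m} (hf : IsNormal f (j + 1)) {τ}
    (hτ : IsRightSplitting (k := k) (S := S) (V := V) τ) {y : ℕ → TrivSqZeroExt S V} {q : ℕ}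
    (hq : q ≤ j) (hy : (y (q + 1)).snd = 0) :
    ev (coboundary k _ m (splice f j τ)) y = 0 := by
  have bal (z : ℕ → TrivSqZeroExt S V) (hz : (z (q + 1)).snd = 0) :
      ev f (ctr q z) = ev f (ctr (q + 1) z) := by
    have h := hf.ev_coboundary hz (by omega) (Or.inl (by omega))
    rw [hδ, ev_zero, eq_comm, smul_eq_zero_iff_right (pow_ne_zero _ (neg_ne_zero.2 one_ne_zero)),
      sub_eq_zero] at h
    exact h
  rw [(isNormal_splice hf hτ).ev_coboundary hy (by omega) (Or.inl (by omega)),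
    smul_eq_zero_iff_right (pow_ne_zero _ (neg_ne_zero.2 one_ne_zero)), sub_eq_zero,
    ev_splice, ev_splice]
  have e1 : ctr q y (j + 1) = y (j + 2) := by
    simp [ctr, show ¬ (j + 1 : ℕ) < q by omega, show (j + 1 : ℕ) ≠ q by omega]
  have hs (u w) : (split (j + 2) u w y (q + 1)).snd = 0 := by
    simp [split, show q + 1 < (j : ℕ) + 2 by omega, hy]
  rcases hq.eq_or_lt with rfl | h
  · obtain ⟨s, hs'⟩ := exists_eq_inl hy
    have e2 : ctr (j + 1) y (j + 1) = TrivSqZeroExt.inl s * y (j + 2) := by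
      simp [ctr, hs']
    rw [e1, e2, hτ.mul_left]
    refine DFunLike.congr_fun (TensorProduct.ext' (g := spliceEv f j (ctr j y))
      (h := spliceEv f j (ctr (j + 1) y) ∘ₗ (LinearMap.mulLeft k (TrivSqZeroExt.inl s)).rTensor _)
      fun u w => ?_) _
    rw [LinearMap.comp_apply, LinearMap.rTensor_tmul, spliceEv_tmul, spliceEv_tmul,
      LinearMap.mulLeft_apply, ← hs', ← ctr_split_eq, ← ctr_split_of_lt (by omega)]
    exact bal _ (hs u w)
  · have e2 : ctr (q + 1) y (j + 1) = y (j + 2) := by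
      simp [ctr, show ¬ (j : ℕ) < q by omega, show (j : ℕ) ≠ q by omega]
    rw [e1, e2]
    refine DFunLike.congr_fun (TensorProduct.ext' fun u w => ?_) _
    rw [spliceEv_tmul, spliceEv_tmul, ← ctr_split_of_lt (by omega), ← ctr_split_of_lt (by omega)]
    exact bal _ (hs u w)

/-- For a letter of `S` in position `j + 2`, the coboundary of the spliced cochain recovers `f`: the
cocycle equation of `f`, at the sequences in which the letter `yⱼ₊₁ ∈ V` is replaced by the two
factors of `τ(yⱼ₊₁) ∈ V ⊗ S`, expresses `f(y)` by the remaining contractions, and these are the terms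
of the coboundary. -/
lemma ev_coboundary_splice {m : ℕ} {f : Cochain k (TrivSqZeroExt S V) (m + 1)}
    (hδ : coboundary k _ (m + 1) f = 0) {j : Fin m} (hf : IsNormal f (j + 1)) {τ}
    (hτ : IsRightSplitting (k := k) (S := S) (V := V) τ) {y : ℕ → TrivSqZeroExt S V}
    (hy : (y (j + 2)).snd = 0) :
    ev (coboundary k _ m (splice f j τ)) y = (-1 : k) ^ ((j : ℕ) + 1) • ev f y := by
  obtain ⟨s, hs⟩ := exists_eq_inl hy
  obtain ⟨c, hc⟩ : ∃ c, m + 2 = (j + 1) + (c + 1) := ⟨m - j, by omega⟩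
  -- in the first contraction the letter `s` is absorbed into the second factor of the tensor
  let W : ℕ → TrivSqZeroExt S V ⊗[k] TrivSqZeroExt S V →ₗ[k]
    TrivSqZeroExt S V ⊗[k] TrivSqZeroExt S V := fun i =>
    if i = 0 then (LinearMap.mulRight k (TrivSqZeroExt.inl s)).lTensor _ else LinearMap.id
  have key := hτ.ext (evLetter f j.castSucc y ∘ₗ LinearMap.mul' k _)
    (∑ i ∈ Finset.range (c + 1), (-1 : k) ^ i • spliceEv f j (ctr (j + 1 + i) y) ∘ₗ W i)
    (fun u b => by
      have h := ev_coboundary f (split (j + 1) u (TrivSqZeroExt.inl b) y)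
      rw [hδ, ev_zero, show m + 1 + 2 = (j + 1) + (c + 1 + 1) by omega,
        Finset.sum_range_add, Finset.sum_eq_zero, zero_add] at h
      · rw [LinearMap.comp_apply, LinearMap.mul'_apply, evLetter_apply, Fin.val_castSucc,
          ← ctr_split_self]
        simp only [LinearMap.sum_apply, LinearMap.smul_apply, LinearMap.comp_apply]
        refine (eq_alternating_sum_of_eq_zero h.symm).trans ?_
        refine Finset.sum_congr rfl fun i _ => ?_
        congr 1
        rcases i with _ | i
        · simp only [W, if_true, LinearMap.lTensor_tmul, spliceEv_tmul, add_zero, zero_add,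
            LinearMap.mulRight_apply, ← hs]
          rw [ctr_succ_split]
        · simp only [W, Nat.succ_ne_zero, if_false, LinearMap.id_apply, spliceEv_tmul]
          rw [← ctr_split_of_gt (by omega)]
          rfl
      · -- contractions before the tensor leave its second factor, a letter of `S`, in position
        -- `j + 1`
        intro i hi
        rw [Finset.mem_range] at hi
        rw [hf (ctr i _) (j + 1) (by omega) le_rfl, smul_zero]
        simp [ctr, split, show ¬ (j + 1 : ℕ) < i by omega, show (j + 1 : ℕ) ≠ i by omega])
    (y (j + 1))
  rw [LinearMap.comp_apply, hτ.mul, evLetter_apply, Fin.val_castSucc] at key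
  -- the component of `yⱼ₊₁` in `S` does not contribute
  have e : ev f (Function.update y (j + 1) (TrivSqZeroExt.inr (y (j + 1)).snd)) = ev f y := by
    conv_rhs => rw [← Function.update_eq_self ((j : ℕ) + 1) y]
    rw [show y (j + 1) = TrivSqZeroExt.inl (y (j + 1)).fst + TrivSqZeroExt.inr (y (j + 1)).snd from
      (TrivSqZeroExt.inl_fst_add_inr_snd_eq _).symm, ev_update_add f y (by omega) (by omega),
      hf (Function.update y (j + 1) (TrivSqZeroExt.inl _)) (j + 1) (by omega) le_rfl (by simp),
      zero_add]
    simp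
  rw [e] at key
  rw [key, ev_coboundary, hc, Finset.sum_range_add, Finset.sum_eq_zero, zero_add]
  · simp only [LinearMap.sum_apply, LinearMap.smul_apply, LinearMap.comp_apply, Finset.smul_sum,
      ← mul_smul, ← pow_add]
    refine Finset.sum_congr rfl fun i _ => ?_
    congr 1
    rw [ev_splice]
    rcases i with _ | i
    · simp only [W, if_true, add_zero]
      rw [← hτ.mul_right, ← hs]
      simp [ctr]
    · simp only [W, Nat.succ_ne_zero, if_false, LinearMap.id_apply]
      simp [ctr]
  · intro i hi
    rw [Finset.mem_range] at hi
    rw [isNormal_splice hf hτ (ctr i _) (j + 1) (by omega) le_rfl, smul_zero]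
    simp [ctr, show ¬ (j + 1 : ℕ) < i by omega, show (j + 1 : ℕ) ≠ i by omega, hy]

/-- One more argument is made normal by subtracting the coboundary of a spliced cochain. -/
lemma IsNormal.succ {m : ℕ} {f : Cochain k (TrivSqZeroExt S V) (m + 1)}
    (hδ : coboundary k _ (m + 1) f = 0) {j : Fin m} (hf : IsNormal f (j + 1)) {τ}
    (hτ : IsRightSplitting (k := k) (S := S) (V := V) τ) :
    IsNormal (f - coboundary k _ m ((-1 : k) ^ ((j : ℕ) + 1) • splice f j τ)) (j + 2) := by
  intro y p h1 h2 hp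
  rw [map_smul, ev_sub, ev_smul]
  rcases h2.eq_or_lt with rfl | h
  · rw [ev_coboundary_splice hδ hf hτ hp, ← mul_smul, ← mul_pow]
    simp
  · obtain ⟨q, rfl⟩ : ∃ q, p = q + 1 := ⟨p - 1, by omega⟩
    rw [hf y _ h1 (by omega) hp, ev_coboundary_splice_of_le hδ hf hτ (by omega) hp]
    simp

end Sweep

/-! ### Normalizing all arguments of a cocycle -/

section Sweep

open scoped TensorProduct

variable {k S V : Type u} [Field k] [Ring S] [Algebra k S]
  [AddCommGroup V] [Module k V] [Module S V] [Module Sᵐᵒᵖ V] [SMulCommClass S Sᵐᵒᵖ V]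
  [IsScalarTower k S V] [IsScalarTower k Sᵐᵒᵖ V]

/-- The cochain `f` of `S ⊕ V` vanishes when all of its first `J` arguments lie in `S`. -/
def IsInitial {n : ℕ} (f : Cochain k (TrivSqZeroExt S V) n) (J : ℕ) : Prop :=
  ∀ y : ℕ → TrivSqZeroExt S V, (∀ p, 1 ≤ p → p ≤ J → (y p).snd = 0) → ev f y = 0

/-- When the first `j + 1` letters are in `S`, the coboundary of the spliced cochain recovers `f`: the
cocycle equation of `f`, at the sequences in which the letter `yⱼ₊₂` is replaced by the two factors of
`τ(yⱼ₊₂) ∈ S ⊗ V`, expresses `f(y)` by the contractions before the tensor, and these are the terms of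
the coboundary. -/
lemma IsInitial.ev_coboundary_splice {m : ℕ} {f : Cochain k (TrivSqZeroExt S V) (m + 1)}
    (hδ : coboundary k _ (m + 1) f = 0) {j : Fin m} (hf : IsInitial f (j + 2)) {τ}
    (hτ : IsLeftSplitting (k := k) (S := S) (V := V) τ) {y : ℕ → TrivSqZeroExt S V}
    (hy : ∀ p, 1 ≤ p → p ≤ (j : ℕ) + 1 → (y p).snd = 0) :
    ev (coboundary k _ m (splice f j τ)) y = (-1 : k) ^ ((j : ℕ) + 1) • ev f y := by
  obtain ⟨s, hs⟩ := exists_eq_inl (hy (j + 1) (by omega) le_rfl)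
  obtain ⟨c, hc⟩ : ∃ c, m + 2 = (j + 2) + c := ⟨m - j, by omega⟩
  -- in the last of these contractions the letter `s` is absorbed into the first factor of the tensor
  let W : ℕ → TrivSqZeroExt S V ⊗[k] TrivSqZeroExt S V →ₗ[k]
    TrivSqZeroExt S V ⊗[k] TrivSqZeroExt S V := fun i =>
    if i = j + 1 then (LinearMap.mulLeft k (TrivSqZeroExt.inl s)).rTensor _ else LinearMap.id
  have key := hτ.ext ((-1 : k) ^ ((j : ℕ) + 1) • evLetter f j.succ y ∘ₗ LinearMap.mul' k _)
    (∑ i ∈ Finset.range (j + 2), (-1 : k) ^ i • spliceEv f j (ctr i y) ∘ₗ W i)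
    (fun b w => by
      have h := ev_coboundary f (split (j + 2) (TrivSqZeroExt.inl b) w y)
      -- contractions after the first factor of the tensor leave `j + 2` letters of `S` in front
      have tail : ∑ i ∈ Finset.range c, (-1 : k) ^ ((j : ℕ) + 2 + 1 + i) •
          ev f (ctr (j + 2 + 1 + i) (split (j + 2) (TrivSqZeroExt.inl b) w y)) = 0 := by
        refine Finset.sum_eq_zero fun i _ => ?_
        rw [hf, smul_zero]
        intro p h1 h2
        rcases h2.eq_or_lt with rfl | h3
        · simp [ctr, split, show (j : ℕ) + 2 < j + 2 + 1 + i by omega]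
        · simpa [ctr, split, show p < (j : ℕ) + 2 + 1 + i by omega, h3] using hy p h1 (by omega)
      rw [hδ, ev_zero, show m + 1 + 2 = (j + 2) + 1 + c by omega, Finset.sum_range_add, tail,
        add_zero, Finset.sum_range_succ, ctr_split_self, pow_succ, mul_neg, mul_one, neg_smul,
        eq_comm, ← sub_eq_add_neg, sub_eq_zero] at h
      rw [LinearMap.smul_apply, LinearMap.comp_apply, LinearMap.mul'_apply, evLetter_apply,
        Fin.val_succ, ← h, LinearMap.sum_apply]
      refine Finset.sum_congr rfl fun i hi => ?_
      rw [Finset.mem_range] at hi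
      rw [LinearMap.smul_apply, LinearMap.comp_apply]
      congr 1
      by_cases hi' : i = j + 1
      · subst hi'
        simp only [W, if_true, LinearMap.rTensor_tmul, spliceEv_tmul, LinearMap.mulLeft_apply, ← hs]
        rw [ctr_split_eq]
      · simp only [W, hi', if_false, LinearMap.id_apply, spliceEv_tmul]
        rw [ctr_split_of_lt (by omega)])
    (y (j + 2))
  rw [LinearMap.smul_apply, LinearMap.comp_apply, hτ.mul, evLetter_apply, Fin.val_succ] at key
  have e : ev f (Function.update y (j + 1 + 1) (TrivSqZeroExt.inr (y (j + 2)).snd)) = ev f y := by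
    conv_rhs => rw [← Function.update_eq_self ((j : ℕ) + 2) y]
    rw [show y (j + 2) = TrivSqZeroExt.inl (y (j + 2)).fst + TrivSqZeroExt.inr (y (j + 2)).snd from
      (TrivSqZeroExt.inl_fst_add_inr_snd_eq _).symm, ev_update_add f y (by omega) (by omega),
      hf (Function.update y (j + 2) (TrivSqZeroExt.inl _)), zero_add]
    · simp
    · intro p h1 h2
      rcases h2.eq_or_lt with rfl | h3
      · simp
      · rw [Function.update_of_ne (by omega)]
        exact hy p h1 (by omega)
  rw [e] at key
  rw [key, ev_coboundary, hc, Finset.sum_range_add, LinearMap.sum_apply, add_eq_left.2]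
  · refine Finset.sum_congr rfl fun i hi => ?_
    rw [Finset.mem_range] at hi
    rw [LinearMap.smul_apply, LinearMap.comp_apply, ev_splice]
    congr 1
    by_cases hi' : i = j + 1
    · subst hi'
      simp only [W, if_true]
      rw [← hτ.mul_left, ← hs]
      simp [ctr]
    · simp only [W, hi', if_false, LinearMap.id_apply]
      simp [ctr, show ¬ (j : ℕ) + 1 < i by omega, show (j : ℕ) + 1 ≠ i by omega]
  · refine Finset.sum_eq_zero fun i _ => ?_
    rw [ev_splice, hτ.zero, map_zero, smul_zero]
    simpa [ctr, show (j : ℕ) + 1 < j + 2 + i by omega] using hy (j + 1) (by omega) le_rfl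

/-- One leading argument fewer has to lie in `S`, after subtracting the coboundary of a spliced
cochain. -/
lemma IsInitial.pred {m : ℕ} {f : Cochain k (TrivSqZeroExt S V) (m + 1)}
    (hδ : coboundary k _ (m + 1) f = 0) {j : Fin m} (hf : IsInitial f (j + 2)) {τ}
    (hτ : IsLeftSplitting (k := k) (S := S) (V := V) τ) :
    IsInitial (f - coboundary k _ m ((-1 : k) ^ ((j : ℕ) + 1) • splice f j τ)) (j + 1) := by
  intro y hy
  rw [map_smul, ev_sub, ev_smul, hf.ev_coboundary_splice hδ hτ hy, ← mul_smul, ← mul_pow]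
  simp

lemma fst_splice {m : ℕ} {f : Cochain k (TrivSqZeroExt S V) (m + 1)} (hf : ∀ x, (f x).fst = 0)
    (j : Fin m) (τ) (x : Fin m → TrivSqZeroExt S V) : (splice f j τ x).fst = 0 := by
  refine DFunLike.congr_fun (TensorProduct.ext' (M := TrivSqZeroExt S V) (N := TrivSqZeroExt S V)
    (g := (TrivSqZeroExt.fstHom k S V).toLinearMap ∘ₗ TensorProduct.lift (spliceBilin f j x))
    (h := 0) fun u w => ?_) (τ (x j))
  simpa [spliceBilin] using hf _

/-- A cocycle that vanishes on `S ⊗ ⋯ ⊗ S` is made to vanish when its first `m + 1 - i` arguments lie in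
`S`, one position at a time. The correction is `V`-valued if the cocycle is. -/
lemma exists_isInitial {m : ℕ} {τ} (hτ : IsLeftSplitting (k := k) (S := S) (V := V) τ)
    {f : Cochain k (TrivSqZeroExt S V) (m + 1)} (hδ : coboundary k _ (m + 1) f = 0)
    (hf : IsInitial f (m + 1)) (i : ℕ) (hi : i ≤ m) :
    ∃ g : Cochain k (TrivSqZeroExt S V) m, IsInitial (f - coboundary k _ m g) (m + 1 - i) ∧
      ((∀ x, (f x).fst = 0) → ∀ x, (g x).fst = 0) := by
  induction i with
  | zero => exact ⟨0, by simpa using hf, by simp⟩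
  | succ i ih =>
    obtain ⟨g, hg, hg'⟩ := ih (by omega)
    have hδ' : coboundary k _ (m + 1) (f - coboundary k _ m g) = 0 := by
      rw [map_sub, hδ, coboundary_coboundary, sub_zero]
    have h := IsInitial.pred hδ' (j := ⟨m - 1 - i, by omega⟩) (by convert hg using 1; simp; omega) hτ
    refine ⟨g + (-1 : k) ^ (m - 1 - i + 1) • splice (f - coboundary k _ m g) ⟨m - 1 - i, by omega⟩ τ,
      ?_, fun hf' x => ?_⟩
    · rw [map_add, ← sub_sub]
      convert h using 1
      simp; omega
    · have h' := fst_splice (f := f - coboundary k _ m g) (fun x => by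
        have := map_coboundary (proj k S V) (hg' hf') x
        simpa [hf'] using this) ⟨m - 1 - i, by omega⟩ τ x
      simp [hg' hf', h']

/-- The remaining arguments are made normal one by one, from left to right. The correction is
`V`-valued if the cocycle is. -/
lemma exists_isNormal {m : ℕ} {τ} (hτ : IsRightSplitting (k := k) (S := S) (V := V) τ)
    {f : Cochain k (TrivSqZeroExt S V) (m + 1)} (hδ : coboundary k _ (m + 1) f = 0)
    (hf : IsNormal f 1) (i : ℕ) (hi : i ≤ m) :
    ∃ g : Cochain k (TrivSqZeroExt S V) m, IsNormal (f - coboundary k _ m g) (i + 1) ∧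
      ((∀ x, (f x).fst = 0) → ∀ x, (g x).fst = 0) := by
  induction i with
  | zero => exact ⟨0, by simpa using hf, by simp⟩
  | succ i ih =>
    obtain ⟨g, hg, hg'⟩ := ih (by omega)
    have hδ' : coboundary k _ (m + 1) (f - coboundary k _ m g) = 0 := by
      rw [map_sub, hδ, coboundary_coboundary, sub_zero]
    have h := IsNormal.succ hδ' (j := ⟨i, by omega⟩) hg hτ
    refine ⟨g + (-1 : k) ^ (i + 1) • splice (f - coboundary k _ m g) ⟨i, by omega⟩ τ,
      ?_, fun hf' x => ?_⟩
    · rw [map_add, ← sub_sub]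
      exact h
    · have h' := fst_splice (f := f - coboundary k _ m g) (fun x => by
        have := map_coboundary (proj k S V) (hg' hf') x
        simpa [hf'] using this) ⟨i, by omega⟩ τ x
      simp [hg' hf', h']

/-- A cocycle of `S ⊕ V` that vanishes on `S ⊗ ⋯ ⊗ S` is cohomologous to one that vanishes as soon
as one of its arguments lies in `S`. The correction is `V`-valued if the cocycle is. -/
theorem exists_isNormal_sub_coboundary {m : ℕ} {σ τ}
    (hσ : IsLeftSplitting (k := k) (S := S) (V := V) σ)
    (hτ : IsRightSplitting (k := k) (S := S) (V := V) τ)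
    {f : Cochain k (TrivSqZeroExt S V) (m + 1)} (hδ : coboundary k _ (m + 1) f = 0)
    (hf : IsInitial f (m + 1)) :
    ∃ g : Cochain k (TrivSqZeroExt S V) m, IsNormal (f - coboundary k _ m g) (m + 1) ∧
      ((∀ x, (f x).fst = 0) → ∀ x, (g x).fst = 0) := by
  obtain ⟨g, hg, hg'⟩ := exists_isInitial hσ hδ hf m le_rfl
  have hδ' : coboundary k _ (m + 1) (f - coboundary k _ m g) = 0 := by
    rw [map_sub, hδ, coboundary_coboundary, sub_zero]
  obtain ⟨g', h, h'⟩ := exists_isNormal hτ hδ' (fun y p h1 h2 hp => hg y fun q h3 h4 => by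
    rwa [show q = p by omega]) m le_rfl
  refine ⟨g + g', by rwa [map_add, ← sub_sub], fun hf' x => ?_⟩
  have h2 := h' (fun x => by
    have := map_coboundary (proj k S V) (hg' hf') x
    simpa [hf'] using this) x
  simp [hg' hf', h2]

end Sweep

/-! ### Splittings of the actions on a projective bimodule -/

section Splitting

open scoped TensorProduct RightActions

variable {k S V : Type u} [Field k] [Ring S] [Algebra k S]
  [AddCommGroup V] [Module k V] [Module S V] [Module Sᵐᵒᵖ V] [SMulCommClass S Sᵐᵒᵖ V]
  [IsScalarTower k S V] [IsScalarTower k Sᵐᵒᵖ V]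

variable (k S) in
/-- The map `S ⊗ Sᵒᵖ → V` sending `a ⊗ b` to `a v b`. -/
def biact (v : V) : S ⊗[k] Sᵐᵒᵖ →ₗ[k] V :=
  TensorProduct.lift (LinearMap.mk₂ k (fun a b => a •> (b • v))
    (fun _ _ _ => add_smul _ _ _) (fun _ _ _ => smul_assoc _ _ _)
    (fun _ _ _ => by rw [add_smul, smul_add]) (fun _ _ _ => by rw [smul_assoc, smul_comm]))

/-- A projective bimodule has a dual basis: bimodule maps `V → S ⊗ Sᵒᵖ`, here indexed by the
elements of `V` and collected into a single map, such that every `v` is the sum of the values of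
these maps at `v` acting on the elements of the index set. -/
lemma exists_dualBasis (h : IsProjectiveBimodule k S V) :
    ∃ θ : V →ₗ[k] V →₀ S ⊗[k] Sᵐᵒᵖ,
      (∀ (s : S) v, θ (s •> v) =
        Finsupp.mapRange.linearMap (LinearMap.mulLeft k (s ⊗ₜ 1)) (θ v)) ∧
      (∀ (s : S) v, θ (v <• s) =
        Finsupp.mapRange.linearMap (LinearMap.mulLeft k (1 ⊗ₜ MulOpposite.op s)) (θ v)) ∧
      ∀ v, Finsupp.lsum k (biact k S) (θ v) = v := by
  let _ : Module (S ⊗[k] Sᵐᵒᵖ) V := TensorProduct.Algebra.module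
  have h' : Module.Projective (S ⊗[k] Sᵐᵒᵖ) V := h
  obtain ⟨θ, hθ⟩ := Module.projective_def'.1 h'
  refine ⟨{ toFun := θ, map_add' := map_add θ, map_smul' := fun c v => ?_ },
    fun s v => ?_, fun s v => ?_, fun v => ?_⟩
  · have e : c • v = (c • (1 : S ⊗[k] Sᵐᵒᵖ)) • v := by
      rw [Algebra.TensorProduct.one_def, TensorProduct.smul_tmul', TensorProduct.Algebra.smul_def,
        one_smul, smul_one_smul]
    rw [e, map_smul]
    ext w
    simp
  · have e : s • v = (s ⊗ₜ (1 : Sᵐᵒᵖ) : S ⊗[k] Sᵐᵒᵖ) • v := by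
      rw [TensorProduct.Algebra.smul_def, one_smul]
    change θ (s • v) = _
    rw [e, map_smul]
    ext w
    simp
  · have e : v <• s = ((1 : S) ⊗ₜ MulOpposite.op s : S ⊗[k] Sᵐᵒᵖ) • v := by
      rw [TensorProduct.Algebra.smul_def, one_smul]
    change θ (v <• s) = _
    rw [e, map_smul]
    ext w
    simp
  · have e := DFunLike.congr_fun hθ v
    simp only [LinearMap.comp_apply, LinearMap.id_apply, Finsupp.linearCombination_apply, id] at e
    conv_rhs => rw [← e]
    simp only [Finsupp.coe_lsum, LinearMap.coe_mk, AddHom.coe_mk]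
    refine Finsupp.sum_congr fun w _ => ?_
    generalize θ v w = t
    induction t with
    | zero => rw [map_zero]; exact (zero_smul (S ⊗[k] Sᵐᵒᵖ) w).symm
    | tmul a b => rw [TensorProduct.Algebra.smul_def]; rfl
    | add s t hs ht => rw [map_add, add_smul, hs, ht]

/-- `inr` as a linear map over the ground field. -/
abbrev inrₗ (k S V : Type u) [Field k] [Ring S] [Algebra k S]
    [AddCommGroup V] [Module k V] [Module S V] [Module Sᵐᵒᵖ V] [SMulCommClass S Sᵐᵒᵖ V]
    [IsScalarTower k S V] [IsScalarTower k Sᵐᵒᵖ V] : V →ₗ[k] TrivSqZeroExt S V :=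
  (TrivSqZeroExt.inrHom S V).restrictScalars k

/-- `snd` as a linear map over the ground field. -/
abbrev sndₗ (k S V : Type u) [Field k] [Ring S] [Algebra k S]
    [AddCommGroup V] [Module k V] [Module S V] [Module Sᵐᵒᵖ V] [SMulCommClass S Sᵐᵒᵖ V]
    [IsScalarTower k S V] [IsScalarTower k Sᵐᵒᵖ V] : TrivSqZeroExt S V →ₗ[k] V :=
  (TrivSqZeroExt.sndHom S V).restrictScalars k

lemma exists_isRightSplitting (h : IsProjectiveBimodule k S V) :
    ∃ τ, IsRightSplitting (k := k) (S := S) (V := V) τ := by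
  obtain ⟨θ, h1, h2, h3⟩ := exists_dualBasis h
  -- `a ⊗ b` at the index `w` is sent to `a w ⊗ b`
  let A : (V →₀ S ⊗[k] Sᵐᵒᵖ) →ₗ[k] TrivSqZeroExt S V ⊗[k] TrivSqZeroExt S V :=
    Finsupp.lsum k fun w => TensorProduct.map
      (inrₗ k S V ∘ₗ (LinearMap.toSpanSingleton S V w).restrictScalars k)
      (inlₗ k S V ∘ₗ (MulOpposite.opLinearEquiv k).symm.toLinearMap)
  have hA (w : V) (a : S) (b : Sᵐᵒᵖ) : A (Finsupp.single w (a ⊗ₜ b)) =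
      TrivSqZeroExt.inr (a • w) ⊗ₜ TrivSqZeroExt.inl b.unop := by
    simp [A]
  refine ⟨A ∘ₗ θ ∘ₗ sndₗ k S V, fun x hx => ?_, fun s x => ?_, fun s x => ?_, fun x => ?_,
    fun F G hFG x => ?_⟩
  · simp [hx]
  · have e : A ∘ₗ Finsupp.mapRange.linearMap (LinearMap.mulLeft k (s ⊗ₜ 1)) =
        (LinearMap.mulLeft k (TrivSqZeroExt.inl s)).rTensor _ ∘ₗ A := by
      refine Finsupp.lhom_ext' fun w => TensorProduct.ext' fun a b => ?_
      simp [hA, mul_smul, -TrivSqZeroExt.inr_smul, TrivSqZeroExt.inl_mul_inr]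
    have e' := LinearMap.congr_fun e (θ x.snd)
    simp only [LinearMap.comp_apply, ← h1] at e'
    simpa using e'
  · have e : A ∘ₗ Finsupp.mapRange.linearMap (LinearMap.mulLeft k (1 ⊗ₜ MulOpposite.op s)) =
        (LinearMap.mulRight k (TrivSqZeroExt.inl s)).lTensor _ ∘ₗ A := by
      refine Finsupp.lhom_ext' fun w => TensorProduct.ext' fun a b => ?_
      simp [hA]
    have e' := LinearMap.congr_fun e (θ x.snd)
    simp only [LinearMap.comp_apply, ← h2] at e'
    simpa using e'
  · have e : LinearMap.mul' k _ ∘ₗ A = inrₗ k S V ∘ₗ Finsupp.lsum k (biact k S) := by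
      refine Finsupp.lhom_ext' fun w => TensorProduct.ext' fun a b => ?_
      simp [hA, biact, smul_comm, -TrivSqZeroExt.inr_smul, TrivSqZeroExt.inr_mul_inl]
    have e' := LinearMap.congr_fun e (θ x.snd)
    rw [LinearMap.comp_apply, LinearMap.comp_apply, h3] at e'
    exact e'
  · have e : F ∘ₗ A = G ∘ₗ A := by
      refine Finsupp.lhom_ext' fun w => TensorProduct.ext' fun a b => ?_
      simpa [hA] using hFG _ _
    exact LinearMap.congr_fun e (θ x.snd)

lemma exists_isLeftSplitting (h : IsProjectiveBimodule k S V) :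
    ∃ τ, IsLeftSplitting (k := k) (S := S) (V := V) τ := by
  obtain ⟨θ, h1, h2, h3⟩ := exists_dualBasis h
  -- `a ⊗ b` at the index `w` is sent to `a ⊗ w b`
  let A : (V →₀ S ⊗[k] Sᵐᵒᵖ) →ₗ[k] TrivSqZeroExt S V ⊗[k] TrivSqZeroExt S V :=
    Finsupp.lsum k fun w => TensorProduct.map (inlₗ k S V)
      (inrₗ k S V ∘ₗ (LinearMap.toSpanSingleton Sᵐᵒᵖ V w).restrictScalars k)
  have hA (w : V) (a : S) (b : Sᵐᵒᵖ) : A (Finsupp.single w (a ⊗ₜ b)) =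
      TrivSqZeroExt.inl a ⊗ₜ TrivSqZeroExt.inr (b • w) := by
    simp [A]
  refine ⟨A ∘ₗ θ ∘ₗ sndₗ k S V, fun x hx => ?_, fun s x => ?_, fun x => ?_,
    fun F G hFG x => ?_⟩
  · simp [hx]
  · have e : A ∘ₗ Finsupp.mapRange.linearMap (LinearMap.mulLeft k (s ⊗ₜ 1)) =
        (LinearMap.mulLeft k (TrivSqZeroExt.inl s)).rTensor _ ∘ₗ A := by
      refine Finsupp.lhom_ext' fun w => TensorProduct.ext' fun a b => ?_
      simp [hA]
    have e' := LinearMap.congr_fun e (θ x.snd)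
    simp only [LinearMap.comp_apply, ← h1] at e'
    simpa using e'
  · have e : LinearMap.mul' k _ ∘ₗ A = inrₗ k S V ∘ₗ Finsupp.lsum k (biact k S) := by
      refine Finsupp.lhom_ext' fun w => TensorProduct.ext' fun a b => ?_
      simp only [LinearMap.comp_apply, Finsupp.lsingle_apply, hA, LinearMap.mul'_apply, biact,
        TrivSqZeroExt.inl_mul_inr, Finsupp.lsum_single, TensorProduct.lift.tmul, LinearMap.mk₂_apply]
      rfl
    have e' := LinearMap.congr_fun e (θ x.snd)
    rw [LinearMap.comp_apply, LinearMap.comp_apply, h3] at e'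
    exact e'
  · have e : F ∘ₗ A = G ∘ₗ A := by
      refine Finsupp.lhom_ext' fun w => TensorProduct.ext' fun a b => ?_
      simpa [hA] using hFG _ _
    exact LinearMap.congr_fun e (θ x.snd)

end Splitting

/-! ### Insertion of a commuting letter -/

section Insertion

variable {k R : Type u} [Field k] [Ring R] [Algebra k R]

lemma ctr_ins_of_lt {i j : ℕ} (h : i < j) (w : R) (y : ℕ → R) :
    ctr i (ins (j + 1) w y) = ins j w (ctr i y) := by
  funext l
  simp only [ctr, ins]
  split_ifs <;> first | omega | rfl | (congr 1; omega)

lemma ctr_ins_left (j : ℕ) (w : R) (y : ℕ → R) :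
    ctr j (ins (j + 1) w y) = Function.update y j (y j * w) := by
  funext l
  simp only [ctr, ins, Function.update_apply]
  split_ifs <;> first | omega | rfl

lemma ctr_ins_right (j : ℕ) (w : R) (y : ℕ → R) :
    ctr (j + 1) (ins (j + 1) w y) = Function.update y (j + 1) (w * y (j + 1)) := by
  funext l
  simp only [ctr, ins, Function.update_apply]
  split_ifs <;> first | omega | rfl

lemma ctr_ins_of_gt {i j : ℕ} (h : j < i) (w : R) (y : ℕ → R) :
    ctr (i + 1) (ins (j + 1) w y) = ins (j + 1) w (ctr i y) := by
  funext l
  simp only [ctr, ins]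
  split_ifs <;> first | omega | rfl | (congr 1; omega)

/-- The alternating double sum over contractions of sequences with an inserted letter: the
contractions away from that letter reassemble, those at the letter remain. -/
lemma double_alternating_sum {Z : Type*} [AddCommGroup Z] [Module k Z] (N : ℕ) (F D : ℕ → ℕ → Z)
    (h1 : ∀ j i, i ≤ j → F (j + 1) i = D j i) (h2 : ∀ j i, j < i → F j (i + 1) = D j i) :
    ∑ j ∈ Finset.range (N + 1), (-1 : k) ^ j • ∑ i ∈ Finset.range (N + 2), (-1 : k) ^ i • F j i =
      ∑ j ∈ Finset.range (N + 1), (F j j - F j (j + 1)) -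
        ∑ i ∈ Finset.range (N + 1), (-1 : k) ^ i • ∑ j ∈ Finset.range N, (-1 : k) ^ j • D j i := by
  -- `U j` and `T j` collect the contractions before and after the inserted letter
  let U : ℕ → Z := fun j => ∑ i ∈ Finset.range j, (-1 : k) ^ i • F j i
  let T : ℕ → Z := fun j => ∑ i ∈ Finset.range (N - j), (-1 : k) ^ (j + 1 + i) • D j (j + 1 + i)
  have hrow : ∀ j ∈ Finset.range (N + 1),
      (-1 : k) ^ j • ∑ i ∈ Finset.range (N + 2), (-1 : k) ^ i • F j i =
        (F j j - F j (j + 1)) + ((-1 : k) ^ j • U j - (-1 : k) ^ j • T j) := by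
    intro j hj
    rw [Finset.mem_range] at hj
    have e : ∑ i ∈ Finset.range (N - j), (-1 : k) ^ (j + 1 + 1 + i) • F j (j + 1 + 1 + i) =
        - T j := by
      rw [← Finset.sum_neg_distrib]
      refine Finset.sum_congr rfl fun i _ => ?_
      rw [show j + 1 + 1 + i = (j + 1 + i) + 1 by omega, h2 _ _ (by omega), pow_succ]
      simp
    rw [show N + 2 = j + 1 + 1 + (N - j) by omega, Finset.sum_range_add, e,
      Finset.sum_range_succ, Finset.sum_range_succ, smul_add, smul_add, smul_add, ← mul_smul,
      ← mul_smul, pow_succ, ← mul_assoc, ← mul_pow]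
    simp only [neg_neg, one_pow, mul_neg, one_smul, neg_smul, mul_one, smul_neg, U]
    abel
  have hcol : ∀ j ∈ Finset.range N, (-1 : k) ^ j • U (j + 1) + (-1 : k) ^ j • T j =
      ∑ i ∈ Finset.range (N + 1), (-1 : k) ^ i • (-1 : k) ^ j • D j i := by
    intro j hj
    rw [Finset.mem_range] at hj
    rw [show N + 1 = j + 1 + (N - j) by omega, Finset.sum_range_add, ← smul_add, smul_add]
    simp only [U, T, Finset.smul_sum]
    congr 1
    · refine Finset.sum_congr rfl fun i hi => ?_
      rw [Finset.mem_range] at hi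
      rw [h1 _ _ (by omega), smul_comm]
    · exact Finset.sum_congr rfl fun i hi => smul_comm _ _ _
  rw [Finset.sum_congr rfl hrow, Finset.sum_add_distrib, sub_eq_add_neg,
    Finset.sum_sub_distrib (fun j => (-1 : k) ^ j • U j) (fun j => (-1 : k) ^ j • T j),
    Finset.sum_range_succ' (fun j => (-1 : k) ^ j • U j),
    Finset.sum_range_succ (fun j => (-1 : k) ^ j • T j)]
  simp only [Finset.smul_sum]
  rw [Finset.sum_comm (s := Finset.range (N + 1)), ← Finset.sum_congr rfl hcol,
    Finset.sum_add_distrib]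
  simp [U, T, pow_succ]
  abel

/-- The alternating sum of the insertions of the letter `w`. -/
def insertSum {m : ℕ} (f : Cochain k R (m + 1)) (w : R) : Cochain k R m :=
  ∑ j : Fin (m + 1), (-1 : k) ^ (j : ℕ) • (f.curryMid j w : Cochain k R m)

lemma ev_insertSum {m : ℕ} (f : Cochain k R (m + 1)) (w : R) (y : ℕ → R) :
    ev (insertSum f w) y = ∑ j ∈ Finset.range (m + 1), (-1 : k) ^ j • ev f (ins (j + 1) w y) := by
  rw [insertSum, ev_sum, Finset.sum_range]
  refine Finset.sum_congr rfl fun j _ => ?_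
  rw [ev_smul]
  congr 1
  exact ev_curryMid f j w y

/-- The two actions on cohomology of a letter `w` that commutes with the arguments are homotopic. -/
lemma ev_coboundary_insertSum {m : ℕ} {f : Cochain k R (m + 1)}
    (hδ : coboundary k R (m + 1) f = 0) (w : R) {y : ℕ → R}
    (hy : ∀ p, 1 ≤ p → p ≤ m + 1 → y p * w = w * y p) :
    ev (coboundary k R m (insertSum f w)) y = ev f (Function.update y 0 (y 0 * w)) -
      ev f (Function.update y (m + 2) (w * y (m + 2))) := by
  have h := double_alternating_sum (k := k) (m + 1)
    (fun j i => ev f (ctr i (ins (j + 1) w y))) (fun j i => ev f (ins (j + 1) w (ctr i y)))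
    (fun j i h => by rw [ctr_ins_of_lt (by omega)]) (fun j i h => by rw [ctr_ins_of_gt h])
  simp only [← ev_insertSum] at h
  rw [← ev_coboundary, Finset.sum_eq_zero, eq_comm, sub_eq_zero] at h
  · rw [← h]
    -- the two contractions at the inserted letter are consecutive terms of a telescoping sum
    let b : ℕ → R := fun j => if j = 0 then ev f (Function.update y 0 (y 0 * w)) else
      ev f (Function.update y j (w * y j))
    have e : ∀ j ∈ Finset.range (m + 2), ev f (ctr j (ins (j + 1) w y)) -
        ev f (ctr (j + 1) (ins (j + 1) w y)) = b j - b (j + 1) := by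
      intro j hj
      rw [Finset.mem_range] at hj
      rw [ctr_ins_left, ctr_ins_right]
      rcases j with _ | j
      · simp [b]
      · simp [b, hy (j + 1) (by omega) (by omega)]
    rw [Finset.sum_congr rfl e, Finset.sum_range_sub']
    simp [b]
  · intro j _
    rw [← ev_coboundary, hδ, ev_zero, smul_zero]

end Insertion

/-! ### Cohomology of `S` with values in an off-diagonal bimodule -/

section Diagonal

open scoped RightActions

variable {k S V : Type u} [Field k] [Ring S] [Algebra k S]
  [AddCommGroup V] [Module k V] [Module S V] [Module Sᵐᵒᵖ V] [SMulCommClass S Sᵐᵒᵖ V]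
  [IsScalarTower k S V] [IsScalarTower k Sᵐᵒᵖ V]

variable (V) in
/-- A central idempotent `e` of `S` such that `V = eV(1 - e) ⊕ (1 - e)Ve`. -/
structure IsOffDiagonal (e : S) : Prop where
  comm : ∀ s : S, s * e = e * s
  idem : e * e = e
  add : ∀ v : V, e •> v + v <• e = v

lemma IsOffDiagonal.smul_smul_right {e : S} (he : IsOffDiagonal V e) (v : V) :
    e •> (v <• e) = 0 := by
  have h := congrArg (fun w => e •> w) (he.add v)
  simpa [← mul_smul, he.idem] using h

/-- The commutator with `e`, an involution of the bimodule `V`. -/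
def commutator (k : Type u) {S V : Type u} [Field k] [Ring S] [Algebra k S]
    [AddCommGroup V] [Module k V] [Module S V] [Module Sᵐᵒᵖ V] [SMulCommClass S Sᵐᵒᵖ V]
    [IsScalarTower k S V] [IsScalarTower k Sᵐᵒᵖ V] (e : S) : V →ₗ[k] V where
  toFun v := e •> v - v <• e
  map_add' v w := by simp only [smul_add]; abel
  map_smul' c v := by simp only [smul_sub, smul_comm _ c, RingHom.id_apply]

lemma IsOffDiagonal.commutator_commutator {e : S} (he : IsOffDiagonal V e) (v : V) :
    commutator k e (commutator k e v) = v := by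
  have h1 := he.smul_smul_right v
  have h2 := he.add v
  have h3 : (e •> v) <• e = 0 := by rw [← smul_comm, h1]
  change e •> (e •> v - v <• e) - (e •> v - v <• e) <• e = v
  rw [smul_sub, smul_sub, h1, h3, ← mul_smul, ← mul_smul, he.idem, ← MulOpposite.op_mul, he.idem,
    sub_zero, zero_sub, sub_neg_eq_add, h2]

lemma isInitial_of_forall {n : ℕ} {f : Cochain k (TrivSqZeroExt S V) n}
    (h : ∀ s : Fin n → S, f (fun i => TrivSqZeroExt.inl (s i)) = 0) : IsInitial f n := by
  intro y hy
  have e : (fun i : Fin n => y (i + 1)) =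
      fun i : Fin n => TrivSqZeroExt.inl (y (i + 1)).fst := by
    funext i
    ext
    · simp
    · simpa using hy (i + 1) (by omega) (by omega)
  rw [ev, e, h]
  simp

/-- The `V`-valued part of a cocycle on `S ⊗ ⋯ ⊗ S` is a coboundary, since the left and right
actions of `e` are homotopic and their difference is an involution of `V`. -/
lemma exists_isInitial_sub_coboundary {e : S} (he : IsOffDiagonal V e) {m : ℕ}
    {f : Cochain k (TrivSqZeroExt S V) (m + 1)} (hδ : coboundary k _ (m + 1) f = 0)
    (hf : ∀ s : Fin (m + 1) → S, (f fun i => TrivSqZeroExt.inl (s i)).fst = 0) :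
    ∃ g : Cochain k (TrivSqZeroExt S V) m, IsInitial (f - coboundary k _ m g) (m + 1) := by
  -- `T` is `S`-bilinear, so that it commutes with coboundaries taken on `S ⊗ ⋯ ⊗ S`
  let T : TrivSqZeroExt S V →ₗ[k] TrivSqZeroExt S V := inrₗ k S V ∘ₗ commutator k e ∘ₗ sndₗ k S V
  have hT (x) : T x = TrivSqZeroExt.inr (e •> x.snd - x.snd <• e) := rfl
  have hl (s : S) (x : TrivSqZeroExt S V) :
      T (TrivSqZeroExt.inl s * x) = TrivSqZeroExt.inl s * T x := by
    rw [hT, hT, TrivSqZeroExt.inl_mul_inr]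
    congr 1
    simp [smul_sub, ← mul_smul, he.comm, smul_comm]
  have hr (s : S) (x : TrivSqZeroExt S V) :
      T (x * TrivSqZeroExt.inl s) = T x * TrivSqZeroExt.inl s := by
    rw [hT, hT, TrivSqZeroExt.inr_mul_inl]
    congr 1
    simp [smul_sub, ← mul_smul, ← MulOpposite.op_mul, he.comm, smul_comm]
  let G := insertSum f (TrivSqZeroExt.inl e)
  refine ⟨T.compMultilinearMap G, isInitial_of_forall fun s => ?_⟩
  have e1 : coboundary k _ m (T.compMultilinearMap G) (fun i => TrivSqZeroExt.inl (s i)) =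
      T (coboundary k _ m G fun i => TrivSqZeroExt.inl (s i)) := by
    simp only [coboundary_apply, LinearMap.compMultilinearMap_apply, map_add, map_sum, map_smul,
      hl, hr]
  have e2 : coboundary k _ m G (fun i => TrivSqZeroExt.inl (s i)) =
      TrivSqZeroExt.inl e * f (fun i => TrivSqZeroExt.inl (s i)) -
        f (fun i => TrivSqZeroExt.inl (s i)) * TrivSqZeroExt.inl e := by
    rw [← ev_pad (coboundary k _ m G), ev_coboundary_insertSum hδ]
    · have h1 := pad_last fun i : Fin (m + 1) => (TrivSqZeroExt.inl (s i) : TrivSqZeroExt S V)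
      have h2 (i : Fin (m + 1)) : (m : ℕ) + 2 ≠ i + 1 := by omega
      simp [ev, pad_succ, pad_zero, h1, Function.update_of_ne (h2 _).symm]
    · intro p h1 h2
      obtain ⟨i, rfl⟩ : ∃ i : Fin (m + 1), p = i + 1 := ⟨⟨p - 1, by omega⟩, by simp; omega⟩
      rw [pad_succ, ← TrivSqZeroExt.inl_mul, ← TrivSqZeroExt.inl_mul, he.comm]
  obtain ⟨v, hv⟩ : ∃ v, f (fun i => TrivSqZeroExt.inl (s i)) = TrivSqZeroExt.inr v :=
    ⟨(f fun i => TrivSqZeroExt.inl (s i)).snd, by ext <;> simp [hf s]⟩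
  rw [sub_apply, e1, e2, hv, TrivSqZeroExt.inl_mul_inr, TrivSqZeroExt.inr_mul_inl,
    ← TrivSqZeroExt.inr_sub, hT, TrivSqZeroExt.snd_inr, sub_eq_zero]
  exact congrArg _ (he.commutator_commutator (k := k) v).symm

end Diagonal

/-! ### Restriction to `V ⊗ ⋯ ⊗ V` -/

section Components

open scoped RightActions

variable {k S V : Type u} [Field k] [Ring S] [Algebra k S]
  [AddCommGroup V] [Module k V] [Module S V] [Module Sᵐᵒᵖ V] [SMulCommClass S Sᵐᵒᵖ V]
  [IsScalarTower k S V] [IsScalarTower k Sᵐᵒᵖ V]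

/-- The restriction of a cochain of `S ⊕ V` to `V ⊗ ⋯ ⊗ V`, followed by the projection to `S`. -/
def restrictBase (n : ℕ) : Cochain k (TrivSqZeroExt S V) n →ₗ[k]
    MultilinearMap k (fun _ : Fin n => V) S where
  toFun f := (TrivSqZeroExt.fstHom k S V).toLinearMap.compMultilinearMap
    (f.compLinearMap fun _ => inrₗ k S V)
  map_add' f g := by ext; simp
  map_smul' c f := by ext; simp

lemma restrictBase_apply {n : ℕ} (f : Cochain k (TrivSqZeroExt S V) n) (v : Fin n → V) :
    restrictBase n f v = (f fun i => TrivSqZeroExt.inr (v i)).fst := rfl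

/-- A sequence of letters of `V`, with `1` at both ends. -/
abbrev padInr (k S : Type u) {V : Type u} [Field k] [Ring S] [Algebra k S]
    [AddCommGroup V] [Module k V] [Module S V] [Module Sᵐᵒᵖ V] [SMulCommClass S Sᵐᵒᵖ V]
    [IsScalarTower k S V] [IsScalarTower k Sᵐᵒᵖ V] {n : ℕ} (v : Fin n → V) : ℕ → TrivSqZeroExt S V :=
  pad fun i => TrivSqZeroExt.inr (v i)

lemma ev_update_first {R : Type u} [Ring R] [Algebra k R] {n : ℕ} (f : Cochain k R n)
    (x : Fin n → R) (a : R) : ev f (Function.update (pad x) 0 a) = a * f x := by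
  simp [ev, pad_succ, pad_last]

lemma ev_update_last {R : Type u} [Ring R] [Algebra k R] {n : ℕ} (f : Cochain k R n)
    (x : Fin n → R) (a : R) : ev f (Function.update (pad x) (n + 1) a) = f x * a := by
  have h (i : Fin n) : (i : ℕ) ≠ n := by omega
  simp [ev, pad_succ, pad_zero, h]

lemma ev_update_pad {R : Type u} [Ring R] [Algebra k R] {n : ℕ} (f : Cochain k R n)
    (x : Fin n → R) (i : Fin n) (a : R) :
    ev f (Function.update (pad x) (i + 1) a) = f (Function.update x i a) := by
  have h : (n : ℕ) ≠ i := by omega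
  rw [ev, update_comp_succ]
  simp [pad_succ, pad_zero, pad_last, h]

lemma inr_update {n : ℕ} (v : Fin n → V) (i : Fin n) (w : V) :
    Function.update (fun l => (TrivSqZeroExt.inr (v l) : TrivSqZeroExt S V)) i
      (TrivSqZeroExt.inr w) = fun l => TrivSqZeroExt.inr (Function.update v i w l) := by
  funext l
  rcases eq_or_ne l i with rfl | hl
  · simp
  · simp [hl]

/-- The value of a cochain on letters of `V`, with the letter `inl s` multiplied to the letter in
position `q` from the right. -/
def mulRightAt {n : ℕ} (f : Cochain k (TrivSqZeroExt S V) n) (v : Fin n → V) (s : S) (q : ℕ) :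
    TrivSqZeroExt S V :=
  ev f (Function.update (padInr k S v) q (padInr k S v q * TrivSqZeroExt.inl s))

/-- The value of a cochain on letters of `V`, with the letter `inl s` multiplied to the letter in
position `q` from the left. -/
def mulLeftAt {n : ℕ} (f : Cochain k (TrivSqZeroExt S V) n) (v : Fin n → V) (s : S) (q : ℕ) :
    TrivSqZeroExt S V :=
  ev f (Function.update (padInr k S v) q (TrivSqZeroExt.inl s * padInr k S v q))

lemma mulRightAt_zero {n : ℕ} (f : Cochain k (TrivSqZeroExt S V) n) (v : Fin n → V) (s : S) :
    mulRightAt f v s 0 = TrivSqZeroExt.inl s * f fun i => TrivSqZeroExt.inr (v i) := by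
  rw [mulRightAt, padInr, ev_update_first, pad_zero, one_mul]

lemma mulRightAt_succ {n : ℕ} (f : Cochain k (TrivSqZeroExt S V) n) (v : Fin n → V) (s : S)
    (i : Fin n) : mulRightAt f v s (i + 1) =
      f fun l => TrivSqZeroExt.inr (Function.update v i (v i <• s) l) := by
  rw [mulRightAt, padInr, ev_update_pad, pad_succ, TrivSqZeroExt.inr_mul_inl, inr_update]

lemma mulLeftAt_succ {n : ℕ} (f : Cochain k (TrivSqZeroExt S V) n) (v : Fin n → V) (s : S)
    (i : Fin n) : mulLeftAt f v s (i + 1) =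
      f fun l => TrivSqZeroExt.inr (Function.update v i (s •> v i) l) := by
  rw [mulLeftAt, padInr, ev_update_pad, pad_succ, TrivSqZeroExt.inl_mul_inr, inr_update]

lemma mulLeftAt_last {n : ℕ} (f : Cochain k (TrivSqZeroExt S V) n) (v : Fin n → V) (s : S) :
    mulLeftAt f v s (n + 1) = (f fun i => TrivSqZeroExt.inr (v i)) * TrivSqZeroExt.inl s := by
  rw [mulLeftAt, padInr, ev_update_last, pad_last, mul_one]

lemma restrictBase_mem_of_balanced {n : ℕ} {f : Cochain k (TrivSqZeroExt S V) n}
    (h : ∀ v s q, q ≤ n → (mulRightAt f v s q).fst = (mulLeftAt f v s (q + 1)).fst) :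
    restrictBase n f ∈ bimodHom k S V S n := by
  cases n with
  | zero =>
    intro s v
    have h0 := h v s 0 le_rfl
    have h1 := mulLeftAt_last f v s
    rw [zero_add] at h1
    rw [mulRightAt_zero, zero_add, h1] at h0
    simpa [restrictBase_apply] using h0
  | succ n =>
    intro s v
    refine ⟨?_, fun i => ?_, ?_⟩
    · have h0 := h v s 0 (by omega)
      have h1 := mulLeftAt_succ f v s 0
      rw [Fin.val_zero] at h1
      rw [mulRightAt_zero, h1] at h0
      simpa [restrictBase_apply] using h0.symm
    · have h0 := h v s (i + 1) (by omega)
      have h1 := mulLeftAt_succ f v s i.succ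
      have h2 := mulRightAt_succ f v s i.castSucc
      rw [Fin.val_succ] at h1
      rw [Fin.val_castSucc] at h2
      rw [h1, h2] at h0
      exact h0
    · have h0 := h v s (n + 1) le_rfl
      have h2 := mulRightAt_succ f v s (Fin.last n)
      rw [Fin.val_last] at h2
      rw [mulLeftAt_last, h2] at h0
      simpa [restrictBase_apply] using h0

lemma restrictCochain_mem_of_balanced {n : ℕ} {f : Cochain k (TrivSqZeroExt S V) n}
    (h : ∀ v s q, q ≤ n → (mulRightAt f v s q).snd = (mulLeftAt f v s (q + 1)).snd) :
    restrictCochain n f ∈ bimodHom k S V V n := by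
  cases n with
  | zero =>
    intro s v
    have h0 := h v s 0 le_rfl
    have h1 := mulLeftAt_last f v s
    rw [zero_add] at h1
    rw [mulRightAt_zero, zero_add, h1] at h0
    simpa [restrictCochain_apply] using h0
  | succ n =>
    intro s v
    refine ⟨?_, fun i => ?_, ?_⟩
    · have h0 := h v s 0 (by omega)
      have h1 := mulLeftAt_succ f v s 0
      rw [Fin.val_zero] at h1
      rw [mulRightAt_zero, h1] at h0
      simpa [restrictCochain_apply] using h0.symm
    · have h0 := h v s (i + 1) (by omega)
      have h1 := mulLeftAt_succ f v s i.succ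
      have h2 := mulRightAt_succ f v s i.castSucc
      rw [Fin.val_succ] at h1
      rw [Fin.val_castSucc] at h2
      rw [h1, h2] at h0
      exact h0
    · have h0 := h v s (n + 1) le_rfl
      have h2 := mulRightAt_succ f v s (Fin.last n)
      rw [Fin.val_last] at h2
      rw [mulLeftAt_last, h2] at h0
      simpa [restrictCochain_apply] using h0

/-- A normal cocycle is balanced on letters of `V`. -/
lemma IsNormal.mulRightAt_eq {n : ℕ} {f : Cochain k (TrivSqZeroExt S V) n} (hf : IsNormal f n)
    (hδ : coboundary k _ n f = 0) (v : Fin n → V) (s : S) {q : ℕ} (hq : q ≤ n) :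
    mulRightAt f v s q = mulLeftAt f v s (q + 1) := by
  have h := hf.ev_coboundary (y := ins (q + 1) (TrivSqZeroExt.inl s) (padInr k S v)) (p := q)
    (by simp [ins]) hq (by omega)
  rw [hδ, ev_zero, ctr_ins_left, ctr_ins_right, eq_comm,
    smul_eq_zero_iff_right (pow_ne_zero _ (neg_ne_zero.2 one_ne_zero)), sub_eq_zero] at h
  exact h

lemma IsNormal.restrictBase_mem {n : ℕ} {f : Cochain k (TrivSqZeroExt S V) n} (hf : IsNormal f n)
    (hδ : coboundary k _ n f = 0) : restrictBase n f ∈ bimodHom k S V S n :=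
  restrictBase_mem_of_balanced fun v s _ hq => by rw [hf.mulRightAt_eq hδ v s hq]

lemma IsNormal.restrictCochain_mem {n : ℕ} {f : Cochain k (TrivSqZeroExt S V) n}
    (hf : IsNormal f n) (hδ : coboundary k _ n f = 0) : restrictCochain n f ∈ bimodHom k S V V n :=
  restrictCochain_mem_of_balanced fun v s _ hq => by rw [hf.mulRightAt_eq hδ v s hq]

lemma ev_fst {n : ℕ} (f : Cochain k (TrivSqZeroExt S V) n) (y : ℕ → TrivSqZeroExt S V) :
    (ev f y).fst = (y 0).fst * (f fun i => y (i + 1)).fst * (y (n + 1)).fst := by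
  simp [ev]

/-- If the coboundary of a cochain has no component in `S`, then the component in `S` of its
restriction to `V ⊗ ⋯ ⊗ V` is a bimodule map: on one letter of `S` and otherwise letters of `V`,
all contractions but two vanish, as `V² = 0`. -/
lemma restrictBase_mem {n : ℕ} {f : Cochain k (TrivSqZeroExt S V) n}
    (hf : ∀ x, (coboundary k _ n f x).fst = 0) : restrictBase n f ∈ bimodHom k S V S n := by
  refine restrictBase_mem_of_balanced fun v s q hq => ?_
  let Y := padInr k S v
  let y := ins (q + 1) (TrivSqZeroExt.inl s) Y
  have hY (i : ℕ) (h1 : 1 ≤ i) (h2 : i ≤ n) : ∃ w, Y i = TrivSqZeroExt.inr w := by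
    refine ⟨v ⟨i - 1, by omega⟩, ?_⟩
    have := pad_succ (fun i => (TrivSqZeroExt.inr (v i) : TrivSqZeroExt S V)) ⟨i - 1, by omega⟩
    simpa [show i - 1 + 1 = i by omega] using this
  have h := congrArg TrivSqZeroExt.fst (ev_coboundary f y)
  rw [ev_fst, hf, mul_zero, zero_mul, TrivSqZeroExt.fst_sum, Finset.sum_eq_add_of_mem q (q + 1)
    (by simp; omega) (by simp; omega) (by omega), eq_comm] at h
  · rw [TrivSqZeroExt.fst_smul, TrivSqZeroExt.fst_smul, pow_succ, mul_neg, mul_one, neg_smul,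
      ← sub_eq_add_neg, ← smul_sub,
      smul_eq_zero_iff_right (pow_ne_zero _ (neg_ne_zero.2 one_ne_zero)), sub_eq_zero,
      ctr_ins_left, ctr_ins_right] at h
    exact h
  · rintro l hl ⟨h1, h2⟩
    rw [Finset.mem_range] at hl
    rw [TrivSqZeroExt.fst_smul]
    have : (ev f (ctr l y)).fst = 0 := by
      by_cases hl0 : l = 0
      · subst hl0
        obtain ⟨w, hw⟩ := hY 1 le_rfl (by omega)
        have : ctr 0 y 0 = TrivSqZeroExt.inr w := by
          have h0 : Y 0 = 1 := pad_zero _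
          simp [ctr, y, ins, h0, hw, show 0 < q by omega]
        rw [ev_fst, this, TrivSqZeroExt.fst_inr, zero_mul, zero_mul]
      by_cases hln : l = n + 1
      · subst hln
        obtain ⟨w, hw⟩ := hY n (by omega) le_rfl
        have : ctr (n + 1) y (n + 1) = TrivSqZeroExt.inr w := by
          have h0 : Y (n + 1) = 1 := pad_last _
          simp [ctr, y, ins, h0, hw, show ¬ n < q by omega, show n ≠ q by omega,
            show ¬ n + 1 < q by omega, show n + 1 ≠ q by omega]
        rw [ev_fst, this, TrivSqZeroExt.fst_inr, mul_zero]
      · -- the two letters being multiplied, in the sequence without the letter of `S`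
        obtain ⟨p, hp0, hp, e⟩ : ∃ p, 1 ≤ p ∧ p < n ∧ y l * y (l + 1) = Y p * Y (p + 1) := by
          rcases lt_or_gt_of_ne h1 with h | h
          · exact ⟨l, by omega, by omega, by simp [y, ins, show l < q + 1 by omega, h]⟩
          · refine ⟨l - 1, by omega, by omega, ?_⟩
            simp [y, ins, show ¬ l < q + 1 by omega, h2, show ¬ l < q by omega, h1,
              show l - 1 + 1 = l by omega]
        obtain ⟨w, hw⟩ := hY p hp0 (by omega)
        obtain ⟨w', hw'⟩ := hY (p + 1) (by omega) (by omega)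
        rw [ev_update_zero f _ (p := l) (by omega) (by omega), TrivSqZeroExt.fst_zero]
        simp [ctr, e, hw, hw']
    rw [this, smul_zero]

end Components

/-! ### Vanishing of bimodule maps by parity -/

section Parity

open scoped RightActions

variable {k S V Z : Type u} [Field k] [Ring S] [Algebra k S]
  [AddCommGroup V] [Module k V] [Module S V] [Module Sᵐᵒᵖ V] [SMulCommClass S Sᵐᵒᵖ V]
  [IsScalarTower k S V] [IsScalarTower k Sᵐᵒᵖ V]
  [AddCommGroup Z] [Module k Z] [Module S Z] [Module Sᵐᵒᵖ Z]
  [IsScalarTower k S Z] [IsScalarTower k Sᵐᵒᵖ Z]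

/-- Moving `e` through the arguments of a bimodule map, past one factor of `V` after the other,
replaces it by `1 - e` at each step. -/
lemma IsOffDiagonal.smul_apply {e : S} (he : IsOffDiagonal V e) {n : ℕ}
    {u : MultilinearMap k (fun _ : Fin n => V) Z} (hu : u ∈ bimodHom k S V Z n) (v : Fin n → V) :
    u v <• e = if Even n then e •> u v else u v - e •> u v := by
  cases n with
  | zero => simpa using (hu e v).symm
  | succ n =>
    obtain ⟨h1, h2, h3⟩ := hu e v
    have hadd (i : Fin (n + 1)) : u (Function.update v i (v i <• e)) =
        u v - u (Function.update v i (e •> v i)) := by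
      rw [eq_sub_iff_add_eq', ← MultilinearMap.map_update_add, he.add, Function.update_eq_self]
    have hc (i : Fin (n + 1)) : u (Function.update v i (e •> v i)) =
        if Even (i : ℕ) then e •> u v else u v - e •> u v := by
      induction i using Fin.induction with
      | zero => simpa using h1
      | succ i ih =>
        rw [← h2 i, hadd, ih, Fin.val_succ, Fin.val_castSucc]
        by_cases hi : Even (i : ℕ) <;> simp [hi, Nat.even_add_one]
    rw [← h3, hadd, hc, Fin.val_last]
    by_cases hi : Even n <;> simp [hi, Nat.even_add_one]

/-- After an even number of factors `e` comes out unchanged, so that the values commute with it; but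
the commutator with `e` is invertible on `V`. -/
lemma IsOffDiagonal.bimodHom_eq_bot_of_even {e : S} (he : IsOffDiagonal V e) {n : ℕ}
    (hn : Even n) : bimodHom k S V V n = ⊥ := by
  refine (Submodule.eq_bot_iff _).2 fun u hu => MultilinearMap.ext fun v => ?_
  have h := he.smul_apply hu v
  rw [if_pos hn] at h
  rw [← he.commutator_commutator (k := k) (u v)]
  have : commutator k e (u v) = 0 := sub_eq_zero.2 h.symm
  rw [this, map_zero]
  rfl

/-- After an odd number of factors `e` comes out as `1 - e`, so that every value `s` satisfies
`s e = (1 - e) s`; this forces `s = 0`, as `e` is a central idempotent. -/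
lemma IsOffDiagonal.bimodHom_eq_bot_of_odd {e : S} (he : IsOffDiagonal V e) {n : ℕ}
    (hn : Odd n) : bimodHom k S V S n = ⊥ := by
  refine (Submodule.eq_bot_iff _).2 fun u hu => MultilinearMap.ext fun v => ?_
  have h := he.smul_apply hu v
  rw [if_neg (Nat.not_even_iff_odd.2 hn)] at h
  simp only [smul_eq_mul, MulOpposite.smul_eq_mul_unop, MulOpposite.unop_op, he.comm] at h
  have h1 : e * u v = 0 := by
    have := congrArg (fun w => e * w) h
    simpa [mul_sub, ← mul_assoc, he.idem] using this
  rw [h1, sub_zero] at h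
  rw [← h]
  rfl

end Parity

/-! ### The connecting map on cochains -/

section Connecting

open scoped RightActions

variable {k S V : Type u} [Field k] [Ring S] [Algebra k S]
  [AddCommGroup V] [Module k V] [Module S V] [Module Sᵐᵒᵖ V] [SMulCommClass S Sᵐᵒᵖ V]
  [IsScalarTower k S V] [IsScalarTower k Sᵐᵒᵖ V]

/-- The map `∇'` sends `φ` to the restriction of the coboundary of the cochain given by `φ`. -/
lemma connecting_coe (D : Subalgebra k S) (n : ℕ) (φ : bimodHom k S V S n) :
    (connecting V D n φ : MultilinearMap k (fun _ : Fin (n + 1) => V) V) =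
      restrictCochain (n + 1) (coboundary k _ n (extendCochain n φ.1)) := by
  have h1 := (kerSequence_shortExact (proj k S V) (inlSub V D)).δ_eq n (n + 1) (by simp)
    (extendHom D n ≫ (Limits.cokernel.π (kerInclusion (proj k S V) (inlSub V D))).f n)
    (by
      rw [Category.assoc, HomologicalComplex.Hom.comm, ← Category.assoc, extendHom_d,
        Category.assoc, ← HomologicalComplex.comp_f, Limits.cokernel.condition,
        HomologicalComplex.zero_f, Limits.comp_zero])
    (extendHom D n) rfl (extendHomCoboundary D n) (extendHom_d D n).symm (n + 2) (by simp)
  have h2 : toQuotient V D n ≫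
      (kerSequence_shortExact (proj k S V) (inlSub V D)).δ n (n + 1) (by simp) ≫ fromKerAux V D n =
      extendHomCoboundary D n ≫ restrictHom V D (n + 1) := by
    rw [toQuotient, Category.assoc]
    have h3 := h1 =≫ fromKerAux V D n
    simp only [Category.assoc] at h3
    refine h3.trans ?_
    simp [fromKerAux]
  exact congr($h2 φ)

lemma snd_coboundary_apply_inr {n : ℕ} (g : Cochain k (TrivSqZeroExt S V) n) (v : Fin (n + 1) → V) :
    (coboundary k _ n g fun i => TrivSqZeroExt.inr (v i)).snd =
      v 0 <• restrictBase n g (Fin.tail v) +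
        (-1 : k) ^ (n + 1) • restrictBase n g (Fin.init v) •> v (Fin.last n) := by
  have h (i : Fin n) : g (i.castSucc.contractNth (· * ·)
      fun i => (TrivSqZeroExt.inr (v i) : TrivSqZeroExt S V)) = 0 := by
    rw [contractNth_castSucc]
    exact g.map_coord_zero i (by simp)
  rw [coboundary_apply]
  simp only [h, smul_zero, Finset.sum_const_zero, add_zero, TrivSqZeroExt.snd_add,
    TrivSqZeroExt.snd_mul, TrivSqZeroExt.fst_inr, zero_smul, zero_add, TrivSqZeroExt.snd_inr,
    TrivSqZeroExt.snd_smul, MulOpposite.op_zero]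
  rfl

lemma restrictBase_extendCochain {n : ℕ} (φ : MultilinearMap k (fun _ : Fin n => V) S) :
    restrictBase n (extendCochain n φ) = φ := by
  ext v
  simp [restrictBase_apply, extendCochain_apply]

/-- `∇'` of the `S`-component of a cochain, read off on `V ⊗ ⋯ ⊗ V`. -/
lemma connecting_restrictBase (D : Subalgebra k S) {n : ℕ} (g : Cochain k (TrivSqZeroExt S V) n)
    (hg : restrictBase n g ∈ bimodHom k S V S n) :
    (connecting V D n ⟨restrictBase n g, hg⟩ : MultilinearMap k (fun _ : Fin (n + 1) => V) V) =
      restrictCochain (n + 1) (coboundary k _ n g) := by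
  rw [connecting_coe]
  ext v
  rw [restrictCochain_apply, restrictCochain_apply, snd_coboundary_apply_inr,
    snd_coboundary_apply_inr, restrictBase_extendCochain]

/-- For `ψ : V ⊗ ⋯ ⊗ V → V`, the cochain `x₁ ⊗ ⋯ ⊗ xₙ ↦ ψ(v₁ ⊗ ⋯ ⊗ vₙ)` of `S ⊕ V`, where `vᵢ` is
the component of `xᵢ` in `V`. -/
def inrCochain (n : ℕ) : MultilinearMap k (fun _ : Fin n => V) V →ₗ[k]
    Cochain k (TrivSqZeroExt S V) n where
  toFun ψ := (inrₗ k S V).compMultilinearMap (ψ.compLinearMap fun _ => sndₗ k S V)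
  map_add' f g := by ext <;> simp
  map_smul' c f := by ext <;> simp

lemma inrCochain_apply {n : ℕ} (ψ : MultilinearMap k (fun _ : Fin n => V) V) (x) :
    inrCochain (S := S) n ψ x = TrivSqZeroExt.inr (ψ fun i => (x i).snd) := rfl

lemma restrictCochain_inrCochain {n : ℕ} (ψ : MultilinearMap k (fun _ : Fin n => V) V) :
    restrictCochain n (inrCochain (S := S) n ψ) = ψ := by
  ext v
  simp [restrictCochain_apply, inrCochain_apply]

/-- The coboundary of the cochain given by `φ` is the cochain given by `∇'φ`. -/
lemma coboundary_extendCochain (D : Subalgebra k S) {n : ℕ} (φ : bimodHom k S V S n) :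
    coboundary k _ n (extendCochain n φ.1) = inrCochain (n + 1) (connecting V D n φ).1 := by
  refine MultilinearMap.ext fun x => TrivSqZeroExt.ext ?_ ?_
  · rw [fst_coboundary_extendCochain φ.2, inrCochain_apply, TrivSqZeroExt.fst_inr]
  · rw [connecting_coe, inrCochain_apply, TrivSqZeroExt.snd_inr, restrictCochain_apply,
      snd_coboundary_apply_inr, restrictBase_extendCochain, coboundary_apply]
    simp only [TrivSqZeroExt.snd_add, TrivSqZeroExt.snd_mul, extendCochain_apply,
      TrivSqZeroExt.snd_inl, TrivSqZeroExt.fst_inl, smul_zero, zero_add, add_zero,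
      TrivSqZeroExt.snd_sum, TrivSqZeroExt.snd_smul, Finset.sum_const_zero]
    rfl

/-- The terms of the coboundary of a bimodule map, evaluated on `S ⊕ V`, cancel in pairs: each
letter of `S` is absorbed once from either side. -/
lemma exists_telescope {n : ℕ} {ψ : MultilinearMap k (fun _ : Fin n => V) V}
    (hψ : ψ ∈ bimodHom k S V V n) (x : Fin (n + 1) → TrivSqZeroExt S V) :
    ∃ T : Fin (n + 1) → V,
      (x 0).fst •> ψ (fun i => (Fin.tail x i).snd) = T 0 ∧
      (∀ i : Fin n, ψ (fun l => (i.castSucc.contractNth (· * ·) x l).snd) =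
        T i.castSucc + T i.succ) ∧
      ψ (fun i => (Fin.init x i).snd) <• (x (Fin.last n)).fst = T (Fin.last n) := by
  cases n with
  | zero =>
    refine ⟨fun _ => (x 0).fst •> ψ (fun i => (Fin.tail x i).snd), rfl, fun i => i.elim0, ?_⟩
    rw [hψ (x 0).fst]
    congr 2
    exact Subsingleton.elim _ _
  | succ n =>
    -- `T i` is the value of `ψ` with the `S`-component of the `i`-th letter acting on the next letter
    -- from the left, and the `V`-components of the others
    obtain ⟨T, hT, hT'⟩ : ∃ T : Fin (n + 1 + 1) → V,
        (∀ i : Fin (n + 1), T i.castSucc =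
          ψ (Function.update (fun l => (x (i.castSucc.succAbove l)).snd) i
            ((x i.castSucc).fst •> (x i.succ).snd))) ∧
        T (Fin.last (n + 1)) = ψ (fun i => (Fin.init x i).snd) <• (x (Fin.last (n + 1))).fst :=
      ⟨Fin.snoc (α := fun _ => V) (fun i => ψ (Function.update
          (fun l => (x (i.castSucc.succAbove l)).snd) i ((x i.castSucc).fst •> (x i.succ).snd)))
          (ψ (fun i => (Fin.init x i).snd) <• (x (Fin.last (n + 1))).fst),
        fun i => by rw [Fin.snoc_castSucc], by rw [Fin.snoc_last]⟩
    refine ⟨T, ?_, fun i => ?_, hT'.symm⟩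
    · have h := (hψ (x 0).fst (fun i => (Fin.tail x i).snd)).1
      rw [← Fin.castSucc_zero, hT, Fin.castSucc_zero, ← h]
      rfl
    · rw [snd_contractNth, ψ.map_update_add, hT]
      congr 1
      have e (z : V) : Function.update (fun l => (x (i.castSucc.succAbove l)).snd) i z =
          Function.update (fun l => (x (i.succ.succAbove l)).snd) i z := by
        funext l
        rcases eq_or_ne l i with rfl | hl
        · simp
        · rw [Function.update_of_ne hl, Function.update_of_ne hl, succAbove_eq _ _ hl]
      obtain ⟨-, h2, h3⟩ := hψ (x i.succ).fst (fun l => (x (i.succ.succAbove l)).snd)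
      rw [e]
      revert e h2 h3
      refine Fin.lastCases ?_ (fun i => ?_) i
      · intro e h2 h3
        rw [Fin.succ_last] at h3 ⊢
        rw [hT']
        simp only [Fin.succAbove_last] at h3 ⊢
        exact h3
      · intro e h2 h3
        have h := h2 i
        rw [Fin.succ_castSucc] at h ⊢
        rw [hT]
        have e1 : i.succ.castSucc.succAbove i.castSucc = i.castSucc.castSucc := by
          rw [← Fin.succ_castSucc, Fin.succAbove_succ_self]
        rw [Fin.succAbove_castSucc_self, e1] at h
        exact h

lemma coboundary_inrCochain {n : ℕ} {ψ : MultilinearMap k (fun _ : Fin n => V) V}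
    (hψ : ψ ∈ bimodHom k S V V n) : coboundary k _ n (inrCochain (S := S) n ψ) = 0 := by
  refine MultilinearMap.ext fun x => TrivSqZeroExt.ext ?_ ?_
  · exact map_coboundary (proj k S V) (fun x => by simp [inrCochain_apply]) x
  · obtain ⟨T, h0, hi, hl⟩ := exists_telescope hψ x
    rw [coboundary_apply]
    simp only [inrCochain_apply, TrivSqZeroExt.snd_add, TrivSqZeroExt.snd_mul,
      TrivSqZeroExt.snd_inr, TrivSqZeroExt.fst_inr, TrivSqZeroExt.snd_smul, TrivSqZeroExt.snd_sum,
      MulOpposite.op_zero, zero_smul, add_zero, zero_add, h0, hi, hl]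
    exact telescope T

end Connecting

/-! ### Classes of Hochschild cocycles -/

section Cohomology

variable {k R : Type u} [Field k] [Ring R] [Algebra k R]

lemma hochschildComplex_d (n : ℕ) :
    (hochschildComplex k R).d n (n + 1) = ModuleCat.ofHom (coboundary k R n) := by
  simp [hochschildComplex]

variable (k R) in
/-- The inclusion of the Hochschild cocycles in the cochains. -/
noncomputable def cocycleHom (n : ℕ) :
    ModuleCat.of k (LinearMap.ker (coboundary k R n)) ⟶ (hochschildComplex k R).X n :=
  ModuleCat.ofHom (LinearMap.ker (coboundary k R n)).subtype

variable (k R) in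
/-- Hochschild cocycles, as elements of the abstract object of cycles. -/
noncomputable def toCycles (n : ℕ) :
    ModuleCat.of k (LinearMap.ker (coboundary k R n)) ⟶ (hochschildComplex k R).cycles n :=
  (hochschildComplex k R).liftCycles (cocycleHom k R n) (n + 1) (by simp)
    (by
      rw [hochschildComplex_d]
      exact ModuleCat.hom_ext (LinearMap.ext fun f => f.2))

lemma iCycles_toCycles {n : ℕ} (f : LinearMap.ker (coboundary k R n)) :
    (hochschildComplex k R).iCycles n (toCycles k R n f) = f.1 := by
  rw [← ModuleCat.comp_apply, toCycles, HomologicalComplex.liftCycles_i]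
  rfl

lemma iCycles_injective (n : ℕ) : Function.Injective ((hochschildComplex k R).iCycles n) :=
  (ModuleCat.mono_iff_injective _).1 inferInstance

variable (k R) in
/-- The cohomology class of a Hochschild cocycle. -/
noncomputable def cls (n : ℕ) : LinearMap.ker (coboundary k R n) →ₗ[k] HH k R n :=
  (toCycles k R n ≫ (hochschildComplex k R).homologyπ n).hom

lemma cls_apply {n : ℕ} (f : LinearMap.ker (coboundary k R n)) :
    cls k R n f = (hochschildComplex k R).homologyπ n (toCycles k R n f) := rfl

lemma cls_surjective (n : ℕ) : Function.Surjective (cls k R n) := by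
  intro h
  obtain ⟨c, rfl⟩ := (ModuleCat.epi_iff_surjective
    ((hochschildComplex k R).homologyπ n)).1 inferInstance h
  have hc := congr($((hochschildComplex k R).iCycles_d n (n + 1)) c)
  rw [hochschildComplex_d] at hc
  refine ⟨⟨(hochschildComplex k R).iCycles n c, hc⟩, ?_⟩
  rw [cls_apply]
  congr 1
  exact iCycles_injective n (iCycles_toCycles _)

lemma cls_eq_zero_iff {n : ℕ} (f : LinearMap.ker (coboundary k R (n + 1))) :
    cls k R (n + 1) f = 0 ↔ ∃ g, coboundary k R n g = f.1 := by
  have hex := ShortComplex.exact_of_g_is_cokernel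
    (ShortComplex.mk _ _ ((hochschildComplex k R).toCycles_comp_homologyπ n (n + 1)))
    ((hochschildComplex k R).homologyIsCokernel n (n + 1) (by simp))
  rw [ShortComplex.moduleCat_exact_iff] at hex
  have ht (g : Cochain k R n) : (hochschildComplex k R).iCycles (n + 1)
      ((hochschildComplex k R).toCycles n (n + 1) g) = coboundary k R n g := by
    have h := congr($((hochschildComplex k R).toCycles_i n (n + 1)) g)
    rw [hochschildComplex_d] at h
    exact h
  rw [cls_apply]
  constructor
  · intro h
    obtain ⟨g, hg⟩ := hex _ h
    refine ⟨g, ?_⟩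
    rw [← ht g, ← iCycles_toCycles f]
    exact congrArg _ hg
  · rintro ⟨g, hg⟩
    have e : (hochschildComplex k R).toCycles n (n + 1) g = toCycles k R (n + 1) f := by
      apply iCycles_injective
      rw [ht, iCycles_toCycles, hg]
    rw [← e]
    exact congr($((hochschildComplex k R).toCycles_comp_homologyπ n (n + 1)) g)

variable {S : Type u} [Ring S] [Algebra k S]

lemma retractCochain_mem_ker (ι : S →ₐ[k] R) (p : R →ₐ[k] S) (h : ∀ s, p (ι s) = s) {n : ℕ}
    {f : Cochain k R n} (hf : f ∈ LinearMap.ker (coboundary k R n)) :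
    retractCochain ι p n f ∈ LinearMap.ker (coboundary k S n) := by
  rw [LinearMap.mem_ker] at hf ⊢
  rw [retractCochain_coboundary ι p h, hf, map_zero]

lemma homologyMap_retractMap_cls (ι : S →ₐ[k] R) (p : R →ₐ[k] S) (h : ∀ s, p (ι s) = s) {n : ℕ}
    (f : LinearMap.ker (coboundary k R n)) :
    HomologicalComplex.homologyMap (retractMap ι p h) n (cls k R n f) =
      cls k S n ⟨retractCochain ι p n f.1, retractCochain_mem_ker ι p h f.2⟩ := by
  rw [cls_apply, cls_apply, ← ModuleCat.comp_apply, HomologicalComplex.homologyπ_naturality,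
    ModuleCat.comp_apply]
  congr 1
  apply iCycles_injective
  rw [← ModuleCat.comp_apply, HomologicalComplex.cyclesMap_i, ModuleCat.comp_apply,
    iCycles_toCycles, iCycles_toCycles]
  rfl

end Cohomology

/-! ### The cohomology of the trivial extension -/

section Main

open scoped RightActions

variable {k S V : Type u} [Field k] [Ring S] [Algebra k S]
  [AddCommGroup V] [Module k V] [Module S V] [Module Sᵐᵒᵖ V] [SMulCommClass S Sᵐᵒᵖ V]
  [IsScalarTower k S V] [IsScalarTower k Sᵐᵒᵖ V]

variable (k S V) in
/-- The restriction of Hochschild cochains of `S ⊕ V` to `S`, composed with the projection to `S`. -/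
noncomputable abbrev baseCochain (n : ℕ) : Cochain k (TrivSqZeroExt S V) n →ₗ[k] Cochain k S n :=
  retractCochain (TrivSqZeroExt.inlAlgHom k S V) (proj k S V) n

lemma baseCochain_apply {n : ℕ} (f : Cochain k (TrivSqZeroExt S V) n) (s : Fin n → S) :
    baseCochain k S V n f s = (f fun i => TrivSqZeroExt.inl (s i)).fst := rfl

lemma baseCochain_coboundary {n : ℕ} (f : Cochain k (TrivSqZeroExt S V) n) :
    baseCochain k S V (n + 1) (coboundary k _ n f) = coboundary k S n (baseCochain k S V n f) :=
  (retractCochain_coboundary _ _ (fun _ => rfl) f).symm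

variable (k S V) in
/-- The map `HHⁿ(S ⊕ V) → HHⁿ(S)` induced by `baseCochain`. -/
noncomputable abbrev baseHH (n : ℕ) : HH k (TrivSqZeroExt S V) n →ₗ[k] HH k S n :=
  (HomologicalComplex.homologyMap
    (retractMap (TrivSqZeroExt.inlAlgHom k S V) (proj k S V) (fun _ => rfl)) n).hom

/-- The extension by zero of a cochain of `S` to `S ⊕ V`. -/
def inflateCochain {n : ℕ} (f : Cochain k S n) : Cochain k (TrivSqZeroExt S V) n :=
  (inlₗ k S V).compMultilinearMap
    (f.compLinearMap fun _ => (TrivSqZeroExt.fstHom k S V).toLinearMap)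

lemma inflateCochain_apply {n : ℕ} (f : Cochain k S n) (x : Fin n → TrivSqZeroExt S V) :
    inflateCochain f x = TrivSqZeroExt.inl (f fun i => (x i).fst) := rfl

lemma baseCochain_inflateCochain {n : ℕ} (f : Cochain k S n) :
    baseCochain k S V n (inflateCochain f) = f := by
  ext s
  simp [baseCochain_apply, inflateCochain_apply]

lemma coboundary_inflateCochain_inl {n : ℕ} (f : Cochain k S n) (s : Fin (n + 1) → S) :
    coboundary k _ n (inflateCochain (V := V) f) (fun i => TrivSqZeroExt.inl (s i)) =
      TrivSqZeroExt.inl (coboundary k S n f s) := by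
  ext
  · have h := congr($(baseCochain_coboundary (inflateCochain (V := V) f)) s)
    rw [baseCochain_inflateCochain] at h
    exact h
  · have e (x : Fin n → TrivSqZeroExt S V) : (inflateCochain f x).snd = 0 := by
      simp [inflateCochain_apply]
    simp [coboundary_apply, e, TrivSqZeroExt.snd_sum]

/-- Inflation commutes with coboundaries up to `V`-valued cochains. -/
lemma fst_coboundary_inflateCochain {n : ℕ} (f : Cochain k S n)
    (x : Fin (n + 1) → TrivSqZeroExt S V) :
    (coboundary k _ n (inflateCochain f) x).fst = coboundary k S n f (fun i => (x i).fst) := by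
  have e (i : Fin n) : (fun l => (i.castSucc.contractNth (· * ·) x l).fst) =
      i.castSucc.contractNth (· * ·) (fun l => (x l).fst) := by
    rw [contractNth_castSucc, contractNth_castSucc]
    funext l
    rcases eq_or_ne l i with rfl | hl
    · simp
    · simp [hl]
  simp only [coboundary_apply, inflateCochain_apply, TrivSqZeroExt.fst_add, TrivSqZeroExt.fst_mul,
    TrivSqZeroExt.fst_inl, TrivSqZeroExt.fst_sum, TrivSqZeroExt.fst_smul, e]
  rfl

/-- A coboundary has no `S`-component on `V ⊗ ⋯ ⊗ V`, since `V² = 0`. -/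
lemma restrictBase_coboundary {n : ℕ} (g : Cochain k (TrivSqZeroExt S V) n) :
    restrictBase (n + 1) (coboundary k _ n g) = 0 := by
  ext v
  have h (i : Fin n) : g (i.castSucc.contractNth (· * ·)
      fun i => (TrivSqZeroExt.inr (v i) : TrivSqZeroExt S V)) = 0 := by
    rw [contractNth_castSucc]
    exact g.map_coord_zero i (by simp)
  simp [restrictBase_apply, coboundary_apply, h]

lemma IsNormal.apply_eq_zero {n : ℕ} {f : Cochain k (TrivSqZeroExt S V) n} (hf : IsNormal f n)
    {x : Fin n → TrivSqZeroExt S V} {i : Fin n} (hi : (x i).snd = 0) : f x = 0 := by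
  rw [← ev_pad f x]
  exact hf _ (i + 1) (by omega) (by omega) (by rw [pad_succ, hi])

/-- A normal cochain only depends on the components of its arguments in `V`. -/
lemma IsNormal.eq_add {n : ℕ} {f : Cochain k (TrivSqZeroExt S V) n} (hf : IsNormal f n) :
    f = extendCochain n (restrictBase n f) + inrCochain n (restrictCochain n f) := by
  have key (x : Fin n → TrivSqZeroExt S V) : f x = f fun i => TrivSqZeroExt.inr (x i).snd := by
    have e : x = (fun i => TrivSqZeroExt.inl (x i).fst) + fun i => TrivSqZeroExt.inr (x i).snd :=
      funext fun i => (TrivSqZeroExt.inl_fst_add_inr_snd_eq _).symm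
    conv_lhs => rw [e]
    rw [MultilinearMap.map_add_univ, Finset.sum_eq_single ∅ _ (by simp), Finset.piecewise_empty]
    intro t _ ht
    obtain ⟨i, hi⟩ := Finset.nonempty_iff_ne_empty.2 ht
    exact hf.apply_eq_zero (i := i) (by rw [Finset.piecewise_eq_of_mem _ _ _ hi]; simp)
  refine MultilinearMap.ext fun x => ?_
  rw [key]
  ext <;> simp [extendCochain_apply, inrCochain_apply, restrictCochain_apply, restrictBase_apply]

variable {e : S}

/-- A cocycle of `S ⊕ V` whose class restricts to zero on `S` is cohomologous to the sum of two
cochains given by bimodule maps on `V ⊗ ⋯ ⊗ V`. -/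
theorem exists_sub_coboundary_eq (hV : IsProjectiveBimodule k S V) (he : IsOffDiagonal V e) {m : ℕ}
    {f : Cochain k (TrivSqZeroExt S V) (m + 1)} (hδ : coboundary k _ (m + 1) f = 0)
    (hf : ∃ g, coboundary k S m g = baseCochain k S V (m + 1) f) :
    ∃ g : Cochain k (TrivSqZeroExt S V) m,
      restrictBase (m + 1) f ∈ bimodHom k S V S (m + 1) ∧
      ∃ ψ ∈ bimodHom k S V V (m + 1), f - coboundary k _ m g =
        extendCochain (m + 1) (restrictBase (m + 1) f) + inrCochain (m + 1) ψ := by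
  obtain ⟨σ, hσ⟩ := exists_isLeftSplitting hV
  obtain ⟨τ, hτ⟩ := exists_isRightSplitting hV
  have hsub {f : Cochain k (TrivSqZeroExt S V) (m + 1)} (hδ : coboundary k _ (m + 1) f = 0)
      (g : Cochain k (TrivSqZeroExt S V) m) :
      coboundary k _ (m + 1) (f - coboundary k _ m g) = 0 := by
    rw [map_sub, hδ, coboundary_coboundary, sub_zero]
  obtain ⟨g₀, hg₀⟩ := hf
  -- the three corrections remove, on `S ⊗ ⋯ ⊗ S`, the `S`-component and the `V`-component, and make
  -- the cocycle normal
  have h1 := hsub hδ (inflateCochain g₀)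
  obtain ⟨g₁, hg₁⟩ := exists_isInitial_sub_coboundary he h1 (fun s => by
    rw [← baseCochain_apply, map_sub, baseCochain_coboundary, baseCochain_inflateCochain, hg₀,
      sub_self, zero_apply])
  have h2 := hsub h1 g₁
  obtain ⟨g₂, hg₂, -⟩ := exists_isNormal_sub_coboundary hσ hτ h2 hg₁
  have h3 := hsub h2 g₂
  have hB : restrictBase (m + 1) (f - coboundary k _ m (inflateCochain g₀) - coboundary k _ m g₁ -
      coboundary k _ m g₂) = restrictBase (m + 1) f := by
    rw [map_sub, map_sub, map_sub, restrictBase_coboundary, restrictBase_coboundary,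
      restrictBase_coboundary, sub_zero, sub_zero, sub_zero]
  have h4 := hg₂.restrictBase_mem h3
  have h5 := hg₂.eq_add
  rw [hB] at h4 h5
  refine ⟨inflateCochain g₀ + g₁ + g₂, h4, _, hg₂.restrictCochain_mem h3, ?_⟩
  rw [← h5, map_add, map_add, ← sub_sub, ← sub_sub]

/-- Every cocycle of `S` extends to a cocycle of `S ⊕ V`: the coboundary of its extension by zero
is `V`-valued, and is the coboundary of a `V`-valued cochain. The extension may be chosen without
component in `S` on `V ⊗ ⋯ ⊗ V`. -/
theorem exists_cocycle_baseCochain_eq (hV : IsProjectiveBimodule k S V) {m : ℕ}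
    {f : Cochain k S (m + 1)} (hδ : coboundary k S (m + 1) f = 0) :
    ∃ F : Cochain k (TrivSqZeroExt S V) (m + 1), coboundary k _ (m + 1) F = 0 ∧
      baseCochain k S V (m + 1) F = f ∧ restrictBase (m + 1) F = 0 := by
  obtain ⟨σ, hσ⟩ := exists_isLeftSplitting hV
  obtain ⟨τ, hτ⟩ := exists_isRightSplitting hV
  obtain ⟨g, hg, hg'⟩ := exists_isNormal_sub_coboundary hσ hτ
    (f := coboundary k _ (m + 1) (inflateCochain f)) (coboundary_coboundary _)
    (isInitial_of_forall fun s => by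
      rw [coboundary_inflateCochain_inl, hδ, zero_apply, TrivSqZeroExt.inl_zero])
  have hg₀ := hg' fun x => by rw [fst_coboundary_inflateCochain, hδ, zero_apply]
  have hB : restrictBase (m + 1) (inflateCochain f - g) = 0 := by
    ext v
    have : f (fun _ => 0) = 0 := f.map_zero
    simp [restrictBase_apply, inflateCochain_apply, hg₀, this]
  rw [← map_sub] at hg
  refine ⟨inflateCochain f - g, ?_, ?_, hB⟩
  · -- both components of the normal cochain vanish on `V ⊗ ⋯ ⊗ V`
    rw [hg.eq_add, restrictBase_coboundary, map_zero, zero_add]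
    have : restrictCochain (m + 1 + 1) (coboundary k _ (m + 1) (inflateCochain f - g)) = 0 := by
      ext v
      rw [restrictCochain_apply, snd_coboundary_apply_inr, hB]
      simp
    rw [this, map_zero]
  · rw [map_sub, baseCochain_inflateCochain, sub_eq_self]
    ext s
    rw [baseCochain_apply, hg₀, zero_apply]

lemma baseCochain_extendCochain {n : ℕ} (φ : MultilinearMap k (fun _ : Fin (n + 1) => V) S) :
    baseCochain k S V (n + 1) (extendCochain (n + 1) φ) = 0 := by
  ext s
  have : φ (fun _ => 0) = 0 := φ.map_zero
  simp [baseCochain_apply, extendCochain_apply, this]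

lemma baseCochain_inrCochain {n : ℕ} (ψ : MultilinearMap k (fun _ : Fin n => V) V) :
    baseCochain k S V n (inrCochain n ψ) = 0 := by
  ext s
  simp [baseCochain_apply, inrCochain_apply]

/-- The class in `HH(S)` and the bimodule map `V ⊗ ⋯ ⊗ V → S` given by a cocycle of `S ⊕ V`. -/
noncomputable def evenMap (D : Subalgebra k S) (n : ℕ) :
    LinearMap.ker (coboundary k (TrivSqZeroExt S V) n) →ₗ[k]
      HH k S n × LinearMap.ker (connecting V D n) :=
  LinearMap.prod (baseHH k S V n ∘ₗ cls k _ n)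
    (LinearMap.codRestrict _
      (LinearMap.codRestrict _ (restrictBase n ∘ₗ Submodule.subtype _) fun f =>
        restrictBase_mem fun x => congrArg TrivSqZeroExt.fst congr($(LinearMap.mem_ker.1 f.2) x))
      fun f => Subtype.ext (by
        refine (connecting_restrictBase D f.1 _).trans ?_
        rw [LinearMap.mem_ker.1 f.2, map_zero]
        rfl))

lemma evenMap_fst (D : Subalgebra k S) {n : ℕ}
    (f : LinearMap.ker (coboundary k (TrivSqZeroExt S V) n)) :
    (evenMap D n f).1 = baseHH k S V n (cls k _ n f) := rfl

lemma evenMap_snd (D : Subalgebra k S) {n : ℕ}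
    (f : LinearMap.ker (coboundary k (TrivSqZeroExt S V) n)) :
    (evenMap D n f).2.1.1 = restrictBase n f.1 := rfl

lemma baseHH_cls {n : ℕ} (f : LinearMap.ker (coboundary k (TrivSqZeroExt S V) n)) :
    baseHH k S V n (cls k _ n f) = cls k S n ⟨baseCochain k S V n f.1,
      retractCochain_mem_ker _ _ (fun _ => rfl) f.2⟩ :=
  homologyMap_retractMap_cls _ _ _ f

lemma baseHH_surjective (hV : IsProjectiveBimodule k S V) (n : ℕ) :
    Function.Surjective (baseHH k S V (n + 1)) := by
  intro z
  obtain ⟨f, rfl⟩ := cls_surjective (n + 1) z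
  obtain ⟨F, hF, hF', -⟩ := exists_cocycle_baseCochain_eq hV f.2
  exact ⟨cls k _ (n + 1) ⟨F, hF⟩, (baseHH_cls _).trans (congrArg _ (Subtype.ext hF'))⟩

lemma evenMap_surjective (hV : IsProjectiveBimodule k S V) (D : Subalgebra k S) (n : ℕ) :
    Function.Surjective (evenMap (V := V) D (n + 1)) := by
  rintro ⟨z, φ, hφ⟩
  obtain ⟨f, rfl⟩ := cls_surjective (n + 1) z
  obtain ⟨F, hF, hF', hF''⟩ := exists_cocycle_baseCochain_eq hV f.2
  have h : coboundary k _ (n + 1) (F + extendCochain (n + 1) φ.1) = 0 := by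
    rw [map_add, hF, coboundary_extendCochain D, LinearMap.mem_ker.1 hφ, zero_add]
    exact map_zero _
  refine ⟨⟨_, h⟩, Prod.ext ?_ (Subtype.ext (Subtype.ext ?_))⟩
  · rw [evenMap_fst, baseHH_cls]
    refine congrArg _ (Subtype.ext ?_)
    change baseCochain k S V (n + 1) (F + extendCochain (n + 1) φ.1) = f.1
    rw [map_add, hF', baseCochain_extendCochain, add_zero]
  · rw [evenMap_snd, map_add, hF'', restrictBase_extendCochain, zero_add]

/-- In positive even degrees, the class of a cocycle vanishes as soon as both of its components
vanish, since there are no nonzero bimodule maps from `V ⊗ ⋯ ⊗ V` to `V`. -/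
lemma cls_eq_zero_iff_of_even (hV : IsProjectiveBimodule k S V) (he : IsOffDiagonal V e)
    {n : ℕ} (hn : Even (n + 1)) (f : LinearMap.ker (coboundary k (TrivSqZeroExt S V) (n + 1))) :
    cls k _ (n + 1) f = 0 ↔
      baseHH k S V (n + 1) (cls k _ (n + 1) f) = 0 ∧ restrictBase (n + 1) f.1 = 0 := by
  constructor
  · intro h
    refine ⟨by rw [h, map_zero], ?_⟩
    obtain ⟨g, hg⟩ := (cls_eq_zero_iff _).1 h
    rw [← hg, restrictBase_coboundary]
  · rintro ⟨h1, h2⟩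
    rw [baseHH_cls] at h1
    obtain ⟨g, -, ψ, hψ, hg⟩ := exists_sub_coboundary_eq hV he f.2 ((cls_eq_zero_iff _).1 h1)
    rw [he.bimodHom_eq_bot_of_even hn, Submodule.mem_bot] at hψ
    rw [h2, hψ, map_zero, map_zero, add_zero, sub_eq_zero] at hg
    exact (cls_eq_zero_iff _).2 ⟨g, hg.symm⟩

lemma evenMap_eq_iff (hV : IsProjectiveBimodule k S V) (he : IsOffDiagonal V e) (D : Subalgebra k S)
    {n : ℕ} (hn : Even (n + 1))
    (f g : LinearMap.ker (coboundary k (TrivSqZeroExt S V) (n + 1))) :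
    evenMap D (n + 1) f = evenMap D (n + 1) g ↔ cls k _ (n + 1) f = cls k _ (n + 1) g := by
  rw [← sub_eq_zero (a := cls k _ (n + 1) f), ← map_sub, cls_eq_zero_iff_of_even hV he hn, map_sub,
    map_sub, sub_eq_zero, Submodule.coe_sub, map_sub, sub_eq_zero, Prod.ext_iff, Subtype.ext_iff,
    Subtype.ext_iff]
  rfl

/-- Two surjective linear maps with the same fibres have isomorphic targets. -/
lemma exists_linearEquiv_of_fibers_eq {R Z X Y : Type*} [Semiring R] [AddCommMonoid Z]
    [AddCommMonoid X] [AddCommMonoid Y] [Module R Z] [Module R X] [Module R Y]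
    {a : Z →ₗ[R] X} {b : Z →ₗ[R] Y}
    (ha : Function.Surjective a) (hb : Function.Surjective b)
    (h : ∀ z w, b z = b w ↔ a z = a w) : ∃ E : X ≃ₗ[R] Y, ∀ z, E (a z) = b z := by
  have key (z : Z) : b (Function.surjInv ha (a z)) = b z := (h _ _).2 (Function.surjInv_eq ha _)
  let F : X →ₗ[R] Y :=
    { toFun x := b (Function.surjInv ha x)
      map_add' x y := by
        obtain ⟨z, rfl⟩ := ha x
        obtain ⟨w, rfl⟩ := ha y
        rw [← map_add, key, key, key, map_add]
      map_smul' c x := by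
        obtain ⟨z, rfl⟩ := ha x
        rw [← map_smul, key, key, map_smul, RingHom.id_apply] }
  refine ⟨LinearEquiv.ofBijective F ⟨fun x y hxy => ?_, fun y => ?_⟩, key⟩
  · obtain ⟨z, rfl⟩ := ha x
    obtain ⟨w, rfl⟩ := ha y
    exact (h _ _).1 ((key z).symm.trans (hxy.trans (key w)))
  · obtain ⟨z, rfl⟩ := hb y
    exact ⟨a z, key z⟩

/-- In positive even degrees, `HHⁿ(S ⊕ V)` is the direct sum of `HHⁿ(S)` and the kernel of the
connecting map. -/
theorem exists_equiv_of_even (hV : IsProjectiveBimodule k S V) (he : IsOffDiagonal V e)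
    (D : Subalgebra k S) {n : ℕ} (h0 : 0 < n) (hn : Even n) :
    ∃ E : HH k (TrivSqZeroExt S V) n ≃ₗ[k] HH k S n × LinearMap.ker (connecting V D n),
      ∀ z, (E z).1 = baseHH k S V n z := by
  obtain ⟨n, rfl⟩ : ∃ m, n = m + 1 := ⟨n - 1, by omega⟩
  obtain ⟨E, hE⟩ := exists_linearEquiv_of_fibers_eq
    (cls_surjective (R := TrivSqZeroExt S V) (n + 1)) (evenMap_surjective hV D n)
    (evenMap_eq_iff hV he D hn)
  refine ⟨E, fun z => ?_⟩
  obtain ⟨f, rfl⟩ := cls_surjective (n + 1) z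
  rw [hE, evenMap_fst]

/-- The cohomology class of a bimodule map `V ⊗ ⋯ ⊗ V → V`. -/
noncomputable def inrClass (k S V : Type u) [Field k] [Ring S] [Algebra k S]
    [AddCommGroup V] [Module k V] [Module S V] [Module Sᵐᵒᵖ V] [SMulCommClass S Sᵐᵒᵖ V]
    [IsScalarTower k S V] [IsScalarTower k Sᵐᵒᵖ V] (n : ℕ) :
    bimodHom k S V V n →ₗ[k] HH k (TrivSqZeroExt S V) n :=
  cls k _ n ∘ₗ LinearMap.codRestrict _ (inrCochain n ∘ₗ Submodule.subtype _)
    fun ψ => coboundary_inrCochain ψ.2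

lemma inrClass_apply {n : ℕ} (ψ : bimodHom k S V V n) : inrClass k S V n ψ =
    cls k _ n ⟨inrCochain n ψ.1, coboundary_inrCochain ψ.2⟩ := rfl

/-- A cochain given by a bimodule map `ψ` is the coboundary of some `g` exactly if `ψ` is in the image
of the connecting map, namely of the `S`-component of `g` on `V ⊗ ⋯ ⊗ V`. -/
lemma ker_inrClass (D : Subalgebra k S) (n : ℕ) :
    LinearMap.ker (inrClass k S V (n + 1)) = LinearMap.range (connecting V D n) := by
  ext ψ
  rw [LinearMap.mem_ker, inrClass_apply, cls_eq_zero_iff, LinearMap.mem_range]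
  constructor
  · rintro ⟨g, hg⟩
    refine ⟨⟨restrictBase n g, restrictBase_mem fun x => ?_⟩, Subtype.ext ?_⟩
    · rw [hg, inrCochain_apply, TrivSqZeroExt.fst_inr]
    · rw [connecting_restrictBase, hg, restrictCochain_inrCochain]
  · rintro ⟨φ, rfl⟩
    exact ⟨_, coboundary_extendCochain D φ⟩

/-- For even `n`, `HHⁿ⁺¹(S ⊕ V)` is an extension of `HHⁿ⁺¹(S)` by the cokernel of the connecting
map. -/
theorem exists_exact_of_even (hV : IsProjectiveBimodule k S V) (he : IsOffDiagonal V e)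
    (D : Subalgebra k S) {n : ℕ} (hn : Even n) :
    ∃ ι : (bimodHom k S V V (n + 1) ⧸ LinearMap.range (connecting V D n)) →ₗ[k]
        HH k (TrivSqZeroExt S V) (n + 1),
      Function.Injective ι ∧ Function.Exact ι (baseHH k S V (n + 1)) ∧
      Function.Surjective (baseHH k S V (n + 1)) := by
  refine ⟨Submodule.liftQ _ (inrClass k S V (n + 1)) (ker_inrClass D n).ge, ?_, ?_,
    baseHH_surjective hV n⟩
  · rw [← LinearMap.ker_eq_bot, Submodule.ker_liftQ_eq_bot _ _ _ (ker_inrClass D n).le]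
  · intro z
    constructor
    · intro hz
      obtain ⟨f, rfl⟩ := cls_surjective (n + 1) z
      rw [baseHH_cls] at hz
      obtain ⟨g, hφ, ψ, hψ, hg⟩ := exists_sub_coboundary_eq hV he f.2 ((cls_eq_zero_iff _).1 hz)
      rw [he.bimodHom_eq_bot_of_odd hn.add_one, Submodule.mem_bot] at hφ
      rw [hφ, map_zero, zero_add] at hg
      refine ⟨Submodule.Quotient.mk ⟨ψ, hψ⟩, ?_⟩
      change inrClass k S V (n + 1) ⟨ψ, hψ⟩ = _
      rw [inrClass_apply, ← sub_eq_zero, ← map_sub, cls_eq_zero_iff]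
      refine ⟨-g, ?_⟩
      rw [map_neg, Submodule.coe_sub]
      change _ = inrCochain (n + 1) ψ - f.1
      rw [← hg]
      abel
    · rintro ⟨q, rfl⟩
      obtain ⟨ψ, rfl⟩ := Submodule.Quotient.mk_surjective _ q
      change baseHH k S V (n + 1) (inrClass k S V (n + 1) ψ) = 0
      rw [inrClass_apply, baseHH_cls, cls_eq_zero_iff]
      exact ⟨0, (map_zero _).trans (baseCochain_inrCochain ψ.1).symm⟩

end Main

/-! ### The null-square algebra -/

section Square

open scoped RightActions

/-- The idempotent `(1, 0)` of `A × B` acts on the left of `M ⊕ N` by the projection to `N`, and on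
the right by the projection to `M`. -/
lemma isOffDiagonal_corner {A B M N : Type u} [Ring A] [Ring B] [AddCommGroup M] [AddCommGroup N]
    [Module B M] [Module Aᵐᵒᵖ M] [SMulCommClass B Aᵐᵒᵖ M]
    [Module A N] [Module Bᵐᵒᵖ N] [SMulCommClass A Bᵐᵒᵖ N] :
    IsOffDiagonal (Corner M N) ((1, 0) : A × B) where
  comm s := by simp [Prod.ext_iff]
  idem := by simp
  add v := by
    refine Prod.ext ?_ ?_
    · change (0 : B) • v.1 + MulOpposite.op (1 : A) • v.1 = v.1
      simp
    · change (1 : A) • v.2 + MulOpposite.op (0 : B) • v.2 = v.2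
      simp

end Square

end NullSquare

theorem mainTheorem7 {k A B M N : Type u} [Field k] [Ring A] [Ring B] [Algebra k A] [Algebra k B]
    [AddCommGroup M] [Module k M] [Module B M] [Module Aᵐᵒᵖ M] [SMulCommClass B Aᵐᵒᵖ M]
    [IsScalarTower k B M] [IsScalarTower k Aᵐᵒᵖ M]
    [AddCommGroup N] [Module k N] [Module A N] [Module Bᵐᵒᵖ N] [SMulCommClass A Bᵐᵒᵖ N]
    [IsScalarTower k A N] [IsScalarTower k Bᵐᵒᵖ N]
    (hproj : NullSquare.IsProjectiveBimodule k (A × B) (NullSquare.Corner M N))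
    (m : ℕ) (hm : 0 < m) :
    (∃ e : NullSquare.HH k (NullSquare.NullSquareAlgebra A B M N) (2 * m) ≃ₗ[k]
        NullSquare.HH k (A × B) (2 * m) × LinearMap.ker (NullSquare.nablaPrime k A B M N m),
      ∀ z, (e z).1 = NullSquare.projHH k A B M N (2 * m) z) ∧
    (∃ ι : (NullSquare.bimodHom k (A × B) (NullSquare.Corner M N) (NullSquare.Corner M N)
          (2 * m + 1) ⧸ LinearMap.range (NullSquare.nablaPrime k A B M N m)) →ₗ[k]
        NullSquare.HH k (NullSquare.NullSquareAlgebra A B M N) (2 * m + 1),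
      Function.Injective ι ∧
      Function.Exact ι (NullSquare.projHH k A B M N (2 * m + 1)) ∧
      Function.Surjective (NullSquare.projHH k A B M N (2 * m + 1))) := by
  exact ⟨NullSquare.exists_equiv_of_even hproj NullSquare.isOffDiagonal_corner
      (NullSquare.diagonal k A B) (by omega) (even_two_mul m),
    NullSquare.exists_exact_of_even hproj NullSquare.isOffDiagonal_corner
      (NullSquare.diagonal k A B) (even_two_mul m)⟩
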